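/- Setting. Let $T>0$, $V_0\in C^1(\mathbb R^d)$ with $\int e^{-V_0}<\infty$, and $p_0(dx)\propto e^{-V_0(x)}dx$. Let $f,g:[0,T]\to[0,\infty)$ be Borel with $\int_0^T f<\infty$, $\int_0^T g^2<\infty$ and $g(s)>0$ for $s\in(0,T]$. Put $a(s)=e^{-\int_0^s f}$, $\sigma^2(s)=\int_0^s\bigl(\tfrac{a(s)}{a(u)}g(u)\bigr)^2du$, and let $p_s=(S_{a(s)}p_0)*\mathcal N(0,\sigma^2(s)I_d)$, where $S_a$ is the push-forward under $x\mapsto ax$. Let $s_\theta$ be a Borel measurable learned score and $e_s=s_\theta(\cdot,s)-\nabla\log p_s$. The ideal and learned reverse drifts are $$b_t(x)=f(T-t)x+g^2(T-t)\nabla\log p_{T-t}(x),\qquad \hat b_t(x)=f(T-t)x+g^2(T-t)s_\theta(x,T-t).$$ Structural assumptions. (1) There are $\alpha,M>0$ such that, with $f_M(r)=2\sqrt M\tanh(\tfrac12\sqrt M r)$, for every $r>0$ $$\inf_{\|x-y\|=r}\frac{\langle\nabla V_0(x)-\nabla V_0(y),x-y\rangle}{\|x-y\|^2}\ge\alpha-\tfrac1r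 f_M(r).$$ (2) There is a measurable $\varepsilon:(0,T]\to[0,\infty)$ with $\mathbb E_{X\sim p_s}\|e_s(X)\|^2\le\varepsilon^2(s)$ for $s\in(0,T]$ and $g^2\varepsilon$ integrable on $(0,T]$. (3) There is a measurable $\ell:(0,T]\to\mathbb R$ with $\langle e_s(x)-e_s(y),x-y\rangle\le\ell(s)\|x-y\|^2$ for all $s\in(0,T]$ and $x,y\in\mathbb R^d$. Put $$\alpha_s=\frac{\alpha}{a^2(s)+\alpha\sigma^2(s)},\quad M_s=\frac{M a^2(s)}{(a^2(s)+\alpha\sigma^2(s))^2},\quad \mathfrak b(s)=f(s)+g^2(s)\bigl(M_s+\ell(s)-\alpha_s\bigr),\quad \Gamma(s)=\int_0^s\mathfrak b(u)\,du,$$ and assume that $\mathfrak b$ is integrable on $(0,T]$. Dynamics. Let $(\Omega,\mathcal F,(\mathcal F_t),\mathbb P)$ be a complete filtered probability space with a $d$-dimensional $(\mathcal F_t)$-Brownian motion $B$. Assume that the ideal reverse SDE $d\widetilde X_t=b_t(\widetilde X_t)dt+g(T-t)dB_t$ has an adapted solution on $[0,T]$ with $\mathrm{Law}(\widetilde X_t)=p_{T-t}$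 for all $t\in[0,T]$. Let $0=t_0<\dots<t_N=T$, and assume that the learned reverse SDE $dY_t=\hat b_t(Y_t)dt+g(T-t)dB_t$ is strongly well posed on $[t_k,T]$ for every $k=0,\dots,N-1$ (in particular on $[0,T]$): every integrable $\mathcal F_{t_k}$-measurable initial value at time $t_k$ admits a strong solution on $[t_k,T]$ (one adapted to the augmented filtration generated by the initial value and by the increments of $B$ after $t_k$), and solutions are pathwise unique. Let $P_k(x,\cdot)$ be the law at time $t_{k+1}$ of the strong solution of the learned SDE started from $x$ at time $t_k$. Sampler. Let $(Z_{t_k})_{k=0}^N$ be random vectors with finite second moments, $Z_{t_0}\sim\hat p_T$ and $\mathrm{Law}(Z_{t_{k+1}}\mid Z_{t_k}=x)=\Psi_k(x,\cdot)$ for Markov kernels $\Psi_k$, and let $\xi_k:\mathbb R^d\to[0,\infty)$ be Borel with $$W_2\bigl(P_k(x,\cdot),\Psi_k(x,\cdot)\bigr)\le\xi_k(x),\qquad x\in\mathbb R^d,\ k=0,\dots,N-1.$$ Proposition (direct full-horizon Euclidean bound). Under these assumptions, $$W_2\bigl(\mathrm{Law}(Z_{t_N}),p_0\bigr)\le e^{\Gamma(T)}W_2(\hat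 p_T,p_T)+\sum_{k=0}^{N-1}e^{\Gamma(T-t_{k+1})}\bigl(\mathbb E[\xi_k(Z_{t_k})^2]\bigr)^{1/2}+\int_0^T e^{\Gamma(s)}g^2(s)\varepsilon(s)\,ds .$$ -/

import Mathlib

open MeasureTheory ProbabilityTheory Set
open scoped ENNReal NNReal RealInnerProductSpace

noncomputable section

namespace ReverseDiffusion

/-- `ℝ^d` with its Euclidean norm. -/
abbrev E (d : ℕ) : Type := EuclideanSpace ℝ (Fin d)

/-! ### The quadratic Wasserstein distance -/

/-- `W₂(μ, ν)`, valued in `[0, ∞]`: the square root of the infimum of `∫ ‖x - y‖² dπ` over all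
couplings `π` of `μ` and `ν`. -/
def W2 {d : ℕ} (μ ν : Measure (E d)) : ℝ≥0∞ :=
  (⨅ (π : Measure (E d × E d)) (_ : π.map Prod.fst = μ ∧ π.map Prod.snd = ν),
    ∫⁻ z, ‖z.1 - z.2‖ₑ ^ 2 ∂π) ^ (1 / 2 : ℝ)

/-! ### The forward marginals -/

/-- `a(s) = exp(-∫₀ˢ f)`. -/
def aCoef (f : ℝ → ℝ) (s : ℝ) : ℝ := Real.exp (-∫ u in (0 : ℝ)..s, f u)

/-- `σ²(s) = ∫₀ˢ (a(s) g(u) / a(u))² du`. -/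
def sigmaSq (f g : ℝ → ℝ) (s : ℝ) : ℝ :=
  ∫ u in (0 : ℝ)..s, (aCoef f s / aCoef f u * g u) ^ 2

/-- The data law `p₀(dx) ∝ exp(-V₀(x)) dx`. -/
def dataLaw {d : ℕ} (V₀ : E d → ℝ) : Measure (E d) :=
  (volume : Measure (E d)).tilted (fun x => -V₀ x)

/-- The forward marginal `p_s = (S_{a(s)} p₀) * N(0, σ²(s) I)`; for `s = 0` this is `p₀`. -/
def forwardMarginal {d : ℕ} (f g : ℝ → ℝ) (V₀ : E d → ℝ) (s : ℝ) : Measure (E d) :=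
  Measure.conv ((dataLaw V₀).map (fun x => aCoef f s • x))
    ((stdGaussian (E d)).map (fun x => Real.sqrt (sigmaSq f g s) • x))

/-- The density at `z` of the Gaussian law `N(0, v I)` on `ℝ^d`, `v > 0`. -/
def gaussianDensity {d : ℕ} (v : ℝ) (z : E d) : ℝ :=
  (2 * Real.pi * v) ^ (-(d : ℝ) / 2) * Real.exp (-‖z‖ ^ 2 / (2 * v))

/-- The smooth Lebesgue density of `p_s` for `s > 0`. -/
def forwardDensity {d : ℕ} (f g : ℝ → ℝ) (V₀ : E d → ℝ) (s : ℝ) (x : E d) : ℝ :=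
  ∫ y, gaussianDensity (sigmaSq f g s) (x - aCoef f s • y) ∂(dataLaw V₀)

/-- The score `∇ log p_s`; at `s = 0` it is `-∇V₀`. -/
def score {d : ℕ} (f g : ℝ → ℝ) (V₀ : E d → ℝ) (s : ℝ) (x : E d) : E d :=
  if s = 0 then -gradient V₀ x
  else gradient (fun z => Real.log (forwardDensity f g V₀ s z)) x

/-! ### The structural assumptions -/

/-- The defect function `f_M(r) = 2 √M tanh(√M r / 2)`. -/
def fDefect (M r : ℝ) : ℝ := 2 * Real.sqrt M * Real.tanh (1 / 2 * Real.sqrt M * r)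

/-- Weak log-concavity of `exp(-V₀)` with parameters `α, M > 0`; the lower bound on the infimum over
pairs at distance `r` is written as a lower bound for each such pair. -/
structure WeakLogConcave {d : ℕ} (V₀ : E d → ℝ) (α M : ℝ) : Prop where
  alpha_pos : 0 < α
  M_pos : 0 < M
  profile : ∀ r : ℝ, 0 < r → ∀ x y : E d, ‖x - y‖ = r →
    α - 1 / r * fDefect M r ≤ ⟪gradient V₀ x - gradient V₀ y, x - y⟫ / ‖x - y‖ ^ 2

/-- The score error `e_s = s_θ(·, s) - ∇ log p_s`. -/
def scoreError {d : ℕ} (f g : ℝ → ℝ) (V₀ : E d → ℝ) (sθ : ℝ → E d → E d) (s : ℝ) (x : E d) :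
    E d :=
  sθ s x - score f g V₀ s x

/-- `L²(p_s)` control of the score error by `ε(s)`, with `g² ε` integrable on `(0, T]`. -/
structure ScoreErrorL2 {d : ℕ} (f g : ℝ → ℝ) (V₀ : E d → ℝ) (sθ : ℝ → E d → E d) (T : ℝ)
    (ε : ℝ → ℝ) : Prop where
  measurable : Measurable ε
  nonneg : ∀ s ∈ Ioc 0 T, 0 ≤ ε s
  bound : ∀ s ∈ Ioc 0 T,
    ∫⁻ x, ‖scoreError f g V₀ sθ s x‖ₑ ^ 2 ∂(forwardMarginal f g V₀ s) ≤ ENNReal.ofReal (ε s ^ 2)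
  integrable : IntegrableOn (fun s => g s ^ 2 * ε s) (Ioc 0 T)

/-- One-sided monotonicity control of the score error by `ℓ(s)`. -/
structure ScoreErrorMonotone {d : ℕ} (f g : ℝ → ℝ) (V₀ : E d → ℝ) (sθ : ℝ → E d → E d) (T : ℝ)
    (ℓ : ℝ → ℝ) : Prop where
  measurable : Measurable ℓ
  bound : ∀ s ∈ Ioc 0 T, ∀ x y : E d,
    ⟪scoreError f g V₀ sθ s x - scoreError f g V₀ sθ s y, x - y⟫ ≤ ℓ s * ‖x - y‖ ^ 2

/-- `α_s = α / (a²(s) + α σ²(s))`. -/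
def alphaS (f g : ℝ → ℝ) (α s : ℝ) : ℝ := α / (aCoef f s ^ 2 + α * sigmaSq f g s)

/-- `M_s = M a²(s) / (a²(s) + α σ²(s))²`. -/
def MS (f g : ℝ → ℝ) (α M s : ℝ) : ℝ :=
  M * aCoef f s ^ 2 / (aCoef f s ^ 2 + α * sigmaSq f g s) ^ 2

/-- The Euclidean load `𝔟(s) = f(s) + g²(s) (M_s + ℓ(s) - α_s)`. -/
def load (f g : ℝ → ℝ) (α M : ℝ) (ℓ : ℝ → ℝ) (s : ℝ) : ℝ :=
  f s + g s ^ 2 * (MS f g α M s + ℓ s - alphaS f g α s)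

/-- `Γ(s) = ∫₀ˢ 𝔟(u) du`. -/
def Gam (f g : ℝ → ℝ) (α M : ℝ) (ℓ : ℝ → ℝ) (s : ℝ) : ℝ :=
  ∫ u in (0 : ℝ)..s, load f g α M ℓ u

/-- The reverse drift `(t, x) ↦ f(T - t) x + g²(T - t) S(T - t, x)` built from a score field `S`.
The exact score gives the ideal drift `b`, the learned score the learned drift `b̂`. -/
def reverseDrift {d : ℕ} (f g : ℝ → ℝ) (T : ℝ) (S : ℝ → E d → E d) (t : ℝ) (x : E d) : E d :=
  f (T - t) • x + g (T - t) ^ 2 • S (T - t) x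

/-! ### Stochastic differential equations with deterministic isotropic noise -/

/-- `B = (B_t)_{t ≥ 0}` is a standard `d`-dimensional Brownian motion with respect to the
filtration `F` under `P`. (Only times `t ≥ 0` matter.) -/
structure IsBrownianMotion {d : ℕ} {Ω : Type*} {mΩ : MeasurableSpace Ω} (F : Filtration ℝ mΩ)
    (B : ℝ → Ω → E d) (P : Measure Ω) : Prop where
  adapted : ∀ t, 0 ≤ t → Measurable[F t] (B t)
  zero : ∀ᵐ ω ∂P, B 0 ω = 0
  cont : ∀ᵐ ω ∂P, ContinuousOn (fun t => B t ω) (Ici 0)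
  law : ∀ s t, 0 ≤ s → s ≤ t →
    P.map (fun ω => B t ω - B s ω) = (stdGaussian (E d)).map (fun x => Real.sqrt (t - s) • x)
  indep : ∀ s t, 0 ≤ s → s ≤ t →
    Indep (MeasurableSpace.comap (fun ω => B t ω - B s ω) inferInstance) (F s) P

/-- The step function `∑ᵢ cᵢ 1_{(pᵢ, qᵢ]}`. -/
def stepFn {n : ℕ} (c p q : Fin n → ℝ) (r : ℝ) : ℝ :=
  ∑ i, c i * (Ioc (p i) (q i)).indicator (fun _ => (1 : ℝ)) r

/-- The integral `∑ᵢ cᵢ (B_{qᵢ} - B_{pᵢ})` of a step function against `B`. -/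
def stepIntegral {d : ℕ} {Ω : Type*} (B : ℝ → Ω → E d) {n : ℕ} (c p q : Fin n → ℝ) (ω : Ω) : E d :=
  ∑ i, c i • (B (q i) ω - B (p i) ω)

/-- `N = ∫_u^t h(r) dB_r` for a deterministic `h ∈ L²(u, t)`: `N` is the `L²(P)`-limit of the
integrals of step functions on `(u, t]` that converge to `h` in `L²(u, t)`. -/
def HasWienerIntegral {d : ℕ} {Ω : Type*} {mΩ : MeasurableSpace Ω} (h : ℝ → ℝ)
    (B : ℝ → Ω → E d) (P : Measure Ω) (u t : ℝ) (N : Ω → E d) : Prop :=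
  ∀ δ : ℝ≥0∞, 0 < δ → ∃ (n : ℕ) (c p q : Fin n → ℝ),
    (∀ i, u ≤ p i ∧ p i ≤ q i ∧ q i ≤ t) ∧
    ∫⁻ r in Ioc u t, ‖h r - stepFn c p q r‖ₑ ^ 2 < δ ∧
    ∫⁻ ω, ‖N ω - stepIntegral B c p q ω‖ₑ ^ 2 ∂P < δ

/-- `Y` solves `dY_t = b_t(Y_t) dt + σ(t) dB_t` on `[u, v]` with `Y_u = ξ`, is adapted to `𝓖`
there, and has almost surely continuous paths. -/
structure IsSolution {d : ℕ} {Ω : Type*} {mΩ : MeasurableSpace Ω} (𝓖 : ℝ → MeasurableSpace Ω)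
    (B : ℝ → Ω → E d) (P : Measure Ω) (b : ℝ → E d → E d) (σ : ℝ → ℝ) (u v : ℝ) (ξ : Ω → E d)
    (Y : ℝ → Ω → E d) : Prop where
  adapted : ∀ t ∈ Icc u v, Measurable[𝓖 t] (Y t)
  init : ∀ᵐ ω ∂P, Y u ω = ξ ω
  cont : ∀ᵐ ω ∂P, ContinuousOn (fun t => Y t ω) (Icc u v)
  drift_integrable : ∀ᵐ ω ∂P, IntervalIntegrable (fun r => b r (Y r ω)) volume u v
  eq : ∀ t ∈ Icc u v,
    HasWienerIntegral σ B P u t (fun ω => Y t ω - Y u ω - ∫ r in u..t, b r (Y r ω))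

/-- The `P`-augmented σ-algebra generated by `ξ` and by the noise `B_r - B_u`, `u ≤ r ≤ t`. -/
abbrev inputSigma {d : ℕ} {Ω : Type*} {mΩ : MeasurableSpace Ω} (B : ℝ → Ω → E d) (P : Measure Ω)
    (u : ℝ) (ξ : Ω → E d) (t : ℝ) : MeasurableSpace Ω :=
  MeasurableSpace.comap ξ inferInstance ⊔
    (⨆ r ∈ Icc u t, MeasurableSpace.comap (fun ω => B r ω - B u ω) inferInstance) ⊔
    MeasurableSpace.generateFrom {A | MeasurableSet A ∧ P A = 0}

/-- A strong solution: a solution which is a functional of the initial value and of the noise. -/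
def IsStrongSolution {d : ℕ} {Ω : Type*} {mΩ : MeasurableSpace Ω} (B : ℝ → Ω → E d)
    (P : Measure Ω) (b : ℝ → E d → E d) (σ : ℝ → ℝ) (u v : ℝ) (ξ : Ω → E d)
    (Y : ℝ → Ω → E d) : Prop :=
  IsSolution (inputSigma B P u ξ) B P b σ u v ξ Y

/-- Strong well posedness on `[u, v]`: every integrable `F_u`-measurable initial value admits a
strong solution, and solutions are pathwise unique. -/
def StronglyWellPosed {d : ℕ} {Ω : Type*} {mΩ : MeasurableSpace Ω} (F : Filtration ℝ mΩ)
    (B : ℝ → Ω → E d) (P : Measure Ω) (b : ℝ → E d → E d) (σ : ℝ → ℝ) (u v : ℝ) : Prop :=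
  ∀ ξ : Ω → E d, Measurable[F u] ξ → Integrable ξ P →
    (∃ Y : ℝ → Ω → E d, IsStrongSolution B P b σ u v ξ Y) ∧
    ∀ Y Y' : ℝ → Ω → E d, IsSolution F B P b σ u v ξ Y → IsSolution F B P b σ u v ξ Y' →
      ∀ᵐ ω ∂P, ∀ t ∈ Icc u v, Y t ω = Y' t ω

open Classical in
/-- The transition law `P_{u,v}(x, ·)`: the law of `Y_v`, where `Y` is the strong solution on
`[u, v]` with `Y_u = x` (by convention `0` if there is none). -/
def transitionLaw {d : ℕ} {Ω : Type*} {mΩ : MeasurableSpace Ω} (B : ℝ → Ω → E d)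
    (P : Measure Ω) (b : ℝ → E d → E d) (σ : ℝ → ℝ) (u v : ℝ) (x : E d) : Measure (E d) :=
  if h : ∃ Y : ℝ → Ω → E d, IsStrongSolution B P b σ u v (fun _ => x) Y then
    P.map (h.choose v)
  else 0

end ReverseDiffusion

end

/-!
The argument couples the sampler with the ideal reverse trajectory and lets their distance grow at
the rate dictated by the monotonicity of the learned drift. It has three parts.

**Monotonicity of the score.** The exact score satisfies
`⟪∇log p_s x - ∇log p_s y, x - y⟫ ≤ (M_s - α_s) ‖x - y‖²` (`inner_score_sub_le`). Remove the convex
part `α ‖x‖² / 2` from `V₀`; what remains is a potential `W` with profile `-r f_M(r)`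
(`ProfilePotential`), and the score is an affine function of the mean of a tilt of `e^{-W}`
(`score_eq`). That mean is governed by the score `S(t, ·)` of the heat flow started from `e^{-W}`
(`flowScore`), which solves the viscous Burgers equation (`hasDerivAt_flowScore_char`). The profile
is preserved along this flow (`flowScore_profile`), by a maximum principle for a function of two
points: at a first touching pair the second order conditions in the directions of coupling by
reflection (`sum_flowScoreDD_nonneg`) contradict the evolution along characteristics
(`char_deriv_nonpos`), because `2 f_M'' + f_M f_M' = 0`. If the profile failed, a first touching
pair would exist, since the score converges to `∇W` at time zero
(`ProfilePotential.tendsto_flowScore`) and is one-sided Lipschitz uniformly in time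
(`ProfilePotential.exists_flowScore_ge`). For small times the latter is
a Brascamp–Lieb inequality, obtained from the Prékopa–Leindler inequality
(`ProfilePotential.tiltCov_le`); for the remaining times it follows by comparing a tilted density
with its dilation about the mode (`ProfilePotential.exists_tiltCov_le`).

**Pathwise stability.** In the difference of a learned and the ideal solution the noise cancels
(`Setting.sub_eq_integral`). The drifts are compared by the bound on the exact score, the one-sided
bound on the score error at two points, and the size of the error at the ideal point. Grönwall's
inequality `norm_le_of_inner_deriv_le` and Minkowski's inequality turn this into a bound by the
initial distance and an `L²` error carried by the ideal trajectory (`Setting.exists_error_bound`).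

**One step and the sum.** In `Setting.W2_step_le` the law of the chain after one step is compared
with the ideal marginal. The chain's kernel is first replaced by a countable mixture
(`exists_quantization`), so that no measurable selection of solutions or couplings is needed:
couplings of countable mixtures are sums (`W2_sum_le`). A near-optimal coupling with the current
ideal marginal is realised next to the ideal trajectory, and the later noise is independent of it
(`IsBrownianMotion.indep_inputSigma`), which identifies the law of the learned solutions
(`Setting.W2_mixture_le`). Multiplied by `e^{Γ(T - t_k)}`, these inequalities telescope.
-/

open MeasureTheory ProbabilityTheory Set
open scoped ENNReal NNReal RealInnerProductSpace

noncomputable section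

namespace ReverseDiffusion

open Filter Topology

/-! ### Exponential tilts and their derivatives -/

section Tilt

variable {d : ℕ} {G : Type*} [NormedAddCommGroup G]

/-- Every centred Gaussian weight `e^{-b ‖y‖²}`, `b > 0`, is integrable against `ν`. Such a measure
can be tilted by `e^{⟪η, y⟫ - β ‖y‖² / 2}` for all `η` and all `β > 0`. -/
def GaussTame (ν : Measure (E d)) : Prop :=
  ∀ b : ℝ, 0 < b → Integrable (fun y => Real.exp (-b * ‖y‖ ^ 2)) ν

/-- The observables that are integrated against tilted measures: continuous, and bounded by `C e^{k
‖y‖}`. -/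
def ExpGrowth (q : E d → G) : Prop :=
  Continuous q ∧ ∃ C k : ℝ, 0 ≤ C ∧ ∀ y, ‖q y‖ ≤ C * Real.exp (k * ‖y‖)

/-- The exponent `⟪η, y⟫ - β ‖y‖² / 2` of a tilt, as a continuous linear form in the parameters
`(η, β)`. -/
def tiltForm (y : E d) : E d × ℝ →L[ℝ] ℝ :=
  (innerSL ℝ y).comp (ContinuousLinearMap.fst ℝ (E d) ℝ)
    - (‖y‖ ^ 2 / 2) • ContinuousLinearMap.snd ℝ (E d) ℝ

lemma tiltForm_apply (y : E d) (p : E d × ℝ) :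
    tiltForm y p = ⟪p.1, y⟫ - p.2 * ‖y‖ ^ 2 / 2 := by
  simp [tiltForm, real_inner_comm]; ring

lemma continuous_tiltForm : Continuous (tiltForm (d := d)) := by
  unfold tiltForm
  refine Continuous.sub ?_ ?_
  · exact (ContinuousLinearMap.compL ℝ (E d × ℝ) (E d) ℝ).flip
      (ContinuousLinearMap.fst ℝ (E d) ℝ) |>.continuous.comp (innerSL ℝ).continuous
  · fun_prop

lemma continuous_exp_tiltForm (p : E d × ℝ) : Continuous fun y => Real.exp (tiltForm y p) :=
  Real.continuous_exp.comp (continuous_tiltForm.clm_apply continuous_const)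

/-- The unnormalised tilted integral `∫ e^{⟪η, y⟫ - β ‖y‖² / 2} q(y) ν(dy)`, as a function of `p =
(η, β)`. -/
def tiltInt [NormedSpace ℝ G] (ν : Measure (E d)) (q : E d → G) (p : E d × ℝ) : G :=
  ∫ y, Real.exp (tiltForm y p) • q y ∂ν

lemma ExpGrowth.smul [NormedSpace ℝ G] {u : E d → ℝ} {q : E d → G} (hu : ExpGrowth u)
    (hq : ExpGrowth q) : ExpGrowth (fun y => u y • q y) := by
  obtain ⟨hu, C, k, hC, h⟩ := hu
  obtain ⟨hq, C', k', hC', h'⟩ := hq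
  refine ⟨hu.smul hq, C * C', k + k', by positivity, fun y => ?_⟩
  rw [norm_smul]
  calc ‖u y‖ * ‖q y‖ ≤ (C * Real.exp (k * ‖y‖)) * (C' * Real.exp (k' * ‖y‖)) :=
        mul_le_mul (h y) (h' y) (norm_nonneg _) (by positivity)
    _ = _ := by rw [add_mul, Real.exp_add]; ring

lemma ExpGrowth.add {u q : E d → G} (hu : ExpGrowth u) (hq : ExpGrowth q) :
    ExpGrowth (fun y => u y + q y) := by
  obtain ⟨hu, C, k, hC, h⟩ := hu
  obtain ⟨hq, C', k', hC', h'⟩ := hq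
  refine ⟨hu.add hq, C + C', max k k', by positivity, fun y => ?_⟩
  have h1 : Real.exp (k * ‖y‖) ≤ Real.exp (max k k' * ‖y‖) :=
    Real.exp_le_exp.2 (mul_le_mul_of_nonneg_right (le_max_left _ _) (norm_nonneg _))
  have h2 : Real.exp (k' * ‖y‖) ≤ Real.exp (max k k' * ‖y‖) :=
    Real.exp_le_exp.2 (mul_le_mul_of_nonneg_right (le_max_right _ _) (norm_nonneg _))
  calc ‖u y + q y‖ ≤ ‖u y‖ + ‖q y‖ := norm_add_le _ _
    _ ≤ C * Real.exp (k * ‖y‖) + C' * Real.exp (k' * ‖y‖) := add_le_add (h y) (h' y)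
    _ ≤ C * Real.exp (max k k' * ‖y‖) + C' * Real.exp (max k k' * ‖y‖) := by gcongr
    _ = _ := by ring

lemma expGrowth_const (c : G) : ExpGrowth (fun _ : E d => c) :=
  ⟨continuous_const, ‖c‖, 0, norm_nonneg _, fun y => by simp⟩

lemma expGrowth_of_le_norm {q : E d → G} (hq : Continuous q) {c : ℝ} (hc : 0 ≤ c)
    (h : ∀ y, ‖q y‖ ≤ c * ‖y‖) : ExpGrowth q :=
  ⟨hq, c, 1, hc, fun y => (h y).trans (mul_le_mul_of_nonneg_left
    (by rw [one_mul]; linarith [Real.add_one_le_exp ‖y‖]) hc)⟩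

lemma expGrowth_id : ExpGrowth (fun y : E d => y) :=
  expGrowth_of_le_norm continuous_id zero_le_one (fun y => by simp)

lemma expGrowth_inner (v : E d) : ExpGrowth (fun y : E d => ⟪v, y⟫) :=
  expGrowth_of_le_norm (by fun_prop) (norm_nonneg v) (fun y => abs_real_inner_le_norm v y)

lemma expGrowth_norm_sq : ExpGrowth (fun y : E d => ‖y‖ ^ 2) := by
  have h : ExpGrowth (fun y : E d => ‖y‖) :=
    expGrowth_of_le_norm continuous_norm zero_le_one (fun y => by simp)
  simpa [sq] using h.smul h

lemma exp_linear_sub_quadratic_le {b : ℝ} (hb : 0 < b) (c r : ℝ) :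
    Real.exp (c * r - b * r ^ 2 / 2) ≤ Real.exp (c ^ 2 / b) * Real.exp (-(b / 4) * r ^ 2) := by
  rw [← Real.exp_add]
  refine Real.exp_le_exp.2 ?_
  have h : c ^ 2 / b + -(b / 4) * r ^ 2 - (c * r - b * r ^ 2 / 2) = (c - b * r / 2) ^ 2 / b := by
    field_simp; ring
  have : 0 ≤ (c - b * r / 2) ^ 2 / b := by positivity
  linarith

lemma GaussTame.integrable_exp {ν : Measure (E d)} (hν : GaussTame ν) {b : ℝ} (hb : 0 < b)
    (c : ℝ) : Integrable (fun y => Real.exp (c * ‖y‖ - b * ‖y‖ ^ 2 / 2)) ν := by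
  refine ((hν (b / 4) (by positivity)).const_mul (Real.exp (c ^ 2 / b))).mono'
    (Continuous.aestronglyMeasurable (by fun_prop)) (Eventually.of_forall fun y => ?_)
  rw [Real.norm_of_nonneg (Real.exp_pos _).le]
  exact exp_linear_sub_quadratic_le hb c ‖y‖

lemma norm_tilt_le [NormedSpace ℝ G] {q : E d → G} {C k : ℝ}
    (h : ∀ y, ‖q y‖ ≤ C * Real.exp (k * ‖y‖))
    {p : E d × ℝ} {R b : ℝ} (hR : ‖p.1‖ ≤ R) (hb : b ≤ p.2) (y : E d) :
    ‖Real.exp (tiltForm y p) • q y‖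
      ≤ C * Real.exp ((R + k) * ‖y‖ - b * ‖y‖ ^ 2 / 2) := by
  rw [norm_smul, Real.norm_of_nonneg (Real.exp_pos _).le, tiltForm_apply]
  have h1 : ⟪p.1, y⟫ ≤ R * ‖y‖ :=
    (real_inner_le_norm _ _).trans (mul_le_mul_of_nonneg_right hR (norm_nonneg _))
  have h2 : b * ‖y‖ ^ 2 / 2 ≤ p.2 * ‖y‖ ^ 2 / 2 := by gcongr
  calc _ ≤ Real.exp (R * ‖y‖ - b * ‖y‖ ^ 2 / 2) * (C * Real.exp (k * ‖y‖)) :=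
        mul_le_mul (Real.exp_le_exp.2 (by linarith)) (h y) (norm_nonneg _) (Real.exp_pos _).le
    _ = _ := by
      rw [mul_left_comm, ← Real.exp_add]; congr 2; ring

lemma GaussTame.integrable_tilt [NormedSpace ℝ G] {ν : Measure (E d)} (hν : GaussTame ν)
    {q : E d → G}
    (hq : ExpGrowth q) {p : E d × ℝ} (hp : 0 < p.2) :
    Integrable (fun y => Real.exp (tiltForm y p) • q y) ν := by
  obtain ⟨hqc, C, k, hC, h⟩ := hq
  refine ((hν.integrable_exp hp (‖p.1‖ + k)).const_mul C).mono'
    (Continuous.aestronglyMeasurable ((continuous_exp_tiltForm p).smul hqc))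
    (Eventually.of_forall fun y => norm_tilt_le h le_rfl le_rfl y)

lemma expGrowth_tiltForm : ExpGrowth (tiltForm (d := d)) := by
  refine ⟨continuous_tiltForm, 2, 2, by norm_num, fun y => ?_⟩
  refine (ContinuousLinearMap.opNorm_le_bound _ (M := ‖y‖ + ‖y‖ ^ 2) (by positivity)
    fun p => ?_).trans ?_
  · rw [tiltForm_apply, Real.norm_eq_abs]
    have h1 : |⟪p.1, y⟫| ≤ ‖p‖ * ‖y‖ := (abs_real_inner_le_norm _ _).trans
      (mul_le_mul_of_nonneg_right (norm_fst_le p) (norm_nonneg _))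
    have h2 : |p.2 * ‖y‖ ^ 2 / 2| ≤ ‖p‖ * ‖y‖ ^ 2 := by
      have := norm_snd_le p
      rw [Real.norm_eq_abs] at this
      rw [abs_div, abs_mul, abs_of_nonneg (sq_nonneg ‖y‖), abs_of_pos (two_pos (α := ℝ))]
      have := mul_le_mul_of_nonneg_right this (sq_nonneg ‖y‖)
      have h0 : 0 ≤ |p.2| * ‖y‖ ^ 2 := by positivity
      linarith
    have := abs_sub ⟪p.1, y⟫ (p.2 * ‖y‖ ^ 2 / 2)
    linarith
  · have h := Real.add_one_le_exp ‖y‖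
    have h0 := norm_nonneg y
    have : Real.exp (2 * ‖y‖) = Real.exp ‖y‖ ^ 2 := by rw [← Real.exp_nat_mul]; norm_num
    rw [this]; nlinarith

lemma ExpGrowth.smulRight_tiltForm [NormedSpace ℝ G] {q : E d → G} (hq : ExpGrowth q) :
    ExpGrowth (fun y => (tiltForm y).smulRight (q y)) := by
  obtain ⟨h1, C, k, hC, h⟩ := hq
  obtain ⟨h1', C', k', hC', h'⟩ := expGrowth_tiltForm (d := d)
  refine ⟨?_, C' * C, k' + k, by positivity, fun y => ?_⟩
  · exact (ContinuousLinearMap.smulRightL ℝ (E d × ℝ) G).continuous₂.comp (h1'.prodMk h1)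
  · rw [ContinuousLinearMap.norm_smulRight_apply]
    calc _ ≤ (C' * Real.exp (k' * ‖y‖)) * (C * Real.exp (k * ‖y‖)) :=
          mul_le_mul (h' y) (h y) (norm_nonneg _) (by positivity)
      _ = _ := by rw [add_mul, Real.exp_add]; ring

/-- Differentiation under the integral sign. Near `p` the tilt parameters satisfy `‖η‖ < ‖p.1‖ + 1`
and `β > p.2 / 2`, which provides an integrable Gaussian bound. -/
lemma hasFDerivAt_tiltInt [NormedSpace ℝ G] {ν : Measure (E d)} (hν : GaussTame ν)
    [CompleteSpace G] {q : E d → G}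
    (hq : ExpGrowth q) {p : E d × ℝ} (hp : 0 < p.2) :
    HasFDerivAt (tiltInt ν q)
      (∫ y, Real.exp (tiltForm y p) • (tiltForm y).smulRight (q y) ∂ν) p := by
  have hq' := hq.smulRight_tiltForm
  have hs : {p' : E d × ℝ | ‖p'.1‖ < ‖p.1‖ + 1 ∧ p.2 / 2 < p'.2} ∈ 𝓝 p := by
    refine IsOpen.mem_nhds ?_ ⟨by simp, by linarith⟩
    exact (isOpen_lt (f := fun p' : E d × ℝ => ‖p'.1‖) (by fun_prop) (by fun_prop)).inter
      (isOpen_lt (f := fun _ => p.2 / 2) (g := fun p' : E d × ℝ => p'.2) (by fun_prop)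
        (by fun_prop))
  obtain ⟨hc', C, k, hC, h⟩ := hq'
  refine hasFDerivAt_integral_of_dominated_of_fderiv_le (𝕜 := ℝ)
    (F := fun p y => Real.exp (tiltForm y p) • q y)
    (F' := fun p y => Real.exp (tiltForm y p) • (tiltForm y).smulRight (q y))
    (bound := fun y => C * Real.exp ((‖p.1‖ + 1 + k) * ‖y‖ - (p.2 / 2) * ‖y‖ ^ 2 / 2))
    hs (Eventually.of_forall fun p' => ?_) (hν.integrable_tilt hq hp) ?_ ?_
    ((hν.integrable_exp (half_pos hp) _).const_mul C) ?_
  · exact ((continuous_exp_tiltForm p').smul hq.1).aestronglyMeasurable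
  · exact ((continuous_exp_tiltForm p).smul hc').aestronglyMeasurable
  · refine Eventually.of_forall fun y p' hp' => ?_
    exact norm_tilt_le h hp'.1.le hp'.2.le y
  · refine Eventually.of_forall fun y p' _ => ?_
    have h1 : HasFDerivAt (fun p : E d × ℝ => Real.exp (tiltForm y p))
        (Real.exp (tiltForm y p') • tiltForm y) p' := (tiltForm y).hasFDerivAt.exp
    exact (h1.smul_const (q y)).congr_fderiv (ContinuousLinearMap.ext fun v => by simp [smul_smul])

lemma hasDerivAt_tiltInt [NormedSpace ℝ G] {ν : Measure (E d)} (hν : GaussTame ν)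
    [CompleteSpace G] {q : E d → G}
    (hq : ExpGrowth q) {η : ℝ → E d} {β : ℝ → ℝ} {η' : E d} {β' s : ℝ}
    (hη : HasDerivAt η η' s) (hβ : HasDerivAt β β' s) (hpos : 0 < β s) :
    HasDerivAt (fun s => tiltInt ν q (η s, β s))
      (tiltInt ν (fun y => (⟪η', y⟫ - β' * ‖y‖ ^ 2 / 2) • q y) (η s, β s)) s := by
  have h := (hasFDerivAt_tiltInt hν hq (p := (η s, β s)) hpos).comp_hasDerivAt s (hη.prodMk hβ)
  refine h.congr_deriv ?_
  have hint : Integrable (fun y => Real.exp (tiltForm y (η s, β s)) •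
      (tiltForm y).smulRight (q y)) ν := by
    have hq' := hq.smulRight_tiltForm
    exact hν.integrable_tilt hq' (p := (η s, β s)) hpos
  rw [ContinuousLinearMap.integral_apply hint]
  simp [tiltInt, tiltForm_apply]

end Tilt

/-! ### Tilted means and the score of the heat flow -/

section TiltMean

variable {d : ℕ} {G : Type*} [NormedAddCommGroup G] [NormedSpace ℝ G] {ν : Measure (E d)}

/-- The probability measure proportional to `e^{⟪η, y⟫ - β ‖y‖² / 2} ν(dy)`, with `p = (η, β)`. -/
def tiltLaw (ν : Measure (E d)) (p : E d × ℝ) : Measure (E d) := ν.tilted (fun y => tiltForm y p)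

/-- The mean of the observable `q` under `tiltLaw ν p`. -/
def tiltMean (ν : Measure (E d)) (q : E d → G) (p : E d × ℝ) : G := ∫ y, q y ∂(tiltLaw ν p)

lemma GaussTame.integrable_exp_tiltForm (hν : GaussTame ν) {p : E d × ℝ} (hp : 0 < p.2) :
    Integrable (fun y => Real.exp (tiltForm y p)) ν := by
  simpa using hν.integrable_tilt (expGrowth_const (1 : ℝ)) hp

lemma GaussTame.isProbabilityMeasure_tiltLaw (hν : GaussTame ν) [NeZero ν] {p : E d × ℝ}
    (hp : 0 < p.2) : IsProbabilityMeasure (tiltLaw ν p) :=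
  isProbabilityMeasure_tilted (hν.integrable_exp_tiltForm hp)

lemma GaussTame.tiltInt_one_pos (hν : GaussTame ν) [NeZero ν] {p : E d × ℝ} (hp : 0 < p.2) :
    0 < tiltInt ν (fun _ => (1 : ℝ)) p := by
  simpa [tiltInt] using integral_exp_pos (hν.integrable_exp_tiltForm hp)

lemma tiltMean_eq (ν : Measure (E d)) (q : E d → G) (p : E d × ℝ) :
    tiltMean ν q p = (tiltInt ν (fun _ => (1 : ℝ)) p)⁻¹ • tiltInt ν q p := by
  rw [tiltMean, tiltLaw, integral_tilted, tiltInt, tiltInt, ← integral_smul]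
  simp [smul_smul, div_eq_inv_mul]

lemma GaussTame.integrable_tiltLaw (hν : GaussTame ν) {q : E d → G} (hq : ExpGrowth q)
    {p : E d × ℝ} (hp : 0 < p.2) : Integrable q (tiltLaw ν p) := by
  rw [tiltLaw, integrable_tilted_iff (hν.integrable_exp_tiltForm hp)]
  exact hν.integrable_tilt hq hp

/-- A tilted mean changes by the covariance with the derivative of the exponent. -/
lemma hasDerivAt_tiltMean [CompleteSpace G] (hν : GaussTame ν) [NeZero ν] {q : E d → G}
    (hq : ExpGrowth q) {η : ℝ → E d} {β : ℝ → ℝ} {η' : E d} {β' s : ℝ}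
    (hη : HasDerivAt η η' s) (hβ : HasDerivAt β β' s) (hpos : 0 < β s) :
    HasDerivAt (fun s => tiltMean ν q (η s, β s))
      (tiltMean ν (fun y => (⟪η', y⟫ - β' * ‖y‖ ^ 2 / 2) • q y) (η s, β s)
        - tiltMean ν (fun y => ⟪η', y⟫ - β' * ‖y‖ ^ 2 / 2) (η s, β s)
          • tiltMean ν q (η s, β s)) s := by
  have h1 := hasDerivAt_tiltInt hν (expGrowth_const (1 : ℝ)) hη hβ hpos
  have h2 := hasDerivAt_tiltInt hν hq hη hβ hpos
  have hZ := (hν.tiltInt_one_pos (p := (η s, β s)) hpos).ne'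
  simp only [tiltMean_eq]
  refine ((h1.fun_inv hZ).smul h2).congr_deriv ?_
  simp only [smul_eq_mul, mul_one, smul_smul]
  rw [sub_eq_add_neg, ← neg_smul]
  congr 2
  generalize tiltInt ν (fun y => ⟪η', y⟫ - β' * ‖y‖ ^ 2 / 2) (η s, β s) = A
  field_simp

lemma continuousAt_tiltMean [CompleteSpace G] (hν : GaussTame ν) [NeZero ν] {q : E d → G}
    (hq : ExpGrowth q) {p : E d × ℝ} (hp : 0 < p.2) : ContinuousAt (tiltMean ν q) p := by
  have h : tiltMean ν q = fun p => (tiltInt ν (fun _ => (1 : ℝ)) p)⁻¹ • tiltInt ν q p :=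
    funext (tiltMean_eq ν q)
  rw [h]
  exact ((hasFDerivAt_tiltInt hν (expGrowth_const (1 : ℝ)) hp).continuousAt.inv₀
    (hν.tiltInt_one_pos hp).ne').smul (hasFDerivAt_tiltInt hν hq hp).continuousAt

/-- The covariance of two observables under `tiltLaw ν p`. -/
def tiltCov (ν : Measure (E d)) (q q' : E d → ℝ) (p : E d × ℝ) : ℝ :=
  tiltMean ν (fun y => q y * q' y) p - tiltMean ν q p * tiltMean ν q' p

/-- The score of the heat flow, `S(t, x) = -∇ log u_t(x)` for `u_t(x) = ∫ e^{-‖x - y‖² / (2 t)}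
ν(dy)`, written as `(x - m) / t`, where `m` is the mean of the posterior law of `y` given `x`, the
tilt of `ν` with parameters `(x / t, 1 / t)`. -/
def flowScore (ν : Measure (E d)) (t : ℝ) (x : E d) : E d :=
  t⁻¹ • (x - tiltMean ν (fun y => y) (t⁻¹ • x, t⁻¹))

/-- The derivative of `⟪w, S(t, ·)⟫` at `x` in the direction `v`, through the posterior covariance.
-/
def flowScoreD (ν : Measure (E d)) (t : ℝ) (v w x : E d) : ℝ :=
  t⁻¹ * (⟪v, w⟫ - t⁻¹ * tiltCov ν (fun y => ⟪v, y⟫) (fun y => ⟪w, y⟫) (t⁻¹ • x, t⁻¹))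

/-- The second derivative of `⟪w, S(t, ·)⟫` at `x` along `v`, through the third joint cumulant of
`⟪v, y⟫`, `⟪v, y⟫` and `⟪w, y⟫` under the posterior law. -/
def flowScoreDD (ν : Measure (E d)) (t : ℝ) (v w x : E d) : ℝ :=
  -t⁻¹ ^ 3 * (tiltMean ν (fun y => ⟪v, y⟫ * (⟪v, y⟫ * ⟪w, y⟫)) (t⁻¹ • x, t⁻¹)
    - 2 * tiltMean ν (fun y => ⟪v, y⟫) (t⁻¹ • x, t⁻¹)
        * tiltMean ν (fun y => ⟪v, y⟫ * ⟪w, y⟫) (t⁻¹ • x, t⁻¹)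
    + 2 * tiltMean ν (fun y => ⟪w, y⟫) (t⁻¹ • x, t⁻¹)
        * tiltMean ν (fun y => ⟪v, y⟫) (t⁻¹ • x, t⁻¹) ^ 2
    - tiltMean ν (fun y => ⟪w, y⟫) (t⁻¹ • x, t⁻¹)
        * tiltMean ν (fun y => ⟪v, y⟫ * ⟪v, y⟫) (t⁻¹ • x, t⁻¹))

lemma inner_tiltMean_id (hν : GaussTame ν) {p : E d × ℝ} (hp : 0 < p.2) (w : E d) :
    ⟪w, tiltMean ν (fun y => y) p⟫ = tiltMean ν (fun y => ⟪w, y⟫) p := by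
  rw [tiltMean, tiltMean, integral_inner (hν.integrable_tiltLaw expGrowth_id hp)]

lemma inner_flowScore (hν : GaussTame ν) {t : ℝ} (ht : 0 < t) (x w : E d) :
    ⟪w, flowScore ν t x⟫ = t⁻¹ * (⟪w, x⟫ - tiltMean ν (fun y => ⟪w, y⟫) (t⁻¹ • x, t⁻¹)) := by
  rw [flowScore, real_inner_smul_right, inner_sub_right,
    inner_tiltMean_id hν (p := (t⁻¹ • x, t⁻¹)) (inv_pos.2 ht)]

lemma hasDerivAt_tiltMean_line (hν : GaussTame ν) [NeZero ν] {q : E d → ℝ}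
    (hq : ExpGrowth q) {t : ℝ} (ht : 0 < t) (x v : E d) (s : ℝ) :
    HasDerivAt (fun s : ℝ => tiltMean ν q (t⁻¹ • (x + s • v), t⁻¹))
      (t⁻¹ * tiltCov ν (fun y => ⟪v, y⟫) q (t⁻¹ • (x + s • v), t⁻¹)) s := by
  have hη : HasDerivAt (fun s : ℝ => t⁻¹ • (x + s • v)) (t⁻¹ • v) s := by
    exact ((((hasDerivAt_id s).smul_const v).const_add x).const_smul t⁻¹).congr_deriv (by simp)
  refine (hasDerivAt_tiltMean hν hq hη (hasDerivAt_const s t⁻¹) (inv_pos.2 ht)).congr_deriv ?_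
  simp only [zero_mul, zero_div, sub_zero, real_inner_smul_left, tiltCov, smul_eq_mul, tiltMean,
    mul_assoc, integral_const_mul]
  ring

lemma hasDerivAt_flowScore_line (hν : GaussTame ν) [NeZero ν] {t : ℝ} (ht : 0 < t)
    (x v w : E d) (s : ℝ) :
    HasDerivAt (fun s : ℝ => ⟪w, flowScore ν t (x + s • v)⟫)
      (flowScoreD ν t v w (x + s • v)) s := by
  simp only [inner_flowScore hν ht]
  have h1 : HasDerivAt (fun s : ℝ => ⟪w, x + s • v⟫) ⟪v, w⟫ s := by
    have : HasDerivAt (fun s : ℝ => ⟪w, x⟫ + s * ⟪v, w⟫) ⟪v, w⟫ s := by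
      simpa using ((hasDerivAt_id s).mul_const ⟪v, w⟫).const_add ⟪w, x⟫
    simpa [inner_add_right, real_inner_smul_right, real_inner_comm] using this
  exact ((h1.sub (hasDerivAt_tiltMean_line hν (expGrowth_inner w) ht x v s)).const_mul t⁻¹)

lemma hasDerivAt_flowScoreD_line (hν : GaussTame ν) [NeZero ν] {t : ℝ} (ht : 0 < t)
    (x v w : E d) (s : ℝ) :
    HasDerivAt (fun s : ℝ => flowScoreD ν t v w (x + s • v))
      (flowScoreDD ν t v w (x + s • v)) s := by
  have hvw : ExpGrowth (fun y : E d => ⟪v, y⟫ * ⟪w, y⟫) :=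
    (expGrowth_inner v).smul (expGrowth_inner w)
  have h1 := hasDerivAt_tiltMean_line hν hvw ht x v s
  have h2 := hasDerivAt_tiltMean_line hν (expGrowth_inner v) ht x v s
  have h3 := hasDerivAt_tiltMean_line hν (expGrowth_inner w) ht x v s
  refine ((((h1.sub (h2.mul h3)).const_mul t⁻¹).const_sub ⟪v, w⟫).const_mul t⁻¹).congr_deriv ?_
  simp only [flowScoreDD, tiltCov]
  ring

/-- The viscous Burgers equation `∂ₜS + (S · ∇)S = ΔS / 2`: along the characteristic `s ↦ x + s
S(t, x)` the flow score moves by half its Laplacian. -/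
lemma hasDerivAt_flowScore_char (hν : GaussTame ν) [NeZero ν] {t : ℝ} (ht : 0 < t)
    {ι : Type*} [Fintype ι] (b : OrthonormalBasis ι ℝ (E d)) (x w : E d) :
    HasDerivAt (fun s : ℝ => ⟪w, flowScore ν (t + s) (x + s • flowScore ν t x)⟫)
      (1 / 2 * ∑ i, flowScoreDD ν t (b i) w x) 0 := by
  set k := flowScore ν t x with hk
  set p : E d × ℝ := (t⁻¹ • x, t⁻¹) with hp
  have hp2 : 0 < p.2 := inv_pos.2 ht
  set m := tiltMean ν (fun y => y) p with hm
  have hkm : k = t⁻¹ • (x - m) := rfl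
  have hts : HasDerivAt (fun s : ℝ => t + s) 1 0 := (hasDerivAt_id (0 : ℝ)).const_add t
  have hinv : HasDerivAt (fun s : ℝ => (t + s)⁻¹) (-(t⁻¹ ^ 2)) 0 := by
    refine (hts.fun_inv (by simpa using ht.ne')).congr_deriv ?_
    simp; ring
  have hx : HasDerivAt (fun s : ℝ => x + s • k) k 0 := by
    simpa using ((hasDerivAt_id (0 : ℝ)).smul_const k).const_add x
  -- the tilt vector moves in the direction of the mean, since `k = (x - m) / t`
  have hη : HasDerivAt (fun s : ℝ => (t + s)⁻¹ • (x + s • k)) (-(t⁻¹ ^ 2) • m) 0 := by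
    refine (hinv.smul hx).congr_deriv ?_
    simp only [add_zero, zero_smul, hkm]
    module
  have hM := hasDerivAt_tiltMean hν (expGrowth_inner w) hη hinv (by simpa using ht)
  have hwx : HasDerivAt (fun s : ℝ => ⟪w, x + s • k⟫) ⟪w, k⟫ 0 := by
    have : HasDerivAt (fun s : ℝ => ⟪w, x⟫ + s * ⟪w, k⟫) ⟪w, k⟫ 0 := by
      simpa using ((hasDerivAt_id (0 : ℝ)).mul_const ⟪w, k⟫).const_add ⟪w, x⟫
    simpa [inner_add_right, real_inner_smul_right] using this
  have hS := hinv.mul (hwx.sub hM)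
  have hev : (fun s : ℝ => ⟪w, flowScore ν (t + s) (x + s • k)⟫) =ᶠ[𝓝 0] fun s =>
      (t + s)⁻¹ * (⟪w, x + s • k⟫
        - tiltMean ν (fun y => ⟪w, y⟫) ((t + s)⁻¹ • (x + s • k), (t + s)⁻¹)) := by
    have : ∀ᶠ s : ℝ in 𝓝 0, -t < s := lt_mem_nhds (by linarith)
    filter_upwards [this] with s hs
    exact inner_flowScore hν (by linarith) _ _
  refine (hS.congr_of_eventuallyEq hev).congr_deriv ?_
  simp only [add_zero, zero_smul, Pi.sub_apply]
  rw [← hp]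
  -- both sides are now polynomials in the mixed moments of `⟪m, y⟫`, `⟪w, y⟫` and `‖y‖²`; the sum
  -- over the basis is evaluated by Parseval
  have hiw := expGrowth_inner w
  have hint : ∀ q : E d → ℝ, ExpGrowth q → Integrable q (tiltLaw ν p) :=
    fun q hq => hν.integrable_tiltLaw hq hp2
  have e1 : ∀ q : E d → ℝ, ExpGrowth q →
      tiltMean ν (fun y => (⟪-(t⁻¹ ^ 2) • m, y⟫ - -(t⁻¹ ^ 2) * ‖y‖ ^ 2 / 2) • q y) p
        = t⁻¹ ^ 2 * (tiltMean ν (fun y => ‖y‖ ^ 2 * q y) p / 2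
            - tiltMean ν (fun y => ⟪m, y⟫ * q y) p) := by
    intro q hq
    have i1 := hint _ (expGrowth_norm_sq.smul hq)
    have i2 := hint _ ((expGrowth_inner m).smul hq)
    simp only [smul_eq_mul] at i1 i2
    simp only [tiltMean]
    rw [← integral_div, ← integral_sub (i1.div_const 2) i2, ← integral_const_mul]
    congr 1; ext y
    rw [real_inner_smul_left, smul_eq_mul]; ring
  have e2 : tiltMean ν (fun y => ⟪-(t⁻¹ ^ 2) • m, y⟫ - -(t⁻¹ ^ 2) * ‖y‖ ^ 2 / 2) p
        = t⁻¹ ^ 2 * (tiltMean ν (fun y => ‖y‖ ^ 2) p / 2 - tiltMean ν (fun y => ⟪m, y⟫) p) := by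
    simpa using e1 _ (expGrowth_const (1 : ℝ))
  rw [e1 _ hiw, e2]
  have hbm : ∀ i, ⟪b i, m⟫ = tiltMean ν (fun y => ⟪b i, y⟫) p :=
    fun i => inner_tiltMean_id hν hp2 (b i)
  have s1 : ∀ q : E d → ℝ, ExpGrowth q →
      ∑ i, tiltMean ν (fun y => ⟪b i, y⟫ * (⟪b i, y⟫ * q y)) p
        = tiltMean ν (fun y => ‖y‖ ^ 2 * q y) p := by
    intro q hq
    simp only [tiltMean]
    rw [← integral_finsetSum]
    · congr 1; ext y
      rw [← b.sum_sq_inner_right y, Finset.sum_mul]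
      exact Finset.sum_congr rfl fun i _ => by ring
    · intro i _
      exact hint _ ((expGrowth_inner (b i)).smul ((expGrowth_inner (b i)).smul hq))
  have s2 : ∑ i, tiltMean ν (fun y => ⟪b i, y⟫) p * tiltMean ν (fun y => ⟪b i, y⟫ * ⟪w, y⟫) p
      = tiltMean ν (fun y => ⟪m, y⟫ * ⟪w, y⟫) p := by
    simp only [← hbm]
    simp only [tiltMean, ← integral_const_mul]
    rw [← integral_finsetSum]
    · congr 1; ext y
      rw [← b.sum_inner_mul_inner m y, Finset.sum_mul]
      exact Finset.sum_congr rfl fun i _ => by rw [real_inner_comm m]; ring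
    · intro i _
      exact (hint _ ((expGrowth_inner (b i)).smul hiw)).const_mul _
  have s3 : ∑ i, tiltMean ν (fun y => ⟪b i, y⟫) p ^ 2 = tiltMean ν (fun y => ⟪m, y⟫) p := by
    simp only [← hbm]
    rw [b.sum_sq_inner_right m, ← inner_tiltMean_id hν hp2 m, real_inner_self_eq_norm_sq]
  have s4 : ∑ i, tiltMean ν (fun y => ⟪b i, y⟫ * ⟪b i, y⟫) p
      = tiltMean ν (fun y => ‖y‖ ^ 2) p := by
    simpa using s1 _ (expGrowth_const (1 : ℝ))
  have hsum : ∑ i, flowScoreDD ν t (b i) w x = -t⁻¹ ^ 3 *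
      (tiltMean ν (fun y => ‖y‖ ^ 2 * ⟪w, y⟫) p - 2 * tiltMean ν (fun y => ⟪m, y⟫ * ⟪w, y⟫) p
        + 2 * tiltMean ν (fun y => ⟪w, y⟫) p * tiltMean ν (fun y => ⟪m, y⟫) p
        - tiltMean ν (fun y => ⟪w, y⟫) p * tiltMean ν (fun y => ‖y‖ ^ 2) p) := by
    simp only [flowScoreDD, ← hp]
    rw [← Finset.mul_sum, Finset.sum_sub_distrib, Finset.sum_add_distrib, Finset.sum_sub_distrib,
      ← Finset.mul_sum, ← Finset.mul_sum, s1 _ hiw, s3, s4]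
    simp only [mul_assoc]
    rw [← Finset.mul_sum, s2]
  rw [hsum, hkm, real_inner_smul_right, inner_sub_right, inner_tiltMean_id hν hp2 w, smul_eq_mul]
  ring

end TiltMean

/-! ### The two-point function at a touching point -/

section Profile

lemma hasDerivAt_tanh (x : ℝ) : HasDerivAt Real.tanh (1 - Real.tanh x ^ 2) x := by
  have h := (Real.hasDerivAt_sinh x).div (Real.hasDerivAt_cosh x) (Real.cosh_pos x).ne'
  have e : (Real.tanh : ℝ → ℝ) = fun x => Real.sinh x / Real.cosh x :=
    funext Real.tanh_eq_sinh_div_cosh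
  rw [e]
  refine h.congr_deriv ?_
  have := (Real.cosh_pos x).ne'
  field_simp

/-- The Riccati equation `f' = M - f² / 4`. Differentiated once more it reads `2 f'' + f f' = 0`,
the identity that makes the profile invariant under the flow. -/
lemma hasDerivAt_fDefect {M : ℝ} (hM : 0 < M) (r : ℝ) :
    HasDerivAt (fDefect M) (M - fDefect M r ^ 2 / 4) r := by
  have h1 : HasDerivAt (fun r : ℝ => 1 / 2 * √M * r) (1 / 2 * √M) r := by
    simpa using (hasDerivAt_id r).const_mul (1 / 2 * √M)
  have h := ((hasDerivAt_tanh (1 / 2 * √M * r)).comp r h1).const_mul (2 * √M)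
  refine h.congr_deriv ?_
  have := Real.sq_sqrt hM.le
  simp only [fDefect]
  linear_combination this

lemma fDefect_zero (M : ℝ) : fDefect M 0 = 0 := by simp [fDefect]

lemma fDefect_nonneg (M : ℝ) {r : ℝ} (hr : 0 ≤ r) : 0 ≤ fDefect M r := by
  unfold fDefect
  have : 0 ≤ Real.tanh (1 / 2 * √M * r) := by
    rw [Real.tanh_eq_sinh_div_cosh]
    exact div_nonneg (Real.sinh_nonneg_iff.2 (by positivity)) (Real.cosh_pos _).le
  positivity

lemma fDefect_le (M r : ℝ) : fDefect M r ≤ 2 * √M := by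
  unfold fDefect
  have := (Real.tanh_lt_one (1 / 2 * √M * r)).le
  have h := Real.sqrt_nonneg M
  nlinarith

lemma fDefect_le_mul {M : ℝ} (hM : 0 < M) {r : ℝ} (hr : 0 ≤ r) : fDefect M r ≤ M * r := by
  have hmono : Monotone (fun r => M * r - fDefect M r) := by
    refine monotone_of_hasDerivAt_nonneg (f' := fun r => fDefect M r ^ 2 / 4) (fun r => ?_)
      (fun r => by positivity)
    exact (((hasDerivAt_id r).const_mul M).sub (hasDerivAt_fDefect hM r)).congr_deriv (by ring)
  have := hmono hr
  simp only [mul_zero, fDefect_zero, sub_zero] at this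
  linarith

lemma continuous_fDefect {M : ℝ} (hM : 0 < M) : Continuous (fDefect M) :=
  continuous_iff_continuousAt.2 fun r => (hasDerivAt_fDefect hM r).continuousAt

lemma second_deriv_nonneg_of_isLocalMin {φ φ' : ℝ → ℝ} {c a : ℝ}
    (h1 : ∀ᶠ s in 𝓝 a, HasDerivAt φ (φ' s) s) (h2 : HasDerivAt φ' c a)
    (hmin : IsLocalMin φ a) : 0 ≤ c := by
  by_contra! hc
  have hd : deriv φ =ᶠ[𝓝 a] φ' := h1.mono fun s hs => hs.deriv
  have hda : deriv φ a = 0 := hmin.deriv_eq_zero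
  have hmax : IsLocalMax φ a := isLocalMax_of_deriv_deriv_neg
    (by rw [hd.deriv_eq, h2.deriv]; exact hc) hda h1.self_of_nhds.continuousAt
  have hconst : φ =ᶠ[𝓝 a] fun _ => φ a := by
    filter_upwards [hmin, hmax] with s h h' using le_antisymm h' h
  have h0 : deriv φ =ᶠ[𝓝 a] fun _ => 0 := by
    simpa using hconst.deriv
  have h3 : HasDerivAt (fun _ : ℝ => (0 : ℝ)) c a :=
    (h2.congr_of_eventuallyEq hd).congr_of_eventuallyEq h0.symm
  exact hc.ne (h3.unique (hasDerivAt_const a 0))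

variable {d : ℕ} {ν : Measure (E d)}

/-- The two-point function whose positivity expresses the profile: `⟪x - y, S x - S y⟫ + r f_M(r)`
with `r = ‖x - y‖`, plus the barrier `δ e^{K t} (1 + ‖x‖² + ‖y‖²) r`, which grows at infinity. -/
def profileGap (S : ℝ → E d → E d) (M δ K t : ℝ) (x y : E d) : ℝ :=
  ⟪x - y, S t x - S t y⟫ + ‖x - y‖ * fDefect M ‖x - y‖
    + δ * Real.exp (K * t) * (1 + ‖x‖ ^ 2 + ‖y‖ ^ 2) * ‖x - y‖

lemma flowScoreDD_neg (ν : Measure (E d)) (t : ℝ) (v w x : E d) :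
    flowScoreDD ν t (-v) w x = flowScoreDD ν t v w x := by
  simp only [flowScoreDD, inner_neg_left, tiltMean, integral_neg, neg_mul, mul_neg, neg_neg,
    neg_sq]

lemma hasDerivAt_norm_line {w : E d} (hw : w ≠ 0) (k : E d) :
    HasDerivAt (fun s : ℝ => ‖w + s • k‖) (⟪w, k⟫ / ‖w‖) 0 := by
  have h : HasDerivAt (fun s : ℝ => w + s • k) k 0 := by
    simpa using ((hasDerivAt_id (0 : ℝ)).smul_const k).const_add w
  have h2 := h.norm_sq.sqrt (by simpa using hw)
  simp only [Real.sqrt_sq (norm_nonneg _)] at h2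
  refine h2.congr_deriv ?_
  simp only [zero_smul, add_zero]
  have := norm_ne_zero_iff.2 hw
  field_simp

lemma hasDerivAt_norm_sq_line (x v : E d) (s : ℝ) :
    HasDerivAt (fun s : ℝ => ‖x + s • v‖ ^ 2) (2 * ⟪x + s • v, v⟫) s := by
  have h : HasDerivAt (fun s : ℝ => x + s • v) v s := by
    simpa using ((hasDerivAt_id s).smul_const v).const_add x
  exact h.norm_sq

/-- The second order conditions at a pair `(x, y)` where the gap is minimal with value zero. The
pair is moved in the directions `(v, v)` for `v` orthogonal to `x - y`, and `(e, -e)` for the unit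
vector `e` along `x - y`: the directions of coupling by reflection. Only the latter change the
distance, at rate two, and so bring in the second derivative of `f_M`. -/
lemma sum_flowScoreDD_nonneg (hν : GaussTame ν) [NeZero ν] {M δ K τ : ℝ} (hM : 0 < M)
    (hτ : 0 < τ) {x y : E d} (hxy : x ≠ y)
    (hmin : ∀ x' y', 0 ≤ profileGap (flowScore ν) M δ K τ x' y')
    (hzero : profileGap (flowScore ν) M δ K τ x y = 0) (b : OrthonormalBasis (Fin d) ℝ (E d))
    {i₀ : Fin d} (hb : b i₀ = ‖x - y‖⁻¹ • (x - y)) :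
    0 ≤ ∑ i, flowScoreDD ν τ (b i) (x - y) x - ∑ i, flowScoreDD ν τ (b i) (x - y) y
      - 2 * ‖x - y‖ * (fDefect M ‖x - y‖ * (M - fDefect M ‖x - y‖ ^ 2 / 4))
      + 4 * d * ‖x - y‖ * (δ * Real.exp (K * τ)) := by
  set w := x - y with hw
  set r := ‖w‖ with hr
  have hw0 : w ≠ 0 := sub_ne_zero.2 hxy
  have hr0 : 0 < r := norm_pos_iff.2 hw0
  set D := δ * Real.exp (K * τ) with hD
  set f := fDefect M with hf
  -- `v i` is the reflection of `b i`, and `2 * c i` is the rate of change of the distance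
  let v : Fin d → E d := fun i => if i = i₀ then -b i else b i
  let c : Fin d → ℝ := fun i => if i = i₀ then 1 else 0
  have hwe : w = r • b i₀ := by rw [hb, smul_smul, mul_inv_cancel₀ hr0.ne', one_smul]
  have hbn : ∀ i, ‖b i‖ = 1 := b.orthonormal.1
  have hvn : ∀ i, ‖v i‖ = 1 := fun i => by
    simp only [v]; split_ifs <;> simp [hbn]
  have hdiff : ∀ i (s : ℝ), (x + s • b i) - (y + s • v i) = (r + 2 * c i * s) • b i₀ := by
    intro i s
    have : (x + s • b i) - (y + s • v i) = w + s • (b i - v i) := by rw [hw]; module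
    rw [this, hwe]
    simp only [v, c]
    split_ifs with h
    · subst h; module
    · module
  have key : ∀ i, 0 ≤ flowScoreDD ν τ (b i) w x - flowScoreDD ν τ (v i) w y
      + r * (4 * c i * (-(1 / 2) * (f r * (M - f r ^ 2 / 4)))) + 4 * r * D := by
    intro i
    -- `φ` is the gap divided by the distance and multiplied by `r`, with a minimum at `0` too; the
    -- direction of the displaced pair is constant, so no derivative falls on it
    let φ : ℝ → ℝ := fun s => ⟪w, flowScore ν τ (x + s • b i)⟫ - ⟪w, flowScore ν τ (y + s • v i)⟫
      + r * f (r + 2 * c i * s) + r * D * (1 + ‖x + s • b i‖ ^ 2 + ‖y + s • v i‖ ^ 2)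
    let φ' : ℝ → ℝ := fun s => flowScoreD ν τ (b i) w (x + s • b i)
      - flowScoreD ν τ (v i) w (y + s • v i)
      + r * ((M - f (r + 2 * c i * s) ^ 2 / 4) * (2 * c i))
      + r * D * (2 * ⟪x + s • b i, b i⟫ + 2 * ⟪y + s • v i, v i⟫)
    have hlin : ∀ s : ℝ, HasDerivAt (fun s : ℝ => r + 2 * c i * s) (2 * c i) s := fun s => by
      simpa using ((hasDerivAt_id s).const_mul (2 * c i)).const_add r
    have hφ : ∀ s, HasDerivAt φ (φ' s) s := by
      intro s
      have h1 := hasDerivAt_flowScore_line hν hτ x (b i) w s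
      have h2 := hasDerivAt_flowScore_line hν hτ y (v i) w s
      have h3 := (((hasDerivAt_fDefect hM (r + 2 * c i * s)).comp s (hlin s)).const_mul r)
      have h4 := ((((hasDerivAt_norm_sq_line x (b i) s).const_add 1).add
        (hasDerivAt_norm_sq_line y (v i) s)).const_mul (r * D))
      exact ((h1.sub h2).add h3).add h4
    have hφ' : HasDerivAt φ' (flowScoreDD ν τ (b i) w x - flowScoreDD ν τ (v i) w y
        + r * (4 * c i * (-(1 / 2) * (f r * (M - f r ^ 2 / 4)))) + 4 * r * D) 0 := by
      have h1 := hasDerivAt_flowScoreD_line hν hτ x (b i) w 0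
      have h2 := hasDerivAt_flowScoreD_line hν hτ y (v i) w 0
      have h3 := ((((((hasDerivAt_fDefect hM (r + 2 * c i * 0)).comp 0 (hlin 0)).fun_pow
        2).div_const 4).const_sub M).mul_const (2 * c i)).const_mul r
      have hl : ∀ z u : E d, ‖u‖ = 1 → HasDerivAt (fun s : ℝ => 2 * ⟪z + s • u, u⟫) 2 0 := by
        intro z u hu
        have : HasDerivAt (fun s : ℝ => 2 * (⟪z, u⟫ + s * 1)) (2 * (1 * 1)) 0 :=
          (((hasDerivAt_id (0 : ℝ)).mul_const 1).const_add _).const_mul 2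
        simpa [inner_add_left, real_inner_smul_left, real_inner_self_eq_norm_sq, hu] using this
      have h4 := ((hl x (b i) (hbn i)).add (hl y (v i) (hvn i))).const_mul (r * D)
      refine (((h1.sub h2).add h3).add h4).congr_deriv ?_
      have hcc : c i * c i = c i := by simp only [c]; split_ifs <;> norm_num
      simp only [zero_smul, add_zero, mul_zero, Function.comp, ← hf]
      linear_combination (-2 * r * (f r * (M - f r ^ 2 / 4))) * hcc
    have hpos : ∀ᶠ s : ℝ in 𝓝 0, 0 < r + 2 * c i * s :=
      (hlin 0).continuousAt.eventually (lt_mem_nhds (by simpa using hr0))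
    have hφN : ∀ s : ℝ, 0 < r + 2 * c i * s → φ s = r / (r + 2 * c i * s) *
        profileGap (flowScore ν) M δ K τ (x + s • b i) (y + s • v i) := by
      intro s hs
      simp only [φ, profileGap, hdiff, norm_smul, hbn, Real.norm_of_nonneg hs.le, mul_one, ← hf,
        ← hD]
      have : ∀ u, ⟪w, u⟫ = r * ⟪b i₀, u⟫ := fun u => by rw [hwe, real_inner_smul_left]
      rw [this, this, real_inner_smul_left, inner_sub_right]
      field_simp
    have hφ0 : φ 0 = 0 := by
      rw [hφN 0 (by simpa using hr0)]
      simp [hzero]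
    refine second_deriv_nonneg_of_isLocalMin (Eventually.of_forall hφ) hφ' ?_
    filter_upwards [hpos] with s hs
    rw [hφ0, hφN s hs]
    exact mul_nonneg (by positivity) (hmin _ _)
  have hsum := Finset.sum_nonneg (s := Finset.univ) fun i _ => key i
  have hv : ∀ i, flowScoreDD ν τ (v i) w y = flowScoreDD ν τ (b i) w y := by
    intro i; simp only [v]; split_ifs
    · exact flowScoreDD_neg _ _ _ _ _
    · rfl
  simp only [hv, Finset.sum_add_distrib, Finset.sum_sub_distrib, ← Finset.mul_sum, ← Finset.sum_mul,
    Finset.sum_const, Finset.card_univ, Fintype.card_fin, nsmul_eq_mul] at hsum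
  have hc : ∑ i, c i = 1 := by simp [c]
  rw [hc] at hsum
  linarith

/-- The first order condition in time at a pair `(x, y)` where the gap first vanishes: the left
derivative of the gap is nonpositive along the pair of characteristics through `x` and `y`, where
the score evolves by half its Laplacian. -/
lemma char_deriv_nonpos (hν : GaussTame ν) [NeZero ν] {M δ K τ : ℝ} (hM : 0 < M)
    (hτ : 0 < τ) {x y : E d} (hxy : x ≠ y)
    (hpast : ∀ t, 0 < t → t < τ → ∀ x' y', 0 ≤ profileGap (flowScore ν) M δ K t x' y')
    (hzero : profileGap (flowScore ν) M δ K τ x y = 0) (b : OrthonormalBasis (Fin d) ℝ (E d)) :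
    (1 / 2 * ∑ i, flowScoreDD ν τ (b i) (x - y) x - 1 / 2 * ∑ i, flowScoreDD ν τ (b i) (x - y) y)
      + ‖flowScore ν τ x - flowScore ν τ y‖ ^ 2
      + (⟪x - y, flowScore ν τ x - flowScore ν τ y⟫ / ‖x - y‖ * fDefect M ‖x - y‖
        + ‖x - y‖ * ((M - fDefect M ‖x - y‖ ^ 2 / 4)
          * (⟪x - y, flowScore ν τ x - flowScore ν τ y⟫ / ‖x - y‖)))
      + δ * Real.exp (K * τ) * ((K * (1 + ‖x‖ ^ 2 + ‖y‖ ^ 2)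
          + (2 * ⟪x, flowScore ν τ x⟫ + 2 * ⟪y, flowScore ν τ y⟫)) * ‖x - y‖
          + (1 + ‖x‖ ^ 2 + ‖y‖ ^ 2)
            * (⟪x - y, flowScore ν τ x - flowScore ν τ y⟫ / ‖x - y‖)) ≤ 0 := by
  set w := x - y with hw
  set k := flowScore ν τ x with hk
  set k' := flowScore ν τ y with hk'
  set κ := k - k' with hκ
  have hw0 : w ≠ 0 := sub_ne_zero.2 hxy
  let ψ : ℝ → ℝ := fun s => profileGap (flowScore ν) M δ K (τ + s) (x + s • k) (y + s • k')
  have hdiff : ∀ s : ℝ, (x + s • k) - (y + s • k') = w + s • κ := fun s => by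
    rw [hw, hκ]; module
  have hψ : ψ = fun s =>
      (⟪w, flowScore ν (τ + s) (x + s • k)⟫ - ⟪w, flowScore ν (τ + s) (y + s • k')⟫)
      + s * (⟪κ, flowScore ν (τ + s) (x + s • k)⟫ - ⟪κ, flowScore ν (τ + s) (y + s • k')⟫)
      + ‖w + s • κ‖ * fDefect M ‖w + s • κ‖
      + δ * Real.exp (K * (τ + s)) * (1 + ‖x + s • k‖ ^ 2 + ‖y + s • k'‖ ^ 2) * ‖w + s • κ‖ := by
    funext s
    simp only [ψ, profileGap, hdiff, inner_add_left, real_inner_smul_left, inner_sub_right]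
    ring
  have h1 := hasDerivAt_flowScore_char hν hτ b x w
  have h2 := hasDerivAt_flowScore_char hν hτ b y w
  have h3 := hasDerivAt_flowScore_char hν hτ b x κ
  have h4 := hasDerivAt_flowScore_char hν hτ b y κ
  have hn := hasDerivAt_norm_line hw0 κ
  have h5 := (hasDerivAt_id (0 : ℝ)).mul (h3.sub h4)
  have h6 := hn.mul ((hasDerivAt_fDefect hM ‖w + (0 : ℝ) • κ‖).comp 0 hn)
  have hexp : HasDerivAt (fun s : ℝ => Real.exp (K * (τ + s))) (Real.exp (K * (τ + 0)) * K) 0 := by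
    have : HasDerivAt (fun s : ℝ => K * (τ + s)) K 0 := by
      simpa using ((hasDerivAt_id (0 : ℝ)).const_add τ).const_mul K
    exact this.exp
  have h7 := ((hexp.const_mul δ).mul (((hasDerivAt_norm_sq_line x k 0).const_add 1).add
    (hasDerivAt_norm_sq_line y k' 0))).mul hn
  have hder := (((h1.sub h2).add h5).add h6).add h7
  have hder2 := hder.congr_of_eventuallyEq
    (Eventually.of_forall fun s => congrFun hψ s : ψ =ᶠ[𝓝 0] _)
  have hle : ∀ᶠ s : ℝ in 𝓝[<] 0, 0 ≤ ψ s := by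
    have : ∀ᶠ s : ℝ in 𝓝[<] 0, -τ < s :=
      nhdsWithin_le_nhds (lt_mem_nhds (by linarith))
    filter_upwards [this, self_mem_nhdsWithin] with s hs hs'
    rw [mem_Iio] at hs'
    exact hpast _ (by linarith) (by linarith) _ _
  have hψ0 : ψ 0 = 0 := by simpa [ψ] using hzero
  have hnonpos := (hasDerivAt_iff_tendsto_slope.1 hder2).mono_left
    (nhdsWithin_mono (0 : ℝ) (s := Iio 0) fun s hs => (mem_Iio.1 hs).ne)
  have hfin := le_of_tendsto hnonpos (b := 0) (by
    filter_upwards [hle, self_mem_nhdsWithin] with s hs hs'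
    rw [mem_Iio] at hs'
    rw [slope_def_field, hψ0, sub_zero, sub_zero]
    exact div_nonpos_of_nonneg_of_nonpos hs hs'.le)
  refine le_trans (le_of_eq ?_) hfin
  simp only [zero_smul, add_zero, id, Pi.sub_apply, Pi.mul_apply, Pi.add_apply, Function.comp]
  rw [← hk, ← hk', ← inner_sub_right κ k k', ← hκ, real_inner_self_eq_norm_sq]
  ring

/-- The gap cannot vanish for the first time off the diagonal. The Laplacians in the two conditions
cancel, the terms without the barrier are nonnegative by `2 f'' + f f' = 0` and the Cauchy–Schwarz
inequality, and the barrier contributes a positive term when `K` is large. -/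
lemma profileGap_not_touching (hν : GaussTame ν) [NeZero ν] {M δ K τ : ℝ} (hM : 0 < M)
    (hδ : 0 < δ) (hτ : 0 < τ) {x y : E d} (hxy : x ≠ y)
    (hmin : ∀ x' y', 0 ≤ profileGap (flowScore ν) M δ K τ x' y')
    (hpast : ∀ t, 0 < t → t < τ → ∀ x' y', 0 ≤ profileGap (flowScore ν) M δ K t x' y')
    (hzero : profileGap (flowScore ν) M δ K τ x y = 0)
    (hK : 0 < (K - M) * (1 + ‖x‖ ^ 2 + ‖y‖ ^ 2)
      + (2 * ⟪x, flowScore ν τ x⟫ + 2 * ⟪y, flowScore ν τ y⟫) - 2 * d) : False := by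
  set r := ‖x - y‖ with hr
  have hw0 : x - y ≠ 0 := sub_ne_zero.2 hxy
  have hr0 : 0 < r := norm_pos_iff.2 hw0
  have hd : 0 < d := by
    rcases Nat.eq_zero_or_pos d with rfl | h
    · exact absurd (Subsingleton.elim x y) hxy
    · exact h
  -- an orthonormal basis whose first vector points along `x - y`
  obtain ⟨b, hb⟩ := Orthonormal.exists_orthonormalBasis_extension_of_card_eq (𝕜 := ℝ)
    (E := E d) (ι := Fin d) (by simp) (v := fun _ => r⁻¹ • (x - y)) (s := {⟨0, hd⟩}) (by
      constructor
      · intro i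
        simp [norm_smul, ← hr, hr0.ne', abs_of_pos hr0]
      · intro i j hij
        exact absurd (Subsingleton.elim i j) hij)
  have h1 := sum_flowScoreDD_nonneg hν hM hτ hxy hmin hzero b (hb _ rfl)
  have h2 := char_deriv_nonpos hν hM hτ hxy hpast hzero b
  rw [profileGap] at hzero
  rw [← hr] at h1 h2 hzero
  have hcs := abs_real_inner_le_norm (x - y) (flowScore ν τ x - flowScore ν τ y)
  rw [← hr] at hcs
  set κ := ‖flowScore ν τ x - flowScore ν τ y‖
  set Φ := 1 + ‖x‖ ^ 2 + ‖y‖ ^ 2 with hΦ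
  have hΦ0 : 0 < Φ := by positivity
  set I := ⟪x - y, flowScore ν τ x - flowScore ν τ y⟫
  set D := I / r with hD
  have hI : I = r * D := by rw [hD]; field_simp
  set f := fDefect M r
  set ε := δ * Real.exp (K * τ) with hε
  have hε0 : 0 < ε := by positivity
  have hDz : D = -f - ε * Φ := by
    have : r * (D + f + ε * Φ) = 0 := by rw [← hzero, hI]; ring
    have := (mul_eq_zero.1 this).resolve_left hr0.ne'
    linarith
  have hκ : D ^ 2 ≤ κ ^ 2 := by
    rw [hI, abs_mul, abs_of_pos hr0] at hcs
    have := le_of_mul_le_mul_left hcs hr0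
    exact sq_le_sq' (by linarith [neg_abs_le D]) ((le_abs_self D).trans this)
  set Φ' := 2 * ⟪x, flowScore ν τ x⟫ + 2 * ⟪y, flowScore ν τ y⟫
  set f' := M - f ^ 2 / 4 with hf'
  have hf'M : f' * Φ ≤ M * Φ := by
    apply mul_le_mul_of_nonneg_right _ hΦ0.le
    rw [hf']; nlinarith [sq_nonneg f]
  have e : D * f + ε * (Φ * D) = -D ^ 2 := by
    have : f + ε * Φ = -D := by linarith
    linear_combination D * this
  have e2 : f' * D = -f' * f - ε * (f' * Φ) := by rw [hDz]; ring
  have hfin : r * (ε * (K * Φ + Φ' - f' * Φ - 2 * d)) ≤ 0 := by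
    nlinarith [h1, h2, hκ, e, e2]
  have : 0 < r * (ε * (K * Φ + Φ' - f' * Φ - 2 * d)) := by
    have : 0 < K * Φ + Φ' - f' * Φ - 2 * d := by linarith
    positivity
  linarith

end Profile

/-! ### Propagation of the semiconvexity profile -/

section MaximumPrinciple

variable {d : ℕ} {ν : Measure (E d)}

/-- The flow score for `t > 0`, extended by `S₀` to `t ≤ 0`. -/
def extendedScore (ν : Measure (E d)) (S₀ : E d → E d) (t : ℝ) (x : E d) : E d :=
  if 0 < t then flowScore ν t x else S₀ x

lemma profileGap_extendedScore (S₀ : E d → E d) {M δ K t : ℝ} (ht : 0 < t) (x y : E d) :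
    profileGap (extendedScore ν S₀) M δ K t x y = profileGap (flowScore ν) M δ K t x y := by
  simp [profileGap, extendedScore, ht]

lemma continuousAt_flowScore (hν : GaussTame ν) [NeZero ν] {t : ℝ} (ht : 0 < t) (x : E d) :
    ContinuousAt (fun p : ℝ × E d => flowScore ν p.1 p.2) (t, x) := by
  have hinv : ContinuousAt (fun p : ℝ × E d => p.1⁻¹) (t, x) :=
    continuousAt_fst.inv₀ ht.ne'
  have h1 : ContinuousAt (fun p : ℝ × E d => (p.1⁻¹ • p.2, p.1⁻¹)) (t, x) :=
    (hinv.smul continuousAt_snd).prodMk hinv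
  have h2 := ContinuousAt.comp (x := ((t, x) : ℝ × E d)) (f := fun p : ℝ × E d =>
    (p.1⁻¹ • p.2, p.1⁻¹)) (continuousAt_tiltMean hν expGrowth_id (p := (t⁻¹ • x, t⁻¹))
    (inv_pos.2 ht)) h1
  exact hinv.smul (continuousAt_snd.sub h2)

lemma continuousOn_extendedScore (hν : GaussTame ν) [NeZero ν] {S₀ : E d → E d}
    (hS₀ : Continuous S₀)
    (hlim : ∀ x₀, Tendsto (fun p : ℝ × E d => flowScore ν p.1 p.2) (𝓝[>] 0 ×ˢ 𝓝 x₀) (𝓝 (S₀ x₀)))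
    (T : ℝ) :
    ContinuousOn (fun p : ℝ × E d => extendedScore ν S₀ p.1 p.2) (Icc 0 T ×ˢ univ) := by
  rintro ⟨t, x⟩ ⟨ht, -⟩
  rcases ht.1.eq_or_lt with h0 | h0
  · simp only at h0
    subst h0
    have hle : 𝓝[Icc 0 T ×ˢ univ] ((0 : ℝ), x) ≤ (pure 0 ×ˢ 𝓝 x) ⊔ (𝓝[>] 0 ×ˢ 𝓝 x) := by
      rw [← Filter.sup_prod, nhdsWithin_prod_eq, nhdsWithin_univ]
      refine Filter.prod_mono ?_ le_rfl
      have : insert (0 : ℝ) (Ioi 0) = Ici 0 := Ioi_insert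
      rw [← nhdsWithin_insert, this]
      exact nhdsWithin_mono _ Icc_subset_Ici_self
    have h00 : extendedScore ν S₀ 0 x = S₀ x := by simp [extendedScore]
    refine Tendsto.mono_left ?_ hle
    simp only [h00]
    refine Tendsto.sup ?_ ?_
    · rw [Filter.pure_prod, tendsto_map'_iff]
      have : ((fun p : ℝ × E d => extendedScore ν S₀ p.1 p.2) ∘ Prod.mk 0) = S₀ := by
        funext y; simp [extendedScore]
      rw [this]
      exact hS₀.continuousAt
    · refine (hlim x).congr' ?_
      have : ∀ᶠ p : ℝ × E d in 𝓝[>] 0 ×ˢ 𝓝 x, p.1 ∈ Ioi (0 : ℝ) :=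
        tendsto_fst.eventually self_mem_nhdsWithin
      filter_upwards [this] with p hp
      simp [extendedScore, mem_Ioi.1 hp]
  · simp only at h0
    refine ContinuousAt.continuousWithinAt ?_
    refine (continuousAt_flowScore hν h0 x).congr ?_
    have : ∀ᶠ p : ℝ × E d in 𝓝 (t, x), 0 < p.1 :=
      continuousAt_fst.eventually (lt_mem_nhds h0)
    filter_upwards [this] with p hp
    simp [extendedScore, hp]

/-- With the barrier the gap stays positive off the diagonal. Otherwise there is a first time at
which it vanishes: the one-sided Lipschitz bound `hC` confines the pairs with nonpositive gap to a
compact set away from the diagonal, and at time zero the gap is positive by `hprof`. This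
contradicts `profileGap_not_touching`. -/
lemma profileGap_pos (hν : GaussTame ν) [NeZero ν] {M : ℝ} (hM : 0 < M) {S₀ : E d → E d}
    (hS₀ : Continuous S₀)
    (hprof : ∀ x y, -(‖x - y‖ * fDefect M ‖x - y‖) ≤ ⟪x - y, S₀ x - S₀ y⟫)
    (hlim : ∀ x₀, Tendsto (fun p : ℝ × E d => flowScore ν p.1 p.2) (𝓝[>] 0 ×ˢ 𝓝 x₀) (𝓝 (S₀ x₀)))
    {C T : ℝ} (hC0 : 0 < C)
    (hC : ∀ t, 0 < t → t ≤ T → ∀ x y,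
      -(C * ‖x - y‖ ^ 2) ≤ ⟪x - y, flowScore ν t x - flowScore ν t y⟫) :
    ∃ K : ℝ, ∀ δ : ℝ, 0 < δ → ∀ t, 0 < t → t ≤ T → ∀ x y, x ≠ y →
      0 < profileGap (flowScore ν) M δ K t x y := by
  have hcont := continuousOn_extendedScore hν hS₀ hlim T
  -- a bound for the score at the origin
  obtain ⟨C₁, hC₁⟩ : ∃ C₁, ∀ t ∈ Icc 0 T, ‖extendedScore ν S₀ t 0‖ ≤ C₁ := by
    have h : ContinuousOn (fun t => extendedScore ν S₀ t 0) (Icc 0 T) :=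
      hcont.comp (f := fun t : ℝ => (t, (0 : E d))) (by fun_prop) (fun t ht => ⟨ht, mem_univ _⟩)
    exact isCompact_Icc.exists_bound_of_continuousOn h
  have hC₁' : ∀ t, 0 < t → t ≤ T → ‖flowScore ν t 0‖ ≤ |C₁| := fun t h0 hT => by
    have := hC₁ t ⟨h0.le, hT⟩
    simp only [extendedScore, h0, if_true] at this
    exact this.trans (le_abs_self _)
  have hdrift : ∀ t, 0 < t → t ≤ T → ∀ x, -(C * ‖x‖ ^ 2 + |C₁| * (1 + ‖x‖ ^ 2)) ≤
      ⟪x, flowScore ν t x⟫ := by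
    intro t h0 hT x
    have h1 := hC t h0 hT x 0
    simp only [sub_zero, inner_sub_right] at h1
    have h2 := abs_le.1 (abs_real_inner_le_norm x (flowScore ν t 0))
    have h3 : ‖x‖ * ‖flowScore ν t 0‖ ≤ |C₁| * (1 + ‖x‖ ^ 2) := by
      have := mul_le_mul_of_nonneg_left (hC₁' t h0 hT) (norm_nonneg x)
      nlinarith [sq_nonneg (‖x‖ - 1), abs_nonneg C₁, norm_nonneg x]
    linarith [h2.1]
  -- the growth rate of the barrier dominates `M`, the radial drift bounded by `hdrift`, and the
  -- Laplacian `2 d` of the barrier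
  set K := M + 2 * C + 4 * |C₁| + 2 * d + 1 with hK
  have hK0 : 0 ≤ K := by positivity
  refine ⟨K, fun δ hδ => ?_⟩
  by_contra! hcon
  obtain ⟨t₁, ht₁0, ht₁T, x₁, y₁, hxy₁, hneg₁⟩ := hcon
  let N : ℝ × E d × E d → ℝ := fun p => profileGap (extendedScore ν S₀) M δ K p.1 p.2.1 p.2.2
  have hN0 : ∀ x y, x ≠ y → 0 < N (0, x, y) := by
    intro x y hxy
    have hr : 0 < ‖x - y‖ := norm_pos_iff.2 (sub_ne_zero.2 hxy)
    have h1 := hprof x y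
    have h2 : 0 < δ * Real.exp (K * 0) * (1 + ‖x‖ ^ 2 + ‖y‖ ^ 2) * ‖x - y‖ := by positivity
    simp only [N, profileGap, extendedScore, lt_irrefl, if_false]
    linarith
  -- where the gap is nonpositive, `δ (1 + ‖x‖² + ‖y‖²) ≤ C ‖x - y‖`: this bounds the distance from
  -- below by `r₀` and the points by `R`
  set r₀ := δ / C with hr₀
  set R := 2 * C / δ with hR
  have hr₀0 : 0 < r₀ := by positivity
  have hloc : ∀ t ∈ Icc 0 T, ∀ x y, x ≠ y → N (t, x, y) ≤ 0 →
      0 < t ∧ r₀ ≤ ‖x - y‖ ∧ ‖x‖ ≤ R ∧ ‖y‖ ≤ R := by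
    intro t ht x y hxy hneg
    have ht0 : 0 < t := by
      rcases ht.1.eq_or_lt with h | h
      · exact absurd hneg (not_le.2 (h ▸ hN0 x y hxy))
      · exact h
    have hr : 0 < ‖x - y‖ := norm_pos_iff.2 (sub_ne_zero.2 hxy)
    simp only [N] at hneg
    rw [profileGap_extendedScore S₀ ht0, profileGap] at hneg
    have h1 := hC t ht0 ht.2 x y
    have h2 : 0 ≤ ‖x - y‖ * fDefect M ‖x - y‖ := mul_nonneg hr.le (fDefect_nonneg M hr.le)
    have h3 : 1 ≤ Real.exp (K * t) := Real.one_le_exp (by positivity)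
    have h4 : δ * (1 + ‖x‖ ^ 2 + ‖y‖ ^ 2) * ‖x - y‖ ≤
        δ * Real.exp (K * t) * (1 + ‖x‖ ^ 2 + ‖y‖ ^ 2) * ‖x - y‖ := by
      gcongr; nlinarith
    have h5 : δ * (1 + ‖x‖ ^ 2 + ‖y‖ ^ 2) ≤ C * ‖x - y‖ := by
      have : δ * (1 + ‖x‖ ^ 2 + ‖y‖ ^ 2) * ‖x - y‖ ≤ C * ‖x - y‖ * ‖x - y‖ := by nlinarith
      exact le_of_mul_le_mul_right this hr
    have h6 : ‖x - y‖ ≤ ‖x‖ + ‖y‖ := norm_sub_le x y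
    have hsum : ‖x‖ + ‖y‖ ≤ R := by
      rw [hR, le_div_iff₀ hδ]
      by_contra! hlt
      have hs : 0 < ‖x‖ + ‖y‖ := lt_of_lt_of_le hr h6
      have h7 : δ * ((‖x‖ + ‖y‖) ^ 2 / 2) ≤ C * (‖x‖ + ‖y‖) := by
        have a1 : δ * ((‖x‖ + ‖y‖) ^ 2 / 2) ≤ δ * (1 + ‖x‖ ^ 2 + ‖y‖ ^ 2) := by
          gcongr; nlinarith [sq_nonneg (‖x‖ - ‖y‖)]
        have a2 : C * ‖x - y‖ ≤ C * (‖x‖ + ‖y‖) := by gcongr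
        linarith
      nlinarith
    refine ⟨ht0, ?_, by linarith [norm_nonneg y], by linarith [norm_nonneg x]⟩
    rw [hr₀, div_le_iff₀ hC0]
    nlinarith [sq_nonneg ‖x‖, sq_nonneg ‖y‖]
  let Q : Set (ℝ × E d × E d) := Icc 0 T ×ˢ (Metric.closedBall 0 R ×ˢ Metric.closedBall 0 R)
  have hQ : IsCompact Q :=
    isCompact_Icc.prod ((isCompact_closedBall 0 R).prod (isCompact_closedBall 0 R))
  have hNcont : ContinuousOn N (Icc 0 T ×ˢ univ) := by
    have c1 : ContinuousOn (fun p : ℝ × E d × E d => extendedScore ν S₀ p.1 p.2.1)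
        (Icc 0 T ×ˢ univ) :=
      hcont.comp (f := fun p : ℝ × E d × E d => (p.1, p.2.1)) (by fun_prop)
        (fun p hp => ⟨hp.1, mem_univ _⟩)
    have c2 : ContinuousOn (fun p : ℝ × E d × E d => extendedScore ν S₀ p.1 p.2.2)
        (Icc 0 T ×ˢ univ) :=
      hcont.comp (f := fun p : ℝ × E d × E d => (p.1, p.2.2)) (by fun_prop)
        (fun p hp => ⟨hp.1, mem_univ _⟩)
    have c3 : Continuous (fun p : ℝ × E d × E d => p.2.1 - p.2.2) := by fun_prop
    have c4 := continuous_fDefect hM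
    refine ((c3.continuousOn.inner (c1.sub c2)).add ?_).add ?_
    · exact Continuous.continuousOn (by fun_prop)
    · exact Continuous.continuousOn (by fun_prop)
  let Zs : Set (ℝ × E d × E d) := (Q ∩ N ⁻¹' Iic 0) ∩ {p | r₀ ≤ ‖p.2.1 - p.2.2‖}
  have hZc : IsCompact Zs := by
    have h1 : IsClosed (Q ∩ N ⁻¹' Iic 0) :=
      (hNcont.mono (prod_mono le_rfl (subset_univ _))).preimage_isClosed_of_isClosed
        hQ.isClosed isClosed_Iic
    exact (hQ.of_isClosed_subset h1 inter_subset_left).inter_right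
      (isClosed_le continuous_const (by fun_prop))
  have hZmem : ∀ t ∈ Icc 0 T, ∀ x y, x ≠ y → N (t, x, y) ≤ 0 → (t, x, y) ∈ Zs := by
    intro t ht x y hxy hneg
    obtain ⟨-, h1, h2, h3⟩ := hloc t ht x y hxy hneg
    exact ⟨⟨⟨ht, by simpa using h2, by simpa using h3⟩, hneg⟩, h1⟩
  have hne : Zs.Nonempty := ⟨(t₁, x₁, y₁), hZmem t₁ ⟨ht₁0.le, ht₁T⟩ x₁ y₁ hxy₁ (by
    simp only [N, profileGap_extendedScore S₀ ht₁0]; exact hneg₁)⟩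
  -- the first time at which the gap is nonpositive somewhere off the diagonal
  obtain ⟨⟨τ, x, y⟩, hmem, hminτ⟩ := hZc.exists_isMinOn hne continuousOn_fst
  have hτT : τ ∈ Icc 0 T := hmem.1.1.1
  have hxy : x ≠ y := by
    intro h
    have : r₀ ≤ ‖x - y‖ := hmem.2
    rw [h, sub_self, norm_zero] at this
    linarith
  have hNle : N (τ, x, y) ≤ 0 := hmem.1.2
  have hτ0 : 0 < τ := (hloc τ hτT x y hxy hNle).1
  have hNdiag : ∀ t z, N (t, z, z) = 0 := fun t z => by simp [N, profileGap]
  have hpastN : ∀ t, 0 < t → t < τ → ∀ x' y', 0 ≤ N (t, x', y') := by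
    intro t h0 hlt x' y'
    rcases eq_or_ne x' y' with rfl | hne'
    · exact (hNdiag t x').ge
    · by_contra! hcon
      have h1 := hZmem t ⟨h0.le, hlt.le.trans hτT.2⟩ x' y' hne' hcon.le
      have h2 : τ ≤ t := hminτ h1
      linarith
  have hminN : ∀ x' y', 0 ≤ N (τ, x', y') := by
    intro x' y'
    have h1 : Tendsto (fun t => N (t, x', y')) (𝓝[Ioo 0 τ] τ) (𝓝 (N (τ, x', y'))) := by
      have : ContinuousWithinAt (fun t => N (t, x', y')) (Icc 0 T) τ :=
        (hNcont (τ, x', y') ⟨hτT, mem_univ _⟩).comp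
          (f := fun t : ℝ => (t, x', y')) (Continuous.continuousWithinAt (by fun_prop))
          (fun t ht => ⟨ht, mem_univ _⟩)
      exact this.mono_left (nhdsWithin_mono _ fun t ht => ⟨ht.1.le, ht.2.le.trans hτT.2⟩)
    have hnb : (𝓝[Ioo 0 τ] τ).NeBot := by
      rw [nhdsWithin_Ioo_eq_nhdsLT hτ0]; infer_instance
    refine ge_of_tendsto h1 ?_
    filter_upwards [self_mem_nhdsWithin] with t ht
    exact hpastN t ht.1 ht.2 x' y'
  have hconv : ∀ t, 0 < t → ∀ x' y', N (t, x', y') = profileGap (flowScore ν) M δ K t x' y' :=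
    fun t ht x' y' => profileGap_extendedScore S₀ ht x' y'
  refine profileGap_not_touching hν (K := K) hM hδ hτ0 hxy
    (fun x' y' => hconv τ hτ0 x' y' ▸ hminN x' y')
    (fun t h0 hlt x' y' => hconv t h0 x' y' ▸ hpastN t h0 hlt x' y')
    (hconv τ hτ0 x y ▸ le_antisymm hNle (hminN x y)) ?_
  have h1 := hdrift τ hτ0 hτT.2 x
  have h2 := hdrift τ hτ0 hτT.2 y
  have hd : (0 : ℝ) ≤ d := Nat.cast_nonneg d
  have hCn := abs_nonneg C₁
  have hx := sq_nonneg ‖x‖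
  have hy := sq_nonneg ‖y‖
  rw [hK]
  nlinarith [mul_nonneg hd hx, mul_nonneg hd hy, mul_nonneg hCn hx, mul_nonneg hCn hy]

/-- Propagation of the semiconvexity profile along the heat flow: a lower bound `-r f_M(r)` for the
monotonicity of the initial score `S₀` holds at all later times. Let the barrier in
`profileGap_pos` tend to zero. -/
theorem flowScore_profile (hν : GaussTame ν) [NeZero ν] {M : ℝ} (hM : 0 < M) {S₀ : E d → E d}
    (hS₀ : Continuous S₀)
    (hprof : ∀ x y, -(‖x - y‖ * fDefect M ‖x - y‖) ≤ ⟪x - y, S₀ x - S₀ y⟫)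
    (hlim : ∀ x₀, Tendsto (fun p : ℝ × E d => flowScore ν p.1 p.2) (𝓝[>] 0 ×ˢ 𝓝 x₀) (𝓝 (S₀ x₀)))
    {C T : ℝ} (hC0 : 0 < C)
    (hC : ∀ t, 0 < t → t ≤ T → ∀ x y,
      -(C * ‖x - y‖ ^ 2) ≤ ⟪x - y, flowScore ν t x - flowScore ν t y⟫)
    {t : ℝ} (ht : 0 < t) (htT : t ≤ T) (x y : E d) :
    -(‖x - y‖ * fDefect M ‖x - y‖) ≤ ⟪x - y, flowScore ν t x - flowScore ν t y⟫ := by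
  rcases eq_or_ne x y with rfl | hxy
  · simp
  obtain ⟨K, hK⟩ := profileGap_pos hν hM hS₀ hprof hlim hC0 hC
  have h : Tendsto (fun δ : ℝ => profileGap (flowScore ν) M δ K t x y) (𝓝[>] 0)
      (𝓝 (profileGap (flowScore ν) M 0 K t x y)) := by
    refine Tendsto.mono_left (Continuous.tendsto ?_ 0) nhdsWithin_le_nhds
    unfold profileGap
    fun_prop
  have := ge_of_tendsto h (b := 0) (by
    filter_upwards [self_mem_nhdsWithin] with δ hδ
    exact (hK δ hδ t ht htT x y hxy).le)
  simp only [profileGap, zero_mul, add_zero] at this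
  linarith

end MaximumPrinciple

/-! ### The Prékopa–Leindler inequality -/

section PrekopaLeindler

/-- Brunn–Minkowski on the line: a translate of `K` and a translate of `L` meet in at most one
point, and both lie in twice the set of midpoints. -/
lemma volume_add_volume_le_of_compact {K L C : Set ℝ} (hK : IsCompact K) (hL : IsCompact L)
    (hKne : K.Nonempty) (hLne : L.Nonempty) (hC : ∀ x ∈ K, ∀ y ∈ L, (x + y) / 2 ∈ C) :
    volume K + volume L ≤ 2 * volume C := by
  obtain ⟨a, haK, ha⟩ := hK.exists_isGreatest hKne
  obtain ⟨b, hbL, hb⟩ := hL.exists_isLeast hLne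
  set A := (fun x => x + b) '' K
  set B := (fun y => a + y) '' L
  have hA : volume A = volume K := by
    simp only [A, image_add_right, measure_preimage_add_right]
  have hB : volume B = volume L := by
    simp only [B, image_add_left, measure_preimage_add]
  have hdisj : AEDisjoint volume A B := by
    refine measure_mono_null (t := {a + b}) ?_ (by simp)
    rintro z ⟨⟨x, hx, rfl⟩, ⟨y, hy, hxy⟩⟩
    have h1 := ha hx
    have h2 := hb hy
    simp only at hxy
    simp only [mem_singleton_iff]
    linarith
  have hBm : NullMeasurableSet B volume :=
    (hL.image (by fun_prop)).isClosed.measurableSet.nullMeasurableSet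
  have hsub : A ∪ B ⊆ (fun x : ℝ => (2 : ℝ)⁻¹ * x) ⁻¹' C := by
    rintro z (⟨x, hx, rfl⟩ | ⟨y, hy, rfl⟩)
    · have := hC x hx b hbL
      simp only [mem_preimage]
      rwa [inv_mul_eq_div]
    · have := hC a haK y hy
      simp only [mem_preimage]
      rwa [inv_mul_eq_div]
  calc volume K + volume L = volume (A ∪ B) := by rw [measure_union₀ hBm hdisj, hA, hB]
    _ ≤ volume ((fun x : ℝ => (2 : ℝ)⁻¹ * x) ⁻¹' C) := measure_mono hsub
    _ = 2 * volume C := by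
      rw [Real.volume_preimage_mul_left (by norm_num)]
      simp

lemma volume_add_volume_le {A B C : Set ℝ} (hA : MeasurableSet A) (hB : MeasurableSet B)
    (hAne : A.Nonempty) (hBne : B.Nonempty) (hC : ∀ x ∈ A, ∀ y ∈ B, (x + y) / 2 ∈ C) :
    volume A + volume B ≤ 2 * volume C := by
  obtain ⟨a, ha⟩ := hAne
  obtain ⟨b, hb⟩ := hBne
  have key : ∀ K, K ⊆ A → IsCompact K → ∀ L, L ⊆ B → IsCompact L →
      volume K + volume L ≤ 2 * volume C := by
    intro K hKA hK L hLB hL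
    refine le_trans (add_le_add (measure_mono (subset_insert a K))
      (measure_mono (subset_insert b L))) ?_
    refine volume_add_volume_le_of_compact (hK.insert a) (hL.insert b) (insert_nonempty _ _)
      (insert_nonempty _ _) fun x hx y hy => hC x ?_ y ?_
    · rcases hx with rfl | hx
      exacts [ha, hKA hx]
    · rcases hy with rfl | hy
      exacts [hb, hLB hy]
  have hsup : ∀ s : Set ℝ, MeasurableSet s →
      volume s = ⨆ K, ⨆ _ : K ⊆ s ∧ IsCompact K, volume K := fun s hs => by
    rw [hs.measure_eq_iSup_isCompact]; simp only [iSup_and]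
  rw [hsup A hA, hsup B hB]
  exact ENNReal.biSup_add_biSup_le' ⟨∅, empty_subset _, isCompact_empty⟩
    ⟨∅, empty_subset _, isCompact_empty⟩ fun K hK L hL => key K hK.1 hK.2 L hL.1 hL.2

/-- Functions of supremum one: apply the Brunn–Minkowski inequality to the superlevel sets, which
are nonempty below level one, and integrate over the levels. -/
lemma lintegral_add_le_of_sup_eq_one {f g h : ℝ → ℝ} (hf : Measurable f) (hg : Measurable g)
    (hh : Measurable h) (hf0 : ∀ x, 0 ≤ f x) (hg0 : ∀ x, 0 ≤ g x) (hh0 : ∀ x, 0 ≤ h x)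
    (hf1 : ∀ x, f x ≤ 1) (hg1 : ∀ x, g x ≤ 1) (hfs : ∀ t < 1, ∃ x, t < f x)
    (hgs : ∀ t < 1, ∃ x, t < g x) (H : ∀ x y, f x * g y ≤ h ((x + y) / 2) ^ 2) :
    (∫⁻ x, ENNReal.ofReal (f x)) + ∫⁻ x, ENNReal.ofReal (g x)
      ≤ 2 * ∫⁻ x, ENNReal.ofReal (h x) := by
  have hmeas : ∀ u : ℝ → ℝ, Measurable fun t : ℝ => volume {a | t < u a} := fun u =>
    Antitone.measurable fun s t hst => measure_mono fun a (ha : t < u a) => lt_of_le_of_lt hst ha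
  rw [lintegral_eq_lintegral_meas_lt volume (Eventually.of_forall hf0) hf.aemeasurable,
    lintegral_eq_lintegral_meas_lt volume (Eventually.of_forall hg0) hg.aemeasurable,
    lintegral_eq_lintegral_meas_lt volume (Eventually.of_forall hh0) hh.aemeasurable,
    ← lintegral_add_left (hmeas f), ← lintegral_const_mul _ (hmeas h)]
  refine setLIntegral_mono ((hmeas h).const_mul _) fun t ht => ?_
  rw [mem_Ioi] at ht
  rcases lt_or_ge t 1 with h1 | h1
  · refine volume_add_volume_le (measurableSet_lt measurable_const hf)
      (measurableSet_lt measurable_const hg) (hfs t h1) (hgs t h1) fun x hx y hy => ?_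
    have h2 := H x y
    have hx' : t < f x := hx
    have hy' : t < g y := hy
    have h3 : t ^ 2 < h ((x + y) / 2) ^ 2 := by nlinarith
    exact lt_of_pow_lt_pow_left₀ 2 (hh0 _) h3
  · have e1 : {a | t < f a} = ∅ := by
      ext a; simpa using (hf1 a).trans h1
    have e2 : {a | t < g a} = ∅ := by
      ext a; simpa using (hg1 a).trans h1
    simp [e1, e2]

lemma ENNReal_mul_le_sq {a b c : ℝ≥0∞} (h : a + b ≤ 2 * c) : a * b ≤ c ^ 2 := by
  rcases eq_or_ne c ⊤ with rfl | hc
  · simp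
  have hab : a + b ≠ ⊤ := ne_top_of_le_ne_top (ENNReal.mul_ne_top (by simp) hc) h
  rw [ENNReal.add_ne_top] at hab
  lift a to ℝ≥0 using hab.1
  lift b to ℝ≥0 using hab.2
  lift c to ℝ≥0 using hc
  norm_cast at h ⊢
  have h' : (a : ℝ) + b ≤ 2 * c := by exact_mod_cast h
  have : (a : ℝ) * b ≤ c ^ 2 := by nlinarith [sq_nonneg ((a : ℝ) - b), a.2, b.2, c.2]
  exact_mod_cast this

/-- Bounded functions: divide `f` and `g` by their suprema and pass from the sum to the product by
the inequality of arithmetic and geometric means. -/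
lemma lintegral_mul_le_sq_of_bounded {f g h : ℝ → ℝ} {n : ℝ} (hf : Measurable f)
    (hg : Measurable g)
    (hh : Measurable h) (hf0 : ∀ x, 0 ≤ f x) (hg0 : ∀ x, 0 ≤ g x) (hh0 : ∀ x, 0 ≤ h x)
    (hfn : ∀ x, f x ≤ n) (hgn : ∀ x, g x ≤ n) (H : ∀ x y, f x * g y ≤ h ((x + y) / 2) ^ 2) :
    (∫⁻ x, ENNReal.ofReal (f x)) * ∫⁻ x, ENNReal.ofReal (g x)
      ≤ (∫⁻ x, ENNReal.ofReal (h x)) ^ 2 := by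
  have hfb : BddAbove (range f) := ⟨n, by rintro _ ⟨x, rfl⟩; exact hfn x⟩
  have hgb : BddAbove (range g) := ⟨n, by rintro _ ⟨x, rfl⟩; exact hgn x⟩
  set F := ⨆ x, f x with hF
  set G := ⨆ x, g x with hG
  have hF0 : 0 ≤ F := (hf0 0).trans (le_ciSup hfb 0)
  have hG0 : 0 ≤ G := (hg0 0).trans (le_ciSup hgb 0)
  rcases hF0.eq_or_lt with h0 | hFpos
  · have : ∀ x, f x = 0 := fun x => le_antisymm (h0 ▸ le_ciSup hfb x) (hf0 x)
    simp [this]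
  rcases hG0.eq_or_lt with h0 | hGpos
  · have : ∀ x, g x = 0 := fun x => le_antisymm (h0 ▸ le_ciSup hgb x) (hg0 x)
    simp [this]
  set q := √(F * G) with hq
  have hqpos : 0 < q := Real.sqrt_pos.2 (mul_pos hFpos hGpos)
  have hq2 : q ^ 2 = F * G := Real.sq_sqrt (mul_pos hFpos hGpos).le
  have key := lintegral_add_le_of_sup_eq_one (f := fun x => f x / F) (g := fun x => g x / G)
    (h := fun x => h x / q) (hf.div_const _) (hg.div_const _) (hh.div_const _)
    (fun x => div_nonneg (hf0 x) hF0) (fun x => div_nonneg (hg0 x) hG0)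
    (fun x => div_nonneg (hh0 x) hqpos.le)
    (fun x => (div_le_one hFpos).2 (le_ciSup hfb x))
    (fun x => (div_le_one hGpos).2 (le_ciSup hgb x))
    (fun t ht => by
      obtain ⟨x, hx⟩ := exists_lt_of_lt_ciSup (show t * F < ⨆ x, f x by nlinarith)
      exact ⟨x, (lt_div_iff₀ hFpos).2 hx⟩)
    (fun t ht => by
      obtain ⟨x, hx⟩ := exists_lt_of_lt_ciSup (show t * G < ⨆ x, g x by nlinarith)
      exact ⟨x, (lt_div_iff₀ hGpos).2 hx⟩)
    (fun x y => by
      rw [div_mul_div_comm, div_pow, hq2]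
      exact div_le_div_of_nonneg_right (H x y) (by positivity))
  have h2 := ENNReal_mul_le_sq key
  have scale : ∀ (u : ℝ → ℝ) (c : ℝ), 0 < c → (∀ x, 0 ≤ u x) → Measurable u →
      ∫⁻ x, ENNReal.ofReal (u x) = ENNReal.ofReal c * ∫⁻ x, ENNReal.ofReal (u x / c) := by
    intro u c hc hu hum
    rw [← lintegral_const_mul _ (hum.div_const c).ennreal_ofReal]
    congr 1; ext x
    rw [← ENNReal.ofReal_mul hc.le, mul_div_cancel₀ _ hc.ne']
  rw [scale f F hFpos hf0 hf, scale g G hGpos hg0 hg, scale h q hqpos hh0 hh, mul_pow,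
    ← ENNReal.ofReal_pow hqpos.le, hq2, ENNReal.ofReal_mul hF0]
  calc _ = ENNReal.ofReal F * ENNReal.ofReal G * ((∫⁻ x, ENNReal.ofReal (f x / F)) *
        ∫⁻ x, ENNReal.ofReal (g x / G)) := by ring
    _ ≤ _ := by gcongr

/-- The Prékopa–Leindler inequality on the line, at midpoints. The functions are truncated at
height `n` to make them bounded. -/
theorem prekopa_leindler_real {f g h : ℝ → ℝ≥0∞} (hf : Measurable f) (hg : Measurable g)
    (hh : Measurable h) (H : ∀ x y, f x * g y ≤ h ((x + y) / 2) ^ 2) :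
    (∫⁻ x, f x) * ∫⁻ x, g x ≤ (∫⁻ x, h x) ^ 2 := by
  have trunc : ∀ n : ℕ, (∫⁻ x, min (f x) n) * ∫⁻ x, min (g x) n ≤ (∫⁻ x, h x) ^ 2 := by
    intro n
    have hne : ∀ (u : ℝ → ℝ≥0∞) x, min (u x) n ≠ ⊤ := fun u x =>
      ne_top_of_le_ne_top (ENNReal.natCast_ne_top n) (min_le_right _ _)
    have hle : ∀ (u : ℝ → ℝ≥0∞) x, (min (u x) n).toReal ≤ n := fun u x => by
      have := ENNReal.toReal_mono (ENNReal.natCast_ne_top n) (min_le_right (u x) n)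
      simpa using this
    have key := lintegral_mul_le_sq_of_bounded (n := n) (f := fun x => (min (f x) n).toReal)
      (g := fun x => (min (g x) n).toReal) (h := fun x => (min (h x) n).toReal)
      (hf.min measurable_const).ennreal_toReal (hg.min measurable_const).ennreal_toReal
      (hh.min measurable_const).ennreal_toReal (fun x => ENNReal.toReal_nonneg)
      (fun x => ENNReal.toReal_nonneg) (fun x => ENNReal.toReal_nonneg)
      (hle f) (hle g) (fun x y => by
        rw [← ENNReal.toReal_mul, ← ENNReal.toReal_pow]
        refine ENNReal.toReal_mono (ENNReal.pow_ne_top (hne h _)) ?_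
        rcases le_total (h ((x + y) / 2)) n with h1 | h1
        · rw [min_eq_left h1]
          exact (mul_le_mul' (min_le_left _ _) (min_le_left _ _)).trans (H x y)
        · rw [min_eq_right h1, sq]
          exact mul_le_mul' (min_le_right _ _) (min_le_right _ _))
    simp only [ENNReal.ofReal_toReal (hne _ _)] at key
    refine key.trans ?_
    gcongr
    exact min_le_left _ _
  have lim : ∀ u : ℝ → ℝ≥0∞, Measurable u → ∫⁻ x, u x = ⨆ n : ℕ, ∫⁻ x, min (u x) n := by
    intro u hu
    rw [← lintegral_iSup (fun n => hu.min measurable_const)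
      (fun m n hmn x => min_le_min_left _ (by exact_mod_cast hmn))]
    congr 1; ext x
    have : (⨆ n : ℕ, min (u x) (n : ℝ≥0∞)) = min (u x) (⨆ n : ℕ, (n : ℝ≥0∞)) :=
      (inf_iSup_eq (u x) fun n : ℕ => (n : ℝ≥0∞)).symm
    rw [this, ENNReal.iSup_natCast, min_eq_left le_top]
  have mono : ∀ u : ℝ → ℝ≥0∞, Monotone fun n : ℕ => ∫⁻ x, min (u x) n := fun u m n hmn =>
    lintegral_mono fun x => min_le_min_left _ (by exact_mod_cast hmn)
  rw [lim f hf, lim g hg, ENNReal.iSup_mul]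
  simp only [ENNReal.mul_iSup]
  exact iSup_le fun i => iSup_le fun j => le_trans (mul_le_mul'
    (mono f (le_max_left i j)) (mono g (le_max_right i j))) (trunc (max i j))

/-- The Prékopa–Leindler inequality in `ℝⁿ`, by induction: the integrals over the remaining
coordinates satisfy the one-dimensional hypothesis in the first. -/
theorem prekopa_leindler_pi {n : ℕ} : ∀ {f g h : (Fin n → ℝ) → ℝ≥0∞}, Measurable f →
    Measurable g → Measurable h → (∀ x y, f x * g y ≤ h ((1 / 2 : ℝ) • (x + y)) ^ 2) →
    (∫⁻ x, f x) * ∫⁻ x, g x ≤ (∫⁻ x, h x) ^ 2 := by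
  induction n with
  | zero =>
    intro f g h _ _ _ H
    have e : ∀ u : (Fin 0 → ℝ) → ℝ≥0∞, ∫⁻ x, u x = u 0 := by
      intro u
      rw [lintegral_unique, volume_pi, Measure.pi_of_empty _ (0 : Fin 0 → ℝ)]
      simp only [Measure.dirac_apply_of_mem (mem_univ _), mul_one]
      exact congrArg u (Subsingleton.elim _ _)
    rw [e, e, e]
    simpa using H 0 0
  | succ n ih =>
    intro f g h hf hg hh H
    let e := (MeasurableEquiv.piFinSuccAbove (fun _ : Fin (n + 1) => ℝ) 0).symm
    have he : ∀ s z, e (s, z) = (Fin.cons s z : Fin (n + 1) → ℝ) := by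
      intro s z
      simp [e, MeasurableEquiv.piFinSuccAbove, Fin.insertNthEquiv]
    have hpres : MeasurePreserving e := (volume_preserving_piFinSuccAbove (fun _ => ℝ) 0).symm
    have split : ∀ u : (Fin (n + 1) → ℝ) → ℝ≥0∞, Measurable u →
        ∫⁻ x, u x = ∫⁻ s : ℝ, ∫⁻ z : Fin n → ℝ, u (e (s, z)) := by
      intro u hu
      rw [← hpres.lintegral_comp hu, Measure.volume_eq_prod,
        lintegral_prod (fun p => u (e p)) (hu.comp e.measurable).aemeasurable]
    have meas : ∀ u : (Fin (n + 1) → ℝ) → ℝ≥0∞, Measurable u →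
        Measurable fun s : ℝ => ∫⁻ z : Fin n → ℝ, u (e (s, z)) := fun u hu =>
      (hu.comp e.measurable).lintegral_prod_right'
    have sec : ∀ u : (Fin (n + 1) → ℝ) → ℝ≥0∞, Measurable u → ∀ s : ℝ,
        Measurable fun z : Fin n → ℝ => u (e (s, z)) := fun u hu s =>
      (hu.comp e.measurable).comp measurable_prodMk_left
    rw [split f hf, split g hg, split h hh]
    refine prekopa_leindler_real (meas f hf) (meas g hg) (meas h hh) fun s s' => ?_
    refine ih (sec f hf s) (sec g hg s') (sec h hh _) fun z z' => ?_
    refine (H _ _).trans (le_of_eq ?_)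
    congr 2
    rw [he, he, he]
    ext i
    refine Fin.cases ?_ (fun j => ?_) i
    · simp; ring
    · simp; ring

theorem prekopa_leindler {d : ℕ} {f g h : E d → ℝ≥0∞} (hf : Measurable f)
    (hg : Measurable g) (hh : Measurable h)
    (H : ∀ x y, f x * g y ≤ h ((1 / 2 : ℝ) • (x + y)) ^ 2) :
    (∫⁻ x, f x) * ∫⁻ x, g x ≤ (∫⁻ x, h x) ^ 2 := by
  have hpres := (EuclideanSpace.volume_preserving_symm_measurableEquiv_toLp (Fin d)).symm
  let e := (MeasurableEquiv.toLp 2 (Fin d → ℝ)).symm.symm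
  have hm : Measurable e := e.measurable
  have hc : ∀ u : E d → ℝ≥0∞, Measurable u → ∫⁻ x, u x = ∫⁻ x, u (e x) := fun u hu =>
    (hpres.lintegral_comp hu).symm
  rw [hc f hf, hc g hg, hc h hh]
  exact prekopa_leindler_pi (hf.comp hm) (hg.comp hm) (hh.comp hm) fun x y => H _ _

end PrekopaLeindler

/-! ### Gibbs measures and a Brascamp–Lieb inequality -/

section Gibbs

variable {d : ℕ} {W : E d → ℝ} {M : ℝ}

/-- A `C¹` potential with semiconvexity profile `-f_M`: the gradient satisfies `⟪x - y, ∇W x - ∇W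
y⟫ ≥ -r f_M(r)` for `r = ‖x - y‖`. The form without quotient covers `x = y`. -/
structure ProfilePotential (W : E d → ℝ) (M : ℝ) : Prop where
  contDiff : ContDiff ℝ 1 W
  M_pos : 0 < M
  profile : ∀ x y, -(‖x - y‖ * fDefect M ‖x - y‖) ≤ ⟪x - y, gradient W x - gradient W y⟫

/-- The measure `e^{-W(y)} dy`; it need not be finite. -/
def gibbs (W : E d → ℝ) : Measure (E d) :=
  volume.withDensity fun y => ENNReal.ofReal (Real.exp (-W y))

lemma hasDerivAt_potential_line (hW : ContDiff ℝ 1 W) (x v : E d) (s : ℝ) :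
    HasDerivAt (fun s : ℝ => W (x + s • v)) ⟪gradient W (x + s • v), v⟫ s := by
  have h1 : HasFDerivAt W (fderiv ℝ W (x + s • v)) (x + s • v) :=
    (hW.differentiable one_ne_zero _).hasFDerivAt
  have h2 : HasDerivAt (fun s : ℝ => x + s • v) v s := by
    simpa using ((hasDerivAt_id s).smul_const v).const_add x
  have h3 := h1.comp_hasDerivAt s h2
  refine h3.congr_deriv ?_
  simp [gradient]

lemma ProfilePotential.inner_gradient_line_ge (hW : ProfilePotential W M) (x v : E d) {s : ℝ}
    (hs : 0 < s) :
    ⟪gradient W x, v⟫ - ‖v‖ * fDefect M (s * ‖v‖) ≤ ⟪gradient W (x + s • v), v⟫ := by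
  have h := hW.profile (x + s • v) x
  rw [add_sub_cancel_left, norm_smul, Real.norm_of_nonneg hs.le, real_inner_smul_left,
    inner_sub_right, real_inner_comm (gradient W (x + s • v)), real_inner_comm (gradient W x)] at h
  have : s * (⟪gradient W x, v⟫ - ‖v‖ * fDefect M (s * ‖v‖)) ≤
      s * ⟪gradient W (x + s • v), v⟫ := by nlinarith
  exact le_of_mul_le_mul_left this hs

/-- The potential decreases at most linearly, because `f_M` is bounded by `2 √M`. -/
lemma ProfilePotential.neg_le (hW : ProfilePotential W M) :
    ∃ A B : ℝ, 0 ≤ B ∧ ∀ y, -W y ≤ A + B * ‖y‖ := by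
  refine ⟨-W 0, ‖gradient W 0‖ + 2 * √M, by positivity, fun y => ?_⟩
  have hd : ∀ s, HasDerivAt (fun s : ℝ => W (0 + s • y)) ⟪gradient W (0 + s • y), y⟫ s :=
    fun s => hasDerivAt_potential_line hW.contDiff 0 y s
  obtain ⟨s, hs, hse⟩ := exists_hasDerivAt_eq_slope (fun s : ℝ => W (0 + s • y)) _ zero_lt_one
    (fun s _ => (hd s).continuousAt.continuousWithinAt) (fun s _ => hd s)
  simp only [zero_add, one_smul, zero_smul, sub_zero, div_one] at hse
  have h1 := hW.inner_gradient_line_ge 0 y hs.1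
  simp only [zero_add] at h1
  have h2 := (abs_le.1 (abs_real_inner_le_norm (gradient W 0) y)).1
  have h3 := mul_le_mul_of_nonneg_left (fDefect_le M (s * ‖y‖)) (norm_nonneg y)
  linarith

lemma integrable_exp_neg_mul_norm_sq {b : ℝ} (hb : 0 < b) :
    Integrable (fun y : E d => Real.exp (-b * ‖y‖ ^ 2)) := by
  have h := (GaussianFourier.integrable_cexp_neg_mul_sq_norm_add (V := E d) (b := (b : ℂ))
    (by simpa using hb) 0 0).norm
  refine h.congr (Eventually.of_forall fun y => ?_)
  simp [Complex.norm_exp, ← Complex.ofReal_pow]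

lemma integrable_exp_linear_sub (c : ℝ) {b : ℝ} (hb : 0 < b) :
    Integrable (fun y : E d => Real.exp (c * ‖y‖ - b * ‖y‖ ^ 2 / 2)) := by
  have : GaussTame (volume : Measure (E d)) := fun b hb => integrable_exp_neg_mul_norm_sq hb
  exact this.integrable_exp hb c

lemma measurable_gibbs_density (hW : Continuous W) :
    Measurable fun y => ENNReal.ofReal (Real.exp (-W y)) := by
  have := hW.measurable
  fun_prop

lemma integrable_gibbs_iff {G : Type*} [NormedAddCommGroup G] [NormedSpace ℝ G]
    (hW : Continuous W) {q : E d → G} :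
    Integrable q (gibbs W) ↔ Integrable fun y => Real.exp (-W y) • q y := by
  rw [gibbs, integrable_withDensity_iff_integrable_smul' (measurable_gibbs_density hW)
    (Eventually.of_forall fun _ => ENNReal.ofReal_lt_top)]
  simp [ENNReal.toReal_ofReal (Real.exp_pos _).le]

lemma integral_gibbs {G : Type*} [NormedAddCommGroup G] [NormedSpace ℝ G]
    (hW : Continuous W) (q : E d → G) :
    ∫ y, q y ∂(gibbs W) = ∫ y, Real.exp (-W y) • q y := by
  rw [gibbs, integral_withDensity_eq_integral_toReal_smul (measurable_gibbs_density hW)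
    (Eventually.of_forall fun _ => ENNReal.ofReal_lt_top)]
  simp [ENNReal.toReal_ofReal (Real.exp_pos _).le]

lemma ProfilePotential.gaussTame (hW : ProfilePotential W M) : GaussTame (gibbs W) := by
  intro b hb
  obtain ⟨A, B, hB, h⟩ := hW.neg_le
  have hc := hW.contDiff.continuous
  rw [integrable_gibbs_iff hc]
  refine ((integrable_exp_linear_sub B (b := 2 * b) (by positivity)).const_mul (Real.exp A)).mono'
    (Continuous.aestronglyMeasurable (by fun_prop)) (Eventually.of_forall fun y => ?_)
  rw [smul_eq_mul, Real.norm_of_nonneg (by positivity), ← Real.exp_add, ← Real.exp_add]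
  refine Real.exp_le_exp.2 ?_
  have := h y
  linarith

lemma neZero_gibbs (hW : Continuous W) : NeZero (gibbs W) := by
  refine ⟨fun h => ?_⟩
  rw [gibbs, withDensity_eq_zero_iff (measurable_gibbs_density hW).aemeasurable] at h
  have hv : (volume : Measure (E d)) = 0 := by
    rw [← ae_eq_bot, ← Filter.eventually_false_iff_eq_bot]
    filter_upwards [h] with y hy
    simp only [Pi.zero_apply, ENNReal.ofReal_eq_zero] at hy
    exact absurd (Real.exp_pos _) (not_lt.2 hy)
  exact NeZero.ne (volume : Measure (E d)) hv

/-- Since `f_M(r) ≤ M r`, the function `W + M ‖·‖² / 2` is midpoint convex. -/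
lemma ProfilePotential.midpoint (hW : ProfilePotential W M) (y y' : E d) :
    2 * W ((1 / 2 : ℝ) • (y + y')) - M * ‖y - y'‖ ^ 2 / 4 ≤ W y + W y' := by
  set u := (1 / 2 : ℝ) • (y + y') with hu
  set v := (1 / 2 : ℝ) • (y - y') with hv
  have hyv : y = u + (1 : ℝ) • v := by rw [hu, hv]; module
  have hyv' : y' = u + (-1 : ℝ) • v := by rw [hu, hv]; module
  have hd : ∀ s : ℝ, HasDerivAt
      (fun s : ℝ => W (u + s • v) + W (u + s • (-v)) + M * ‖v‖ ^ 2 * s ^ 2)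
      (⟪gradient W (u + s • v), v⟫ + ⟪gradient W (u + s • (-v)), -v⟫
        + M * ‖v‖ ^ 2 * (2 * s)) s := by
    intro s
    refine ((hasDerivAt_potential_line hW.contDiff u v s).add
      (hasDerivAt_potential_line hW.contDiff u (-v) s)).add ?_
    simpa using (hasDerivAt_pow 2 s).const_mul (M * ‖v‖ ^ 2)
  obtain ⟨s, hs, hse⟩ := exists_hasDerivAt_eq_slope _ _ zero_lt_one
    (fun s _ => (hd s).continuousAt.continuousWithinAt) (fun s _ => hd s)
  have h := hW.profile (u + s • v) (u + s • (-v))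
  have e : u + s • v - (u + s • (-v)) = (2 * s) • v := by module
  have hs0 : 0 < 2 * s := by linarith [hs.1]
  rw [e, norm_smul, Real.norm_of_nonneg hs0.le, real_inner_smul_left] at h
  have h1 := fDefect_le_mul hW.M_pos (r := 2 * s * ‖v‖) (by positivity)
  have h2 : -(M * (2 * s) * ‖v‖ ^ 2) ≤
      ⟪v, gradient W (u + s • v) - gradient W (u + s • (-v))⟫ := by
    have h3 := mul_le_mul_of_nonneg_left h1 (show 0 ≤ 2 * s * ‖v‖ by positivity)
    have : 2 * s * -(M * (2 * s) * ‖v‖ ^ 2) ≤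
      2 * s * ⟪v, gradient W (u + s • v) - gradient W (u + s • (-v))⟫ := by nlinarith
    exact le_of_mul_le_mul_left this hs0
  have hnv : ‖y - y'‖ = 2 * ‖v‖ := by
    rw [hv, norm_smul]; norm_num; ring
  simp only [one_smul, zero_smul, add_zero, sub_zero, div_one, one_pow] at hse
  rw [inner_sub_right] at h2
  rw [inner_neg_right, real_inner_comm v, real_inner_comm v] at hse
  rw [hnv]
  have e1 : W y = W (u + v) := by conv_lhs => rw [hyv, one_smul]
  have e2 : W y' = W (u + -v) := by conv_lhs => rw [hyv', neg_one_smul]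
  rw [e1, e2]
  nlinarith

/-- Brascamp–Lieb for linear observables under a tilt that is strongly log-concave of modulus `b -
M`. Prékopa–Leindler bounds the product of the normalising constants of the tilts `η + s v` and `η
- s v` by the square of the one at `η` times `e^{s² ‖v‖² / (b - M)}`; the second order condition at
`s = 0` is the claim, as the second derivative of the logarithm of the normalising constant is the
variance. -/
lemma ProfilePotential.tiltCov_le (hW : ProfilePotential W M) {b : ℝ} (hb : M < b) (η v : E d) :
    tiltCov (gibbs W) (fun y => ⟪v, y⟫) (fun y => ⟪v, y⟫) (η, b) ≤ ‖v‖ ^ 2 / (b - M) := by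
  have hν := hW.gaussTame
  have hc := hW.contDiff.continuous
  have := neZero_gibbs hc
  have hb0 : 0 < b := hW.M_pos.trans hb
  set Z : E d → ℝ := fun η => tiltInt (gibbs W) (fun _ => (1 : ℝ)) (η, b) with hZ
  have hZpos : ∀ η, 0 < Z η := fun η => hν.tiltInt_one_pos (p := (η, b)) hb0
  have hcont : ∀ η : E d, Continuous fun y => Real.exp (tiltForm y (η, b) - W y) := fun η => by
    have : Continuous fun y => tiltForm y ((η, b) : E d × ℝ) :=
      continuous_tiltForm.clm_apply continuous_const
    fun_prop
  have hZe : ∀ η, Z η = ∫ y, Real.exp (tiltForm y (η, b) - W y) := by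
    intro η
    simp only [hZ, tiltInt]
    rw [integral_gibbs hc]
    congr 1; ext y
    rw [smul_eq_mul, smul_eq_mul, mul_one, ← Real.exp_add]; congr 1; ring
  have hint : ∀ η : E d, Integrable fun y => Real.exp (tiltForm y (η, b) - W y) := by
    intro η
    have := (integrable_gibbs_iff hc).1 (hν.integrable_exp_tiltForm (p := (η, b)) hb0)
    refine this.congr (Eventually.of_forall fun y => ?_)
    simp only [smul_eq_mul]
    rw [← Real.exp_add]; congr 1; ring
  have hZl : ∀ η, ENNReal.ofReal (Z η) =
      ∫⁻ y, ENNReal.ofReal (Real.exp (tiltForm y (η, b) - W y)) := fun η => by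
    rw [hZe, ofReal_integral_eq_lintegral_ofReal (hint η)
      (Eventually.of_forall fun y => (Real.exp_pos _).le)]
  -- the Prékopa–Leindler inequality for opposite tilts
  have hPL : ∀ s : ℝ, Z (η + s • v) * Z (η + s • (-v)) ≤
      Z η ^ 2 * Real.exp (s ^ 2 * (‖v‖ ^ 2 / (b - M))) := by
    intro s
    set κ := Real.exp (s ^ 2 * (‖v‖ ^ 2 / (b - M)) / 2) with hκ
    have hκ0 : 0 < κ := Real.exp_pos _
    have h := prekopa_leindler
      (f := fun y => ENNReal.ofReal (Real.exp (tiltForm y (η + s • v, b) - W y)))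
      (g := fun y => ENNReal.ofReal (Real.exp (tiltForm y (η + s • (-v), b) - W y)))
      (h := fun y => ENNReal.ofReal κ * ENNReal.ofReal (Real.exp (tiltForm y (η, b) - W y)))
      (hcont _).measurable.ennreal_ofReal (hcont _).measurable.ennreal_ofReal
      ((hcont _).measurable.ennreal_ofReal.const_mul _) (fun y y' => by
        rw [← ENNReal.ofReal_mul hκ0.le, ← ENNReal.ofReal_mul (Real.exp_pos _).le,
          ← ENNReal.ofReal_pow (by positivity)]
        refine ENNReal.ofReal_le_ofReal ?_
        rw [hκ, ← Real.exp_add, ← Real.exp_add, ← Real.exp_nat_mul]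
        refine Real.exp_le_exp.2 ?_
        have hmid := hW.midpoint y y'
        simp only [tiltForm_apply]
        have hpar : ‖(1 / 2 : ℝ) • (y + y')‖ ^ 2 = (‖y‖ ^ 2 + ‖y'‖ ^ 2) / 2 - ‖y - y'‖ ^ 2 / 4 := by
          rw [norm_smul, mul_pow, Real.norm_eq_abs, sq_abs, norm_add_sq_real, norm_sub_sq_real]
          ring
        rw [hpar]
        simp only [inner_add_left, real_inner_smul_left, inner_neg_left, real_inner_smul_right,
          inner_add_right]
        have hcs := abs_le.1 (abs_real_inner_le_norm v (y - y'))
        rw [inner_sub_right] at hcs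
        have hbM : 0 < b - M := by linarith
        have hq : s * (⟪v, y⟫ - ⟪v, y'⟫) ≤
            (b - M) * ‖y - y'‖ ^ 2 / 4 + s ^ 2 * (‖v‖ ^ 2 / (b - M)) := by
          have h1 : s * (⟪v, y⟫ - ⟪v, y'⟫) ≤ |s| * (‖v‖ * ‖y - y'‖) := by
            refine (le_abs_self _).trans ?_
            rw [abs_mul]
            exact mul_le_mul_of_nonneg_left (abs_le.2 hcs) (abs_nonneg s)
          have h2 : (b - M) * ‖y - y'‖ ^ 2 / 4 + s ^ 2 * (‖v‖ ^ 2 / (b - M))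
              - |s| * (‖v‖ * ‖y - y'‖)
              = ((b - M) * ‖y - y'‖ / 2 - |s| * ‖v‖) ^ 2 / (b - M) := by
            rw [← sq_abs s]; field_simp; ring
          have h3 : 0 ≤ ((b - M) * ‖y - y'‖ / 2 - |s| * ‖v‖) ^ 2 / (b - M) := by positivity
          linarith
        push_cast
        linarith)
    rw [lintegral_const_mul _ (hcont _).measurable.ennreal_ofReal, ← hZl, ← hZl, ← hZl,
      ← ENNReal.ofReal_mul hκ0.le, ← ENNReal.ofReal_mul (hZpos _).le,
      ← ENNReal.ofReal_pow (mul_pos hκ0 (hZpos _)).le] at h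
    have h' := (ENNReal.ofReal_le_ofReal_iff (by positivity)).1 h
    refine h'.trans (le_of_eq ?_)
    rw [mul_pow, hκ, ← Real.exp_nat_mul, mul_comm]
    congr 2
    push_cast; ring
  have hη : ∀ (v : E d) (s : ℝ), HasDerivAt (fun s : ℝ => η + s • v) v s := fun v s => by
    simpa using ((hasDerivAt_id s).smul_const v).const_add η
  have hlog : ∀ (v : E d) (s : ℝ), HasDerivAt (fun s : ℝ => Real.log (Z (η + s • v)))
      (tiltMean (gibbs W) (fun y => ⟪v, y⟫) (η + s • v, b)) s := by
    intro v s
    have h := (hasDerivAt_tiltInt hν (expGrowth_const (1 : ℝ)) (hη v s) (hasDerivAt_const s b)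
      hb0).log (hZpos _).ne'
    refine h.congr_deriv ?_
    rw [tiltMean_eq]
    simp [div_eq_inv_mul]
  have hmean : ∀ (v : E d) (s : ℝ), HasDerivAt
      (fun s : ℝ => tiltMean (gibbs W) (fun y => ⟪v, y⟫) (η + s • v, b))
      (tiltCov (gibbs W) (fun y => ⟪v, y⟫) (fun y => ⟪v, y⟫) (η + s • v, b)) s := by
    intro v s
    refine (hasDerivAt_tiltMean hν (expGrowth_inner v) (hη v s) (hasDerivAt_const s b)
      hb0).congr_deriv ?_
    simp [tiltCov]
  let φ : ℝ → ℝ := fun s => s ^ 2 * (‖v‖ ^ 2 / (b - M)) + 2 * Real.log (Z η)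
    - Real.log (Z (η + s • v)) - Real.log (Z (η + s • (-v)))
  let φ' : ℝ → ℝ := fun s => 2 * s * (‖v‖ ^ 2 / (b - M))
    - tiltMean (gibbs W) (fun y => ⟪v, y⟫) (η + s • v, b)
    - tiltMean (gibbs W) (fun y => ⟪-v, y⟫) (η + s • (-v), b)
  have hφ : ∀ s, HasDerivAt φ (φ' s) s := by
    intro s
    have h1 : HasDerivAt (fun s : ℝ => s ^ 2 * (‖v‖ ^ 2 / (b - M)))
        (2 * s * (‖v‖ ^ 2 / (b - M))) s := by
      simpa using (hasDerivAt_pow 2 s).mul_const (‖v‖ ^ 2 / (b - M))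
    exact ((h1.add_const _).sub (hlog v s)).sub (hlog (-v) s)
  have hneg : ∀ p, tiltCov (gibbs W) (fun y => ⟪-v, y⟫) (fun y => ⟪-v, y⟫) p =
      tiltCov (gibbs W) (fun y => ⟪v, y⟫) (fun y => ⟪v, y⟫) p := fun p => by
    simp [tiltCov, tiltMean, integral_neg]
  have hφ' : HasDerivAt φ' (2 * (‖v‖ ^ 2 / (b - M))
      - 2 * tiltCov (gibbs W) (fun y => ⟪v, y⟫) (fun y => ⟪v, y⟫) (η, b)) 0 := by
    have h1 : HasDerivAt (fun s : ℝ => 2 * s * (‖v‖ ^ 2 / (b - M)))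
        (2 * (‖v‖ ^ 2 / (b - M))) 0 := by
      simpa using ((hasDerivAt_id (0 : ℝ)).const_mul 2).mul_const (‖v‖ ^ 2 / (b - M))
    refine ((h1.sub (hmean v 0)).sub (hmean (-v) 0)).congr_deriv ?_
    rw [hneg]
    simp only [zero_smul, add_zero]
    ring
  have hmin : IsLocalMin φ 0 := by
    refine Eventually.of_forall fun s => ?_
    have h0 : φ 0 = 0 := by simp [φ]; ring
    rw [h0]
    have h1 := Real.log_le_log (mul_pos (hZpos _) (hZpos _)) (hPL s)
    rw [Real.log_mul (hZpos _).ne' (hZpos _).ne', Real.log_mul (pow_pos (hZpos _) 2).ne'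
      (Real.exp_pos _).ne', Real.log_exp, Real.log_pow] at h1
    simp only [φ]
    push_cast at h1
    linarith
  have := second_deriv_nonneg_of_isLocalMin (Eventually.of_forall hφ) hφ' hmin
  linarith

end Gibbs

/-! ### A one-sided Lipschitz bound up to time zero -/

section Crude

variable {d : ℕ} {W : E d → ℝ} {M : ℝ}

/-- A tilted density of a profile potential has a critical point, at its maximum. -/
lemma ProfilePotential.exists_mode (hW : ProfilePotential W M) {b : ℝ} (hb : 0 < b) (η : E d) :
    ∃ m : E d, b • m - η + gradient W m = 0 := by
  obtain ⟨A, B, hB, h⟩ := hW.neg_le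
  have hc := hW.contDiff.continuous
  let U : E d → ℝ := fun y => b * ‖y‖ ^ 2 / 2 - ⟪η, y⟫ + W y
  have hU : Continuous U := by fun_prop
  have hlim : Tendsto U (cocompact (E d)) atTop := by
    have h1 : Tendsto (fun r : ℝ => r * (b * r / 2 - (‖η‖ + B)) - A) atTop atTop := by
      refine tendsto_atTop_add_const_right _ _ (tendsto_id.atTop_mul_atTop₀ ?_)
      refine tendsto_atTop_add_const_right _ _ ?_
      exact (tendsto_id.const_mul_atTop hb).atTop_div_const two_pos
    refine tendsto_atTop_mono (fun y => ?_) (h1.comp (tendsto_norm_cocompact_atTop (E := E d)))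
    have h2 := h y
    have h3 := (abs_le.1 (abs_real_inner_le_norm η y)).2
    simp only [U, Function.comp]
    nlinarith
  obtain ⟨m, hm⟩ := hU.exists_forall_le hlim
  refine ⟨m, ?_⟩
  refine ext_inner_right ℝ fun v => ?_
  have hd : HasDerivAt (fun s : ℝ => U (m + s • v)) ⟪b • m - η + gradient W m, v⟫ 0 := by
    have h1 := ((hasDerivAt_norm_sq_line m v 0).const_mul b).div_const 2
    have h2 : HasDerivAt (fun s : ℝ => ⟪η, m + s • v⟫) ⟪η, v⟫ 0 := by
      have : HasDerivAt (fun s : ℝ => ⟪η, m⟫ + s * ⟪η, v⟫) ⟪η, v⟫ 0 := by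
        simpa using ((hasDerivAt_id (0 : ℝ)).mul_const ⟪η, v⟫).const_add ⟪η, m⟫
      simpa [inner_add_right, real_inner_smul_right] using this
    refine ((h1.sub h2).add (hasDerivAt_potential_line hW.contDiff m v 0)).congr_deriv ?_
    simp only [zero_smul, add_zero, inner_add_left, inner_sub_left, real_inner_smul_left]
    ring
  have hmin : IsLocalMin (fun s : ℝ => U (m + s • v)) 0 :=
    Eventually.of_forall fun s => by simpa using hm (m + s • v)
  simpa using hmin.hasDerivAt_eq_zero hd

/-- A covariance bound uniform in the tilt vector and in the precision `b ≥ b₀`, also where the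
tilted density is not log-concave. Centred at its mode, the density `g` satisfies `‖w‖² g(w) ≤ C₀
g(w / 2)`, because along rays the exponent is a quadratic of curvature `b` up to a linear error `2
√M ‖w‖`; integrating gives the second moment about the mode. -/
lemma ProfilePotential.exists_tiltCov_le (hW : ProfilePotential W M) {b₀ : ℝ} (hb₀ : 0 < b₀) :
    ∃ C : ℝ, 0 < C ∧ ∀ b, b₀ ≤ b → ∀ η v : E d,
      tiltCov (gibbs W) (fun y => ⟪v, y⟫) (fun y => ⟪v, y⟫) (η, b) ≤ C * ‖v‖ ^ 2 := by
  -- `4 / b₀` comes from `‖w‖² ≤ (4 / b₀) e^{b₀ ‖w‖² / 4}`, the exponential from Young's inequality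
  -- for the linear error
  set C₀ := 4 / b₀ * Real.exp (2 * M / b₀) with hC₀
  have hC₀0 : 0 < C₀ := by positivity
  refine ⟨C₀ * 2 ^ d, by positivity, fun b hb η v => ?_⟩
  have hb0 : 0 < b := hb₀.trans_le hb
  have hν := hW.gaussTame
  have hc := hW.contDiff.continuous
  have := neZero_gibbs hc
  have hp2 : 0 < ((η, b) : E d × ℝ).2 := hb0
  have := hν.isProbabilityMeasure_tiltLaw hp2
  obtain ⟨m, hm⟩ := hW.exists_mode hb0 η
  -- the tilted density, centred at its mode
  let g : E d → ℝ := fun w => Real.exp (tiltForm (m + w) (η, b) - W (m + w))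
  have hgc : Continuous g := by
    have : Continuous fun y => tiltForm y ((η, b) : E d × ℝ) :=
      continuous_tiltForm.clm_apply continuous_const
    fun_prop
  have hmove : ∀ q : E d → ℝ, tiltMean (gibbs W) q (η, b) =
      (∫ w, g w)⁻¹ * ∫ w, g w * q (m + w) := by
    intro q
    rw [tiltMean_eq, tiltInt, tiltInt, integral_gibbs hc, integral_gibbs hc,
      ← integral_add_left_eq_self _ m, ← integral_add_left_eq_self (fun y => Real.exp (-W y) • _) m]
    have : ∀ w, g w = Real.exp (-W (m + w)) * Real.exp (tiltForm (m + w) (η, b)) := fun w => by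
      rw [← Real.exp_add]; simp only [g]; congr 1; ring
    simp only [smul_eq_mul, mul_one, this, mul_assoc]
  have hgi : ∀ q : E d → ℝ, ExpGrowth q → Integrable fun w => g w * q (m + w) := by
    intro q hq
    have h1 := (integrable_gibbs_iff hc).1 (hν.integrable_tilt hq hp2)
    refine (h1.comp_add_left m).congr (Eventually.of_forall fun w => ?_)
    simp only [g, smul_eq_mul]
    rw [← mul_assoc, ← Real.exp_add]; congr 2; ring
  have hg0 : Integrable g := by simpa using hgi _ (expGrowth_const (1 : ℝ))
  have hgpos : 0 < ∫ w, g w := by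
    have : g = fun w => Real.exp (tiltForm (m + w) (η, b) - W (m + w)) := rfl
    rw [this]
    exact integral_exp_pos hg0
  -- comparison of the density with its dilation
  have hkey : ∀ w, ‖w‖ ^ 2 * g w ≤ C₀ * g ((1 / 2 : ℝ) • w) := by
    intro w
    -- minus the exponent of `g` on the ray, less its quadratic growth and plus the largest linear
    -- error; by the equation of the mode and the profile its derivative is nonnegative
    let φ : ℝ → ℝ := fun s => b * ‖m + s • w‖ ^ 2 / 2 - ⟪η, m + s • w⟫ + W (m + s • w)
      - b * ‖w‖ ^ 2 * s ^ 2 / 2 + 2 * √M * ‖w‖ * s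
    have hφ : ∀ s, HasDerivAt φ (b * (2 * ⟪m + s • w, w⟫) / 2 - ⟪η, w⟫
        + ⟪gradient W (m + s • w), w⟫ - b * ‖w‖ ^ 2 * (2 * s) / 2 + 2 * √M * ‖w‖) s := by
      intro s
      have h1 := ((hasDerivAt_norm_sq_line m w s).const_mul b).div_const 2
      have h2 : HasDerivAt (fun s : ℝ => ⟪η, m + s • w⟫) ⟪η, w⟫ s := by
        have : HasDerivAt (fun s : ℝ => ⟪η, m⟫ + s * ⟪η, w⟫) ⟪η, w⟫ s := by
          simpa using ((hasDerivAt_id s).mul_const ⟪η, w⟫).const_add ⟪η, m⟫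
        simpa [inner_add_right, real_inner_smul_right] using this
      have h3 : HasDerivAt (fun s : ℝ => b * ‖w‖ ^ 2 * s ^ 2 / 2)
          (b * ‖w‖ ^ 2 * (2 * s) / 2) s := by
        simpa using ((hasDerivAt_pow 2 s).const_mul (b * ‖w‖ ^ 2)).div_const 2
      have h4 : HasDerivAt (fun s : ℝ => 2 * √M * ‖w‖ * s) (2 * √M * ‖w‖) s := by
        simpa using (hasDerivAt_id s).const_mul (2 * √M * ‖w‖)
      exact (((h1.sub h2).add (hasDerivAt_potential_line hW.contDiff m w s)).sub h3).add h4
    obtain ⟨s, hs, hse⟩ := exists_hasDerivAt_eq_slope φ _ (show (1 / 2 : ℝ) < 1 by norm_num)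
      (fun s _ => (hφ s).continuousAt.continuousWithinAt) (fun s _ => hφ s)
    have hs0 : 0 < s := by linarith [hs.1]
    have h1 := hW.inner_gradient_line_ge m w hs0
    have h2 := mul_le_mul_of_nonneg_left (fDefect_le M (s * ‖w‖)) (norm_nonneg w)
    have h3 : ⟪b • m - η + gradient W m, w⟫ = 0 := by rw [hm, inner_zero_left]
    simp only [inner_add_left, inner_sub_left, real_inner_smul_left] at h3
    rw [inner_add_left, real_inner_smul_left, real_inner_self_eq_norm_sq] at hse
    have hφle : φ (1 / 2) ≤ φ 1 := by
      have : 0 ≤ (φ 1 - φ (1 / 2)) / (1 - 1 / 2) := by rw [← hse]; nlinarith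
      have h5 := mul_nonneg this (show (0 : ℝ) ≤ 1 - 1 / 2 by norm_num)
      rw [div_mul_cancel₀ _ (by norm_num)] at h5
      linarith
    simp only [φ, one_smul] at hφle
    have hsq := Real.sq_sqrt hW.M_pos.le
    have hquad : ‖w‖ ^ 2 ≤ 4 / b₀ * Real.exp (b₀ * ‖w‖ ^ 2 / 4) := by
      have := Real.add_one_le_exp (b₀ * ‖w‖ ^ 2 / 4)
      calc ‖w‖ ^ 2 = 4 / b₀ * (b₀ * ‖w‖ ^ 2 / 4) := by field_simp
        _ ≤ _ := by gcongr; linarith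
    have hyoung : b₀ * ‖w‖ ^ 2 / 4 - 2 * M / b₀ ≤ 3 / 8 * b₀ * ‖w‖ ^ 2 - √M * ‖w‖ := by
      have : 3 / 8 * b₀ * ‖w‖ ^ 2 - √M * ‖w‖ - (b₀ * ‖w‖ ^ 2 / 4 - 2 * M / b₀)
          = (b₀ * ‖w‖ - 4 * √M) ^ 2 / (8 * b₀) := by
        field_simp; nlinarith
      have h0 : 0 ≤ (b₀ * ‖w‖ - 4 * √M) ^ 2 / (8 * b₀) := by positivity
      linarith
    have hbb : b₀ * ‖w‖ ^ 2 ≤ b * ‖w‖ ^ 2 := by gcongr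
    calc ‖w‖ ^ 2 * g w ≤ 4 / b₀ * Real.exp (b₀ * ‖w‖ ^ 2 / 4) * g w :=
          mul_le_mul_of_nonneg_right hquad (Real.exp_pos _).le
      _ = 4 / b₀ * Real.exp (b₀ * ‖w‖ ^ 2 / 4 + (tiltForm (m + w) (η, b) - W (m + w))) := by
          simp only [g]; rw [mul_assoc, ← Real.exp_add]
      _ ≤ 4 / b₀ * Real.exp (2 * M / b₀ + (tiltForm (m + (1 / 2 : ℝ) • w) (η, b)
            - W (m + (1 / 2 : ℝ) • w))) := by
          refine mul_le_mul_of_nonneg_left (Real.exp_le_exp.2 ?_) (by positivity)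
          simp only [tiltForm_apply]
          linarith
      _ = C₀ * g ((1 / 2 : ℝ) • w) := by
          simp only [g, hC₀]; rw [Real.exp_add, mul_assoc]
  have hscale : ∫ w, g ((1 / 2 : ℝ) • w) = 2 ^ d * ∫ w, g w := by
    rw [Measure.integral_comp_smul]
    simp
  have hgs : Integrable fun w => g ((1 / 2 : ℝ) • w) := hg0.comp_smul (by norm_num)
  have hnn : ExpGrowth fun y : E d => ‖y - m‖ ^ 2 := by
    have h1 : ExpGrowth fun y : E d => y + -m := expGrowth_id.add (expGrowth_const _)
    obtain ⟨h1c, C, k, hC, h1⟩ := h1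
    have h2 : ExpGrowth fun y : E d => ‖y - m‖ :=
      ⟨by fun_prop, C, k, hC, fun y => by simpa [sub_eq_add_neg] using h1 y⟩
    simpa [sq] using h2.smul h2
  have hvar : tiltMean (gibbs W) (fun y => ‖y - m‖ ^ 2) (η, b) ≤ C₀ * 2 ^ d := by
    rw [hmove]
    have hi := hgi _ hnn
    simp only [add_sub_cancel_left] at hi ⊢
    rw [inv_mul_le_iff₀ hgpos]
    calc ∫ w, g w * ‖w‖ ^ 2 ≤ ∫ w, C₀ * g ((1 / 2 : ℝ) • w) :=
          integral_mono hi (hgs.const_mul _) fun w => by rw [mul_comm]; exact hkey w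
      _ = _ := by rw [integral_const_mul, hscale]; ring
  have hiv := expGrowth_inner v
  have i1 := hν.integrable_tiltLaw hiv hp2
  have i2 : Integrable (fun y => ⟪v, y⟫ * ⟪v, y⟫) (tiltLaw (gibbs W) (η, b)) := by
    simpa using hν.integrable_tiltLaw (hiv.smul hiv) hp2
  have i3 := hν.integrable_tiltLaw hnn hp2
  have hcov : tiltCov (gibbs W) (fun y => ⟪v, y⟫) (fun y => ⟪v, y⟫) (η, b) ≤
      tiltMean (gibbs W) (fun y => (⟪v, y⟫ - ⟪v, m⟫) ^ 2) (η, b) := by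
    have : tiltMean (gibbs W) (fun y => (⟪v, y⟫ - ⟪v, m⟫) ^ 2) (η, b) =
        tiltMean (gibbs W) (fun y => ⟪v, y⟫ * ⟪v, y⟫) (η, b)
          - 2 * ⟪v, m⟫ * tiltMean (gibbs W) (fun y => ⟪v, y⟫) (η, b) + ⟪v, m⟫ ^ 2 := by
      simp only [tiltMean]
      rw [← integral_const_mul, ← integral_sub i2 (i1.const_mul _)]
      have e : ⟪v, m⟫ ^ 2 = ∫ _, ⟪v, m⟫ ^ 2 ∂(tiltLaw (gibbs W) (η, b)) := by simp
      conv_rhs => rw [e]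
      have i4 : Integrable (fun y => ⟪v, y⟫ * ⟪v, y⟫ - 2 * ⟪v, m⟫ * ⟪v, y⟫)
          (tiltLaw (gibbs W) (η, b)) := i2.sub (i1.const_mul _)
      rw [← integral_add i4 (integrable_const _)]
      congr 1; ext y; ring
    rw [this, tiltCov]
    nlinarith [sq_nonneg (tiltMean (gibbs W) (fun y => ⟪v, y⟫) (η, b) - ⟪v, m⟫)]
  refine hcov.trans ?_
  calc tiltMean (gibbs W) (fun y => (⟪v, y⟫ - ⟪v, m⟫) ^ 2) (η, b)
      ≤ ∫ y, ‖v‖ ^ 2 * ‖y - m‖ ^ 2 ∂(tiltLaw (gibbs W) (η, b)) := by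
        refine integral_mono_of_nonneg (Eventually.of_forall fun y => sq_nonneg _)
          (i3.const_mul _) (Eventually.of_forall fun y => ?_)
        simp only
        rw [← inner_sub_right, ← mul_pow, ← sq_abs]
        exact pow_le_pow_left₀ (abs_nonneg _) (abs_real_inner_le_norm _ _) 2
    _ = ‖v‖ ^ 2 * tiltMean (gibbs W) (fun y => ‖y - m‖ ^ 2) (η, b) := integral_const_mul _ _
    _ ≤ ‖v‖ ^ 2 * (C₀ * 2 ^ d) := by gcongr
    _ = _ := by ring

/-- Mean value theorem: a lower bound for the symmetric derivative of the flow score is a one-sided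
Lipschitz bound. -/
lemma inner_flowScore_sub_ge {ν : Measure (E d)} (hν : GaussTame ν) [NeZero ν] {t C : ℝ}
    (ht : 0 < t) (hC : ∀ v x : E d, -(C * ‖v‖ ^ 2) ≤ flowScoreD ν t v v x) (x y : E d) :
    -(C * ‖x - y‖ ^ 2) ≤ ⟪x - y, flowScore ν t x - flowScore ν t y⟫ := by
  have hd := fun s => hasDerivAt_flowScore_line hν ht y (x - y) (x - y) s
  obtain ⟨s, hs, hse⟩ := exists_hasDerivAt_eq_slope _ _ zero_lt_one
    (fun s _ => (hd s).continuousAt.continuousWithinAt) (fun s _ => hd s)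
  have := hC (x - y) (y + s • (x - y))
  rw [hse] at this
  simpa [inner_sub_right] using this

/-- The flow score is one-sided Lipschitz, uniformly up to time zero. For `t ≤ 1 / (2 M)` the
posterior law is log-concave and Brascamp–Lieb gives the bound `2 M`; for later times the uniform
covariance bound suffices, because `1 / t` is bounded. -/
lemma ProfilePotential.exists_flowScore_ge (hW : ProfilePotential W M) (T : ℝ) :
    ∃ C : ℝ, 0 < C ∧ ∀ t, 0 < t → t ≤ T → ∀ x y,
      -(C * ‖x - y‖ ^ 2) ≤ ⟪x - y, flowScore (gibbs W) t x - flowScore (gibbs W) t y⟫ := by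
  have hM := hW.M_pos
  have := neZero_gibbs hW.contDiff.continuous
  rcases le_or_gt T 0 with hT | hT
  · exact ⟨1, one_pos, fun t h0 h1 => absurd h0 (not_lt.2 (h1.trans hT))⟩
  obtain ⟨C₁, hC₁, h₁⟩ := hW.exists_tiltCov_le (b₀ := T⁻¹) (inv_pos.2 hT)
  refine ⟨2 * M + 4 * M ^ 2 * C₁, by positivity, fun t h0 h1 => ?_⟩
  refine inner_flowScore_sub_ge hW.gaussTame h0 fun v x => ?_
  rw [flowScoreD, real_inner_self_eq_norm_sq]
  have hv := sq_nonneg ‖v‖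
  have hti : 0 < t⁻¹ := inv_pos.2 h0
  rcases le_or_gt (2 * M) t⁻¹ with h | h
  · have hc := hW.tiltCov_le (b := t⁻¹) (by linarith) (t⁻¹ • x) v
    have hden : 0 < t⁻¹ - M := by linarith
    have h2 : t⁻¹ * (‖v‖ ^ 2 - t⁻¹ * (‖v‖ ^ 2 / (t⁻¹ - M))) =
        -(M * (t⁻¹ / (t⁻¹ - M)) * ‖v‖ ^ 2) := by
      generalize t⁻¹ = b at hden
      have := hden.ne'
      field_simp; ring
    have h3 : t⁻¹ / (t⁻¹ - M) ≤ 2 := by rw [div_le_iff₀ hden]; linarith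
    have h4 : t⁻¹ * (‖v‖ ^ 2 - t⁻¹ * (‖v‖ ^ 2 / (t⁻¹ - M))) ≤ t⁻¹ * (‖v‖ ^ 2 - t⁻¹ *
        tiltCov (gibbs W) (fun y => ⟪v, y⟫) (fun y => ⟪v, y⟫) (t⁻¹ • x, t⁻¹)) := by gcongr
    refine le_trans ?_ h4
    rw [h2, neg_le_neg_iff]
    have : M * (t⁻¹ / (t⁻¹ - M)) ≤ 2 * M + 4 * M ^ 2 * C₁ := by
      have : 0 ≤ 4 * M ^ 2 * C₁ := by positivity
      nlinarith
    exact mul_le_mul_of_nonneg_right this hv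
  · have hc := h₁ t⁻¹ (inv_anti₀ h0 h1) (t⁻¹ • x) v
    have h5 : t⁻¹ * t⁻¹ * tiltCov (gibbs W) (fun y => ⟪v, y⟫) (fun y => ⟪v, y⟫) (t⁻¹ • x, t⁻¹) ≤
        (2 * M) * (2 * M) * (C₁ * ‖v‖ ^ 2) := by
      have h6 : t⁻¹ * t⁻¹ * tiltCov (gibbs W) (fun y => ⟪v, y⟫) (fun y => ⟪v, y⟫) (t⁻¹ • x, t⁻¹)
          ≤ t⁻¹ * t⁻¹ * (C₁ * ‖v‖ ^ 2) := by gcongr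
      refine h6.trans ?_
      gcongr
    have h7 : 0 ≤ t⁻¹ * ‖v‖ ^ 2 := by positivity
    have h8 : 0 ≤ 2 * M * ‖v‖ ^ 2 := by positivity
    nlinarith

end Crude

/-! ### The flow score as time tends to zero -/

section InitialLayer

variable {d : ℕ} {W : E d → ℝ} {M : ℝ} {G : Type*} [NormedAddCommGroup G] [NormedSpace ℝ G]

lemma gaussTame_volume : GaussTame (volume : Measure (E d)) :=
  fun _ hb => integrable_exp_neg_mul_norm_sq hb

/-- The standard Gaussian integral of `q`, without the normalising constant. -/
lemma tiltInt_volume_zero (q : E d → G) :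
    tiltInt volume q ((0 : E d), (1 : ℝ)) = ∫ z, Real.exp (-‖z‖ ^ 2 / 2) • q z := by
  simp [tiltInt, tiltForm_apply, neg_div]

lemma integral_gaussian_smul_id : ∫ z : E d, Real.exp (-‖z‖ ^ 2 / 2) • z = 0 := by
  have h := integral_neg_eq_self (fun z : E d => Real.exp (-‖z‖ ^ 2 / 2) • z) volume
  simp only [norm_neg, smul_neg, integral_neg] at h
  have h2 : (2 : ℝ) • ∫ z : E d, Real.exp (-‖z‖ ^ 2 / 2) • z = 0 := by
    rw [two_smul]
    nth_rewrite 1 [← h]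
    exact neg_add_cancel _
  exact (smul_eq_zero.1 h2).resolve_left two_ne_zero

lemma tiltMean_volume_id_zero :
    tiltMean volume (fun y : E d => y) ((0 : E d), (1 : ℝ)) = 0 := by
  rw [tiltMean_eq, tiltInt_volume_zero (fun y : E d => y), integral_gaussian_smul_id, smul_zero]

/-- The tilt of Lebesgue measure with parameters `(η, 1)` is the Gaussian law `N(η, I)`. -/
lemma tiltMean_volume_id (η : E d) : tiltMean volume (fun y : E d => y) (η, (1 : ℝ)) = η := by
  have key : ∀ q : E d → E d, tiltInt volume q (η, (1 : ℝ)) =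
      Real.exp (‖η‖ ^ 2 / 2) • tiltInt volume (fun z => q (z + η)) ((0 : E d), (1 : ℝ)) := by
    intro q
    rw [tiltInt_volume_zero, tiltInt, ← integral_smul,
      ← integral_add_right_eq_self (fun y : E d => Real.exp (tiltForm y (η, (1 : ℝ))) • q y) η]
    congr 1; ext1 z
    rw [smul_smul, ← Real.exp_add, tiltForm_apply]
    congr 2
    rw [norm_add_sq_real, inner_add_right, real_inner_self_eq_norm_sq, real_inner_comm]
    ring
  have key1 : tiltInt volume (fun _ => (1 : ℝ)) (η, (1 : ℝ)) =
      Real.exp (‖η‖ ^ 2 / 2) * tiltInt volume (fun _ => (1 : ℝ)) ((0 : E d), (1 : ℝ)) := by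
    rw [tiltInt_volume_zero, tiltInt, ← integral_const_mul,
      ← integral_add_right_eq_self (fun y : E d => Real.exp (tiltForm y (η, (1 : ℝ))) • (1 : ℝ)) η]
    congr 1; ext1 z
    rw [smul_eq_mul, smul_eq_mul, mul_one, mul_one, ← Real.exp_add, tiltForm_apply]
    congr 1
    rw [norm_add_sq_real, inner_add_right, real_inner_self_eq_norm_sq, real_inner_comm]
    ring
  have hν := gaussTame_volume (d := d)
  have hpos := hν.tiltInt_one_pos (p := ((0 : E d), (1 : ℝ))) one_pos
  have h0 := tiltMean_volume_id_zero (d := d)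
  rw [tiltMean_eq] at h0
  have h0' : tiltInt volume (fun z : E d => z) ((0 : E d), (1 : ℝ)) = 0 :=
    (smul_eq_zero.1 h0).resolve_left (inv_ne_zero hpos.ne')
  have hadd : tiltInt volume (fun z : E d => z + η) ((0 : E d), (1 : ℝ)) =
      tiltInt volume (fun _ => (1 : ℝ)) ((0 : E d), (1 : ℝ)) • η := by
    have : tiltInt volume (fun z : E d => z + η) ((0 : E d), (1 : ℝ)) =
        tiltInt volume (fun z : E d => z) ((0 : E d), (1 : ℝ)) +
          tiltInt volume (fun _ : E d => η) ((0 : E d), (1 : ℝ)) := by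
      simp only [tiltInt, smul_add]
      exact integral_add (hν.integrable_tilt expGrowth_id one_pos)
        (hν.integrable_tilt (expGrowth_const η) one_pos)
    rw [this, h0', zero_add]
    simp only [tiltInt, smul_eq_mul, mul_one]
    rw [integral_smul_const]
  rw [tiltMean_eq, key1, key, hadd, smul_smul, smul_smul, mul_assoc]
  rw [show (Real.exp (‖η‖ ^ 2 / 2) * tiltInt volume (fun _ => (1 : ℝ)) ((0 : E d), (1 : ℝ)))⁻¹ *
    (Real.exp (‖η‖ ^ 2 / 2) * tiltInt volume (fun _ => (1 : ℝ)) ((0 : E d), (1 : ℝ))) = 1 from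
    inv_mul_cancel₀ (mul_pos (Real.exp_pos _) hpos).ne', one_smul]

/-- The covariance of the standard Gaussian is the identity; it is the derivative of the mean in
the tilt. -/
lemma integral_gaussian_inner_smul (a : E d) :
    ∫ z : E d, Real.exp (-‖z‖ ^ 2 / 2) • (⟪a, z⟫ • z) =
      (∫ z : E d, Real.exp (-‖z‖ ^ 2 / 2)) • a := by
  have hν := gaussTame_volume (d := d)
  have hη : HasDerivAt (fun s : ℝ => s • a) a 0 := by
    simpa using (hasDerivAt_id (0 : ℝ)).smul_const a
  have h1 := hasDerivAt_tiltMean hν expGrowth_id hη (hasDerivAt_const (0 : ℝ) (1 : ℝ)) one_pos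
  simp only [tiltMean_volume_id] at h1
  have h2 := h1.unique hη
  simp only [zero_smul, smul_zero, sub_zero, zero_mul, zero_div] at h2
  have h3 := hν.tiltInt_one_pos (p := ((0 : E d), (1 : ℝ))) one_pos
  rw [tiltMean_eq] at h2
  have h4 := congrArg (fun v => tiltInt volume (fun _ => (1 : ℝ)) ((0 : E d), (1 : ℝ)) • v) h2
  simp only [smul_smul, mul_inv_cancel₀ h3.ne', one_smul] at h4
  rw [tiltInt_volume_zero, tiltInt_volume_zero] at h4
  simpa using h4

lemma integral_comp_add_smul (F : E d → G) (x : E d) {h : ℝ} (hh : 0 < h) :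
    ∫ y, F y = h ^ d • ∫ z, F (x + h • z) := by
  rw [Measure.integral_comp_smul volume (fun z => F (x + z)), integral_add_left_eq_self F x,
    smul_smul]
  have : h ^ d * |(h ^ Module.finrank ℝ (E d))⁻¹| = 1 := by
    rw [finrank_euclideanSpace, Fintype.card_fin, abs_of_pos (by positivity)]
    exact mul_inv_cancel₀ (by positivity)
  rw [this, one_smul]

/-- The posterior integrals at time `h²`, after the substitution `y = x + h z` into standard
Gaussian ones. -/
lemma tiltInt_gibbs_eq (hW : Continuous W) (q : E d → G) (x : E d) {h : ℝ} (hh : 0 < h) :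
    tiltInt (gibbs W) q (((h ^ 2)⁻¹ • x), (h ^ 2)⁻¹) =
      (h ^ d * Real.exp (‖x‖ ^ 2 / (2 * h ^ 2))) •
        ∫ z, (Real.exp (-‖z‖ ^ 2 / 2) * Real.exp (-W (x + h • z))) • q (x + h • z) := by
  rw [tiltInt, integral_gibbs hW, integral_comp_add_smul _ x hh, mul_smul]
  congr 1
  rw [← integral_smul]
  refine integral_congr_ae (ae_of_all _ fun z => ?_)
  simp only [smul_smul]
  congr 1
  rw [← Real.exp_add, ← Real.exp_add, ← Real.exp_add, tiltForm_apply]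
  congr 1
  simp only
  rw [norm_add_sq_real, inner_add_right, real_inner_smul_left, real_inner_smul_left,
    real_inner_self_eq_norm_sq, real_inner_smul_right, norm_smul, mul_pow, Real.norm_eq_abs, sq_abs]
  field_simp
  ring

lemma integrable_gaussian_of_le {q : E d → G} (hq : Continuous q) {C k : ℝ}
    (h : ∀ z, ‖q z‖ ≤ C * Real.exp (k * ‖z‖)) :
    Integrable fun z => Real.exp (-‖z‖ ^ 2 / 2) • q z := by
  have h0 : 0 ≤ C := by
    have := (norm_nonneg _).trans (h 0)
    simpa using this
  have := (gaussTame_volume (d := d)).integrable_tilt ⟨hq, C, k, h0, h⟩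
    (p := ((0 : E d), (1 : ℝ))) one_pos
  simpa [tiltForm_apply, neg_div] using this

/-- The flow score as a Gaussian average of difference quotients of the density. -/
lemma ProfilePotential.flowScore_eq (hW : ProfilePotential W M) (x : E d) {h : ℝ} (hh : 0 < h) :
    flowScore (gibbs W) (h ^ 2) x =
      -(∫ z, Real.exp (-‖z‖ ^ 2 / 2) * Real.exp (-W (x + h • z)))⁻¹ •
        ∫ z, Real.exp (-‖z‖ ^ 2 / 2) •
          ((h⁻¹ * (Real.exp (-W (x + h • z)) - Real.exp (-W x))) • z) := by
  have hc := hW.contDiff.continuous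
  have hν := hW.gaussTame
  have := neZero_gibbs hc
  obtain ⟨A, B, hB, hAB⟩ := hW.neg_le
  set c := h ^ d * Real.exp (‖x‖ ^ 2 / (2 * h ^ 2)) with hcdef
  have hc0 : 0 < c := by positivity
  set D := ∫ z, Real.exp (-‖z‖ ^ 2 / 2) * Real.exp (-W (x + h • z)) with hD
  have hcp : Continuous fun z => Real.exp (-W (x + h • z)) := by fun_prop
  have hbd : ∀ z, ‖Real.exp (-W (x + h • z))‖ ≤
      Real.exp (A + B * ‖x‖) * Real.exp (B * h * ‖z‖) := by
    intro z
    rw [Real.norm_of_nonneg (Real.exp_pos _).le, ← Real.exp_add]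
    refine Real.exp_le_exp.2 ((hAB _).trans ?_)
    have h1 : ‖x + h • z‖ ≤ ‖x‖ + h * ‖z‖ := by
      refine (norm_add_le _ _).trans ?_
      rw [norm_smul, Real.norm_of_nonneg hh.le]
    nlinarith
  have hE : ExpGrowth fun z => Real.exp (-W (x + h • z)) := ⟨hcp, _, _, (Real.exp_pos _).le, hbd⟩
  have hi := fun {q : E d → E d} (hq : ExpGrowth q) =>
    (gaussTame_volume (d := d)).integrable_tilt hq (p := ((0 : E d), (1 : ℝ))) one_pos
  simp only [tiltForm_apply, inner_zero_left, one_mul, zero_sub, ← neg_div] at hi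
  have i1 := hi (hE.smul (expGrowth_const x))
  have i2 := hi (hE.smul expGrowth_id)
  have i3 := hi expGrowth_id
  have e1 : tiltInt (gibbs W) (fun _ => (1 : ℝ)) (((h ^ 2)⁻¹ • x), (h ^ 2)⁻¹) = c * D := by
    rw [tiltInt_gibbs_eq hc _ x hh]; simp [hcdef, hD]
  have hcD : 0 < c * D := by
    rw [← e1]
    exact hν.tiltInt_one_pos (p := (((h ^ 2)⁻¹ • x), (h ^ 2)⁻¹))
      (by simp only; positivity)
  have hD0 : D ≠ 0 := (pos_of_mul_pos_right hcD hc0.le).ne'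
  have e2 : tiltInt (gibbs W) (fun y => y) (((h ^ 2)⁻¹ • x), (h ^ 2)⁻¹) =
      c • (D • x + h • ∫ z, Real.exp (-‖z‖ ^ 2 / 2) • (Real.exp (-W (x + h • z)) • z)) := by
    rw [tiltInt_gibbs_eq hc _ x hh]
    congr 1
    rw [hD, ← integral_smul, ← integral_smul_const, ← integral_add]
    · congr 1; ext1 z
      module
    · simpa [smul_smul] using i1
    · exact i2.smul h
  have e4 : ∫ z : E d, Real.exp (-‖z‖ ^ 2 / 2) •
      ((h⁻¹ * (Real.exp (-W (x + h • z)) - Real.exp (-W x))) • z) =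
      h⁻¹ • ∫ z, Real.exp (-‖z‖ ^ 2 / 2) • (Real.exp (-W (x + h • z)) • z) := by
    have : ∀ z : E d, Real.exp (-‖z‖ ^ 2 / 2) •
      ((h⁻¹ * (Real.exp (-W (x + h • z)) - Real.exp (-W x))) • z) =
      h⁻¹ • (Real.exp (-‖z‖ ^ 2 / 2) • (Real.exp (-W (x + h • z)) • z)) -
      (h⁻¹ * Real.exp (-W x)) • (Real.exp (-‖z‖ ^ 2 / 2) • z) := fun z => by module
    simp only [this]
    have i2' := i2.smul h⁻¹
    have i3' := i3.smul (h⁻¹ * Real.exp (-W x))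
    simp only [Pi.smul_def] at i2' i3'
    rw [integral_sub i2' i3', integral_smul, integral_smul, integral_gaussian_smul_id, smul_zero,
      sub_zero]
  rw [flowScore, tiltMean_eq, e1, e2, e4]
  rw [smul_smul, show (c * D)⁻¹ * c = D⁻¹ by field_simp, smul_add, smul_smul, inv_mul_cancel₀ hD0,
    one_smul]
  generalize ∫ z, Real.exp (-‖z‖ ^ 2 / 2) • (Real.exp (-W (x + h • z)) • z) = J
  rw [sub_add_cancel_left, smul_neg, smul_smul, smul_smul, smul_smul, neg_mul, neg_smul]
  congr 2
  field_simp

/-- The flow score converges to the gradient of the potential as time tends to zero, locally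
uniformly in space: differentiate `e^{-W}` under the Gaussian average. -/
lemma ProfilePotential.tendsto_flowScore (hW : ProfilePotential W M) (x₀ : E d) :
    Tendsto (fun p : ℝ × E d => flowScore (gibbs W) p.1 p.2) (𝓝[>] 0 ×ˢ 𝓝 x₀)
      (𝓝 (gradient W x₀)) := by
  have hc := hW.contDiff.continuous
  obtain ⟨A, B, hB, hAB⟩ := hW.neg_le
  set p : E d → ℝ := fun y => Real.exp (-W y) with hp
  have hpC : ContDiff ℝ 1 p := (hW.contDiff.neg).exp
  have hpc : Continuous p := hpC.continuous
  -- a Lipschitz constant of `e^{-W}` around `x₀`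
  obtain ⟨L, hL⟩ : ∃ L : ℝ, ∀ y ∈ Metric.closedBall x₀ 2, ‖fderiv ℝ p y‖ ≤ L := by
    obtain ⟨L, hL⟩ := (isCompact_closedBall x₀ 2).exists_bound_of_continuousOn
      (f := fderiv ℝ p) (hpC.continuous_fderiv one_ne_zero).continuousOn
    exact ⟨L, hL⟩
  have hL0 : 0 ≤ L := (norm_nonneg _).trans (hL x₀ (by simp))
  have hlip : ∀ y ∈ Metric.closedBall x₀ 2, ∀ y' ∈ Metric.closedBall x₀ 2,
      ‖p y' - p y‖ ≤ L * ‖y' - y‖ := fun y hy y' hy' =>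
    (convex_closedBall x₀ 2).norm_image_sub_le_of_norm_fderiv_le
      (fun z _ => hpC.differentiable one_ne_zero z) hL hy hy'
  set K := Real.exp (A + B * (‖x₀‖ + 1)) with hK
  have hK0 : 0 < K := Real.exp_pos _
  have hpK : ∀ x ∈ Metric.ball x₀ 1, ∀ h : ℝ, 0 ≤ h → h ≤ 1 → ∀ z : E d,
      p (x + h • z) ≤ K * Real.exp (B * ‖z‖) := by
    intro x hx h h0 h1 z
    rw [hK, ← Real.exp_add]
    refine Real.exp_le_exp.2 ((hAB _).trans ?_)
    have hx' : ‖x‖ ≤ ‖x₀‖ + 1 := by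
      have := norm_sub_norm_le x x₀
      rw [Metric.mem_ball, dist_eq_norm] at hx
      linarith
    have h2 : ‖x + h • z‖ ≤ ‖x‖ + h * ‖z‖ := by
      refine (norm_add_le _ _).trans ?_
      rw [norm_smul, Real.norm_of_nonneg h0]
    have h3 : h * ‖z‖ ≤ ‖z‖ := mul_le_of_le_one_left (norm_nonneg z) h1
    nlinarith
  -- the difference quotients are dominated uniformly in `h`: by the Lipschitz constant if
  -- `h ‖z‖ ≤ 1`, and by the exponential bound together with `h⁻¹ < ‖z‖` otherwise
  have hquot : ∀ x ∈ Metric.ball x₀ 1, ∀ h : ℝ, 0 < h → h ≤ 1 → ∀ z : E d,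
      ‖h⁻¹ * (p (x + h • z) - p x)‖ ≤ (L + 2 * K * Real.exp (B * ‖z‖)) * ‖z‖ := by
    intro x hx h h0 h1 z
    have hx' : ‖x - x₀‖ < 1 := by rwa [Metric.mem_ball, dist_eq_norm] at hx
    have hnz := norm_nonneg z
    rw [norm_mul, Real.norm_of_nonneg (inv_pos.2 h0).le, inv_mul_le_iff₀ h0]
    have hE : 0 < Real.exp (B * ‖z‖) := Real.exp_pos _
    rcases le_or_gt (h * ‖z‖) 1 with hz | hz
    · have h2 := hlip x (by rw [Metric.mem_closedBall, dist_eq_norm]; linarith) (x + h • z) (by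
        rw [Metric.mem_closedBall, dist_eq_norm, add_sub_right_comm]
        refine (norm_add_le _ _).trans ?_
        rw [norm_smul, Real.norm_of_nonneg h0.le]; linarith)
      rw [add_sub_cancel_left, norm_smul, Real.norm_of_nonneg h0.le] at h2
      refine h2.trans ?_
      have : 0 ≤ 2 * K * Real.exp (B * ‖z‖) * (h * ‖z‖) := by positivity
      nlinarith
    · have h2 := hpK x hx h h0.le h1 z
      have h3 := hpK x hx 0 le_rfl zero_le_one z
      rw [zero_smul, add_zero] at h3
      have h4 : ‖p (x + h • z) - p x‖ ≤ 2 * K * Real.exp (B * ‖z‖) := by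
        have h5 : 0 < p (x + h • z) := Real.exp_pos _
        have h6 : 0 < p x := Real.exp_pos _
        rw [Real.norm_eq_abs, abs_le]
        constructor <;> linarith
      have h7 : 0 ≤ L * (h * ‖z‖) := by positivity
      have h8 : 2 * K * Real.exp (B * ‖z‖) * 1 ≤ 2 * K * Real.exp (B * ‖z‖) * (h * ‖z‖) :=
        mul_le_mul_of_nonneg_left hz.le (by positivity)
      nlinarith
  have hev : ∀ᶠ q : ℝ × E d in 𝓝[>] 0 ×ˢ 𝓝 x₀, 0 < q.1 ∧ q.1 ≤ 1 ∧ q.2 ∈ Metric.ball x₀ 1 := by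
    have h1 : ∀ᶠ h : ℝ in 𝓝[>] 0, 0 < h ∧ h ≤ 1 := by
      filter_upwards [Ioc_mem_nhdsGT (zero_lt_one' ℝ)] with h hh using ⟨hh.1, hh.2⟩
    exact (h1.prod_mk (Metric.ball_mem_nhds x₀ one_pos)).mono fun q hq => ⟨hq.1.1, hq.1.2, hq.2⟩
  have hfst : Tendsto (fun q : ℝ × E d => q.1) (𝓝[>] 0 ×ˢ 𝓝 x₀) (𝓝 0) :=
    tendsto_fst.mono_right nhdsWithin_le_nhds
  have hsnd : Tendsto (fun q : ℝ × E d => q.2) (𝓝[>] 0 ×ˢ 𝓝 x₀) (𝓝 x₀) := tendsto_snd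
  have hxz : ∀ z : E d, Tendsto (fun q : ℝ × E d => q.2 + q.1 • z) (𝓝[>] 0 ×ˢ 𝓝 x₀) (𝓝 x₀) := by
    intro z
    simpa using hsnd.add (hfst.smul_const z)
  -- the normalising integrals
  have hden : Tendsto (fun q : ℝ × E d => ∫ z, Real.exp (-‖z‖ ^ 2 / 2) * p (q.2 + q.1 • z))
      (𝓝[>] 0 ×ˢ 𝓝 x₀) (𝓝 (∫ z : E d, Real.exp (-‖z‖ ^ 2 / 2) * p x₀)) := by
    refine tendsto_integral_filter_of_dominated_convergence
      (fun z => Real.exp (-‖z‖ ^ 2 / 2) • (K * Real.exp (B * ‖z‖))) ?_ ?_ ?_ ?_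
    · exact Eventually.of_forall fun q => Continuous.aestronglyMeasurable (by fun_prop)
    · filter_upwards [hev] with q hq
      refine Eventually.of_forall fun z => ?_
      rw [norm_mul, Real.norm_of_nonneg (Real.exp_pos _).le, smul_eq_mul,
        Real.norm_of_nonneg (Real.exp_pos _).le]
      exact mul_le_mul_of_nonneg_left (hpK _ hq.2.2 _ hq.1.le hq.2.1 z) (Real.exp_pos _).le
    · refine integrable_gaussian_of_le (C := K) (k := B) (by fun_prop) fun z => ?_
      rw [Real.norm_of_nonneg (by positivity)]
    · refine Eventually.of_forall fun z => ?_
      exact ((hpc.tendsto x₀).comp (hxz z)).const_mul _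
  have hnum : Tendsto (fun q : ℝ × E d => ∫ z, Real.exp (-‖z‖ ^ 2 / 2) •
      ((q.1⁻¹ * (p (q.2 + q.1 • z) - p q.2)) • z)) (𝓝[>] 0 ×ˢ 𝓝 x₀)
      (𝓝 (∫ z : E d, Real.exp (-‖z‖ ^ 2 / 2) • (⟪gradient p x₀, z⟫ • z))) := by
    refine tendsto_integral_filter_of_dominated_convergence
      (fun z => Real.exp (-‖z‖ ^ 2 / 2) •
        (((L + 2 * K * Real.exp (B * ‖z‖)) * ‖z‖) * ‖z‖)) ?_ ?_ ?_ ?_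
    · exact Eventually.of_forall fun q => Continuous.aestronglyMeasurable (by fun_prop)
    · filter_upwards [hev] with q hq
      refine Eventually.of_forall fun z => ?_
      rw [norm_smul, Real.norm_of_nonneg (Real.exp_pos _).le, norm_smul, smul_eq_mul]
      exact mul_le_mul_of_nonneg_left (mul_le_mul_of_nonneg_right
        (hquot _ hq.2.2 _ hq.1 hq.2.1 z) (norm_nonneg _)) (Real.exp_pos _).le
    · refine integrable_gaussian_of_le (C := L + 2 * K) (k := B + 2) (by fun_prop) fun z => ?_
      have h0 := norm_nonneg z
      have h1 := Real.add_one_le_exp ‖z‖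
      rw [Real.norm_of_nonneg (by positivity)]
      have h2 : 1 ≤ Real.exp (B * ‖z‖) := Real.one_le_exp (by positivity)
      have h3 : Real.exp ((B + 2) * ‖z‖) = Real.exp (B * ‖z‖) * (Real.exp ‖z‖ * Real.exp ‖z‖) := by
        rw [← Real.exp_add, ← Real.exp_add]; congr 1; ring
      rw [h3, mul_assoc, ← mul_assoc (L + 2 * K)]
      refine mul_le_mul ?_ (mul_le_mul (by linarith) (by linarith) h0 (Real.exp_pos _).le)
        (by positivity) (by positivity)
      nlinarith
    · refine Eventually.of_forall fun z => ?_
      refine ((Tendsto.smul_const ?_ z).const_smul _)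
      have hstrict : HasStrictFDerivAt p (fderiv ℝ p x₀) x₀ :=
        hpC.contDiffAt.hasStrictFDerivAt one_ne_zero
      have h1 : (fun q : ℝ × E d => p (q.2 + q.1 • z) - p q.2 - fderiv ℝ p x₀ (q.1 • z))
          =o[𝓝[>] 0 ×ˢ 𝓝 x₀] fun q => q.1 • z := by
        have := hstrict.isLittleO.comp_tendsto ((hxz z).prodMk_nhds hsnd)
        refine (this.congr ?_ ?_) <;> intro q <;> simp
      have h2 : (fun q : ℝ × E d => p (q.2 + q.1 • z) - p q.2 - fderiv ℝ p x₀ (q.1 • z))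
          =o[𝓝[>] 0 ×ˢ 𝓝 x₀] fun q => q.1 := by
        refine h1.trans_isBigO (Asymptotics.IsBigO.of_bound ‖z‖ (Eventually.of_forall fun q => ?_))
        rw [norm_smul, mul_comm]
      have h3 := h2.tendsto_div_nhds_zero
      have h4 : Tendsto (fun q : ℝ × E d =>
          (p (q.2 + q.1 • z) - p q.2 - fderiv ℝ p x₀ (q.1 • z)) / q.1 + ⟪gradient p x₀, z⟫)
          (𝓝[>] 0 ×ˢ 𝓝 x₀) (𝓝 ⟪gradient p x₀, z⟫) := by
        simpa using h3.add_const ⟪gradient p x₀, z⟫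
      refine h4.congr' ?_
      filter_upwards [hev] with q hq
      have : fderiv ℝ p x₀ z = ⟪gradient p x₀, z⟫ := by simp [gradient]
      rw [map_smul, this, smul_eq_mul]
      have := hq.1.ne'
      field_simp
      ring
  rw [integral_gaussian_inner_smul] at hnum
  rw [integral_mul_const] at hden
  set Z := ∫ z : E d, Real.exp (-‖z‖ ^ 2 / 2) with hZ
  have hZ0 : 0 < Z := by
    have := (gaussTame_volume (d := d)).tiltInt_one_pos (p := ((0 : E d), (1 : ℝ))) one_pos
    rw [tiltInt_volume_zero] at this
    simpa [hZ] using this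
  have hp0 : 0 < p x₀ := Real.exp_pos _
  have hgrad : gradient p x₀ = -(p x₀ • gradient W x₀) := by
    have h1 : HasFDerivAt p (p x₀ • -(fderiv ℝ W x₀)) x₀ :=
      ((hW.contDiff.differentiable one_ne_zero x₀).hasFDerivAt.neg).exp
    rw [gradient, h1.fderiv, gradient]
    simp
  have hlim := ((hden.inv₀ (mul_pos hZ0 hp0).ne').neg).smul hnum
  have hval : -(Z * p x₀)⁻¹ • (Z • gradient p x₀) = gradient W x₀ := by
    rw [hgrad, smul_neg, smul_neg, smul_smul, smul_smul, ← neg_smul]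
    rw [show -(-(Z * p x₀)⁻¹ * Z * p x₀) = 1 by field_simp, one_smul]
  rw [hval] at hlim
  -- reparametrise by `h = √t`
  have hsqrt : Tendsto (fun q : ℝ × E d => (√q.1, q.2)) (𝓝[>] 0 ×ˢ 𝓝 x₀) (𝓝[>] 0 ×ˢ 𝓝 x₀) := by
    have h1 : Tendsto Real.sqrt (𝓝[>] 0) (𝓝[>] 0) := by
      refine tendsto_nhdsWithin_iff.2 ⟨?_, ?_⟩
      · have := (Real.continuous_sqrt.tendsto 0).mono_left (nhdsWithin_le_nhds (s := Ioi 0))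
        simpa using this
      · filter_upwards [self_mem_nhdsWithin] with t ht using Real.sqrt_pos.2 ht
    exact (h1.comp tendsto_fst).prodMk tendsto_snd
  refine (hlim.comp hsqrt).congr' ?_
  filter_upwards [hev] with q hq
  have := hW.flowScore_eq q.2 (Real.sqrt_pos.2 hq.1)
  rw [Real.sq_sqrt hq.1.le] at this
  rw [this]
  rfl

/-- The semiconvexity profile of the potential is inherited by the flow, in the form of the linear
bound `f_M(r) ≤ M r`. -/
lemma ProfilePotential.flowScore_ge (hW : ProfilePotential W M) {t : ℝ} (ht : 0 < t) (x y : E d) :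
    -(M * ‖x - y‖ ^ 2) ≤ ⟪x - y, flowScore (gibbs W) t x - flowScore (gibbs W) t y⟫ := by
  have := neZero_gibbs hW.contDiff.continuous
  obtain ⟨C, hC0, hC⟩ := hW.exists_flowScore_ge t
  have hgc : Continuous (gradient W) := by
    have h := hW.contDiff.continuous_fderiv one_ne_zero
    exact (InnerProductSpace.toDual ℝ (E d)).symm.continuous.comp h
  have h := flowScore_profile hW.gaussTame hW.M_pos hgc hW.profile hW.tendsto_flowScore hC0 hC
    ht le_rfl x y
  have h1 := fDefect_le_mul hW.M_pos (r := ‖x - y‖) (norm_nonneg _)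
  nlinarith [norm_nonneg (x - y)]

/-- One-sided Lipschitz bound of the tilted mean in the tilt vector: `flowScore_ge` at time `1 /
b`, solved for the mean. -/
lemma ProfilePotential.inner_tiltMean_sub_le (hW : ProfilePotential W M) {b : ℝ} (hb : 0 < b)
    (η η' : E d) :
    ⟪η - η', tiltMean (gibbs W) (fun y => y) (η, b) - tiltMean (gibbs W) (fun y => y) (η', b)⟫ ≤
      (b⁻¹ + M / b ^ 2) * ‖η - η'‖ ^ 2 := by
  have h := hW.flowScore_ge (inv_pos.2 hb) (b⁻¹ • η) (b⁻¹ • η')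
  simp only [flowScore, inv_inv, smul_smul, mul_inv_cancel₀ hb.ne', one_smul] at h
  rw [← smul_sub, ← smul_sub, norm_smul, Real.norm_of_nonneg (inv_pos.2 hb).le, mul_pow,
    real_inner_smul_left, real_inner_smul_right, sub_sub_sub_comm, ← smul_sub, inner_sub_right,
    real_inner_smul_right, real_inner_self_eq_norm_sq] at h
  set I := ⟪η - η', tiltMean (gibbs W) (fun y => y) (η, b) -
    tiltMean (gibbs W) (fun y => y) (η', b)⟫
  have h2 : b⁻¹ * (b * (b⁻¹ * ‖η - η'‖ ^ 2 - I)) = b⁻¹ * ‖η - η'‖ ^ 2 - I := by field_simp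
  rw [h2] at h
  have h3 : M / b ^ 2 = M * b⁻¹ ^ 2 := by field_simp
  rw [h3]
  linarith

end InitialLayer

/-! ### The noise schedule -/

section Schedule

variable {f g : ℝ → ℝ} {T : ℝ}

lemma aCoef_pos (f : ℝ → ℝ) (s : ℝ) : 0 < aCoef f s := Real.exp_pos _

lemma continuousOn_aCoef (hT : 0 ≤ T) (hf : IntegrableOn f (Ioc 0 T)) :
    ContinuousOn (aCoef f) (Icc 0 T) := by
  have h := intervalIntegral.continuousOn_primitive_interval (a := 0) (b := T) (f := f)
    (μ := volume)
    (by rw [uIcc_of_le hT]; exact (integrableOn_Icc_iff_integrableOn_Ioc).2 hf)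
  rw [uIcc_of_le hT] at h
  exact h.neg.rexp

lemma sigmaSq_eq (f g : ℝ → ℝ) (s : ℝ) :
    sigmaSq f g s = aCoef f s ^ 2 * ∫ u in (0 : ℝ)..s, (aCoef f u)⁻¹ ^ 2 * g u ^ 2 := by
  rw [sigmaSq, ← intervalIntegral.integral_const_mul]
  congr 1; ext u
  rw [div_eq_mul_inv]; ring

lemma integrableOn_sigmaSq (hT : 0 ≤ T) (hf : IntegrableOn f (Ioc 0 T))
    (hg : IntegrableOn (fun s => g s ^ 2) (Ioc 0 T)) :
    IntegrableOn (fun u => (aCoef f u)⁻¹ ^ 2 * g u ^ 2) (Icc 0 T) := by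
  refine IntegrableOn.continuousOn_mul ?_ ((integrableOn_Icc_iff_integrableOn_Ioc).2 hg)
    isCompact_Icc
  exact ((continuousOn_aCoef hT hf).inv₀ fun u _ => (aCoef_pos f u).ne').pow 2

lemma continuousOn_sigmaSq (hT : 0 ≤ T) (hf : IntegrableOn f (Ioc 0 T))
    (hg : IntegrableOn (fun s => g s ^ 2) (Ioc 0 T)) : ContinuousOn (sigmaSq f g) (Icc 0 T) := by
  have h := intervalIntegral.continuousOn_primitive_interval (a := 0) (b := T) (μ := volume)
    (f := fun u => (aCoef f u)⁻¹ ^ 2 * g u ^ 2)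
    (by rw [uIcc_of_le hT]; exact integrableOn_sigmaSq hT hf hg)
  rw [uIcc_of_le hT] at h
  rw [show sigmaSq f g = _ from funext (sigmaSq_eq f g)]
  exact ((continuousOn_aCoef hT hf).pow 2).mul h

lemma sigmaSq_pos (hf : IntegrableOn f (Ioc 0 T))
    (hg : IntegrableOn (fun s => g s ^ 2) (Ioc 0 T)) (hg_pos : ∀ s ∈ Ioc 0 T, 0 < g s) {s : ℝ}
    (hs : s ∈ Ioc 0 T) : 0 < sigmaSq f g s := by
  rw [sigmaSq_eq]
  refine mul_pos (pow_pos (aCoef_pos f s) 2) ?_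
  refine intervalIntegral.intervalIntegral_pos_of_pos_on ?_ (fun u hu => ?_) hs.1
  · rw [intervalIntegrable_iff_integrableOn_Icc_of_le hs.1.le]
    exact (integrableOn_sigmaSq (hs.1.le.trans hs.2) hf hg).mono_set (Icc_subset_Icc_right hs.2)
  · have := hg_pos u ⟨hu.1, hu.2.le.trans hs.2⟩
    have := aCoef_pos f u
    positivity

end Schedule

/-! ### Monotonicity of the exact score -/

section Score

variable {d : ℕ} {f g : ℝ → ℝ} {T : ℝ} {V₀ : E d → ℝ} {α M : ℝ}

/-- The data potential with its quadratic part `α ‖x‖² / 2` removed. -/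
def residualPotential (V₀ : E d → ℝ) (α : ℝ) (x : E d) : ℝ := V₀ x - α * ‖x‖ ^ 2 / 2

lemma hasGradientAt_residualPotential (hV₀ : ContDiff ℝ 1 V₀) (x : E d) :
    HasGradientAt (residualPotential V₀ α) (gradient V₀ x - α • x) x := by
  rw [hasGradientAt_iff_hasFDerivAt]
  have h1 : HasFDerivAt V₀ (fderiv ℝ V₀ x) x := (hV₀.differentiable one_ne_zero x).hasFDerivAt
  have h2 : HasFDerivAt (fun y : E d => ‖y‖ ^ 2) (2 • innerSL ℝ x) x :=
    (hasStrictFDerivAt_norm_sq x).hasFDerivAt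
  have h3 := h1.sub ((h2.const_mul α).mul_const (2 : ℝ)⁻¹)
  have h4 : residualPotential V₀ α = V₀ - fun y => α * ‖y‖ ^ 2 * 2⁻¹ := by
    ext y; simp [residualPotential, div_eq_mul_inv]
  rw [h4]
  refine h3.congr_fderiv ?_
  ext v
  simp [gradient]
  ring

/-- Removing `α ‖x‖² / 2` turns weak log-concavity into the profile `-f_M`. -/
lemma WeakLogConcave.profilePotential (hw : WeakLogConcave V₀ α M) (hV₀ : ContDiff ℝ 1 V₀) :
    ProfilePotential (residualPotential V₀ α) M where
  contDiff := by
    unfold residualPotential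
    exact hV₀.sub ((contDiff_const.mul (contDiff_norm_sq ℝ)).div_const 2)
  M_pos := hw.M_pos
  profile x y := by
    rcases eq_or_ne x y with rfl | hxy
    · simp
    have hr : 0 < ‖x - y‖ := norm_pos_iff.2 (sub_ne_zero.2 hxy)
    have h := hw.profile _ hr x y rfl
    rw [le_div_iff₀ (by positivity)] at h
    rw [(hasGradientAt_residualPotential hV₀ x).gradient,
      (hasGradientAt_residualPotential hV₀ y).gradient]
    have e : gradient V₀ x - α • x - (gradient V₀ y - α • y) =
        (gradient V₀ x - gradient V₀ y) - α • (x - y) := by module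
    rw [e, inner_sub_right, real_inner_smul_right, real_inner_self_eq_norm_sq, real_inner_comm]
    have e2 : (α - 1 / ‖x - y‖ * fDefect M ‖x - y‖) * ‖x - y‖ ^ 2 =
        α * ‖x - y‖ ^ 2 - ‖x - y‖ * fDefect M ‖x - y‖ := by field_simp
    linarith

/-- The tilt parameters `(a x / σ², a² / σ² + α)` at which the posterior of `x` under `p_s` is a
tilt of the residual Gibbs measure. -/
def scoreTilt (f g : ℝ → ℝ) (α s : ℝ) (x : E d) : E d × ℝ :=
  ((aCoef f s / sigmaSq f g s) • x, aCoef f s ^ 2 / sigmaSq f g s + α)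

/-- The density of `p_s` is, up to a constant, `e^{-‖x‖² / (2 σ²)}` times the normalising constant
of a tilt of the residual Gibbs measure: complete the squares in `e^{-V₀(y)} e^{-‖x - a y‖² / (2
σ²)}`. -/
lemma forwardDensity_eq (hV₀ : ContDiff ℝ 1 V₀) (α s : ℝ) (hσ : 0 < sigmaSq f g s) (x : E d) :
    forwardDensity f g V₀ s x =
      ((2 * Real.pi * sigmaSq f g s) ^ (-(d : ℝ) / 2) / ∫ y, Real.exp (-V₀ y)) *
        (Real.exp (-‖x‖ ^ 2 / (2 * sigmaSq f g s)) *
          tiltInt (gibbs (residualPotential V₀ α)) (fun _ => (1 : ℝ)) (scoreTilt f g α s x)) := by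
  have hc : Continuous (residualPotential V₀ α) := by
    have := hV₀.continuous
    unfold residualPotential; fun_prop
  rw [forwardDensity, dataLaw, integral_tilted, tiltInt, integral_gibbs hc, ← integral_const_mul,
    ← integral_const_mul]
  refine integral_congr_ae (ae_of_all _ fun y => ?_)
  simp only [smul_eq_mul, mul_one, gaussianDensity]
  set v := sigmaSq f g s
  have : Real.exp (-V₀ y) * Real.exp (-‖x - aCoef f s • y‖ ^ 2 / (2 * v)) =
      Real.exp (-‖x‖ ^ 2 / (2 * v)) * (Real.exp (-residualPotential V₀ α y) *
        Real.exp (tiltForm y (scoreTilt f g α s x))) := by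
    rw [← Real.exp_add, ← Real.exp_add, ← Real.exp_add, tiltForm_apply]
    congr 1
    simp only [scoreTilt, residualPotential]
    rw [norm_sub_sq_real, real_inner_smul_left, real_inner_smul_right, norm_smul, mul_pow,
      Real.norm_eq_abs, sq_abs]
    simp only [show sigmaSq f g s = v from rfl]
    field_simp
    ring
  rw [div_mul_eq_mul_div, div_mul_eq_mul_div, ← this]
  ring

/-- Tweedie's formula: the score is affine in the posterior mean. -/
lemma score_eq (hw : WeakLogConcave V₀ α M) (hV₀ : ContDiff ℝ 1 V₀)
    (hV₀_int : Integrable (fun x => Real.exp (-V₀ x))) {s : ℝ} (hs : 0 < s)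
    (hσ : 0 < sigmaSq f g s) (x : E d) :
    score f g V₀ s x = -(sigmaSq f g s)⁻¹ • x + (aCoef f s / sigmaSq f g s) •
      tiltMean (gibbs (residualPotential V₀ α)) (fun y => y) (scoreTilt f g α s x) := by
  have hW := hw.profilePotential hV₀
  have hν := hW.gaussTame
  have := neZero_gibbs hW.contDiff.continuous
  set ν := gibbs (residualPotential V₀ α) with hνd
  have hZ : 0 < ∫ y, Real.exp (-V₀ y) := integral_exp_pos hV₀_int
  set v := sigmaSq f g s with hv
  set a := aCoef f s with ha
  set K := ((2 * Real.pi * v) ^ (-(d : ℝ) / 2) / ∫ y, Real.exp (-V₀ y)) with hK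
  have hK0 : 0 < K := by have := Real.pi_pos; positivity
  have hp : ∀ z : E d, 0 < (scoreTilt f g α s z).2 := fun z => by
    have := hw.alpha_pos; have := aCoef_pos f s
    simp only [scoreTilt]; positivity
  have hlog : (fun z => Real.log (forwardDensity f g V₀ s z)) = fun z : E d =>
      Real.log K + (-‖z‖ ^ 2 / (2 * v) +
        Real.log (tiltInt ν (fun _ => (1 : ℝ)) (scoreTilt f g α s z))) := by
    ext z
    rw [forwardDensity_eq hV₀ α s hσ z, Real.log_mul hK0.ne'
      (mul_pos (Real.exp_pos _) (hν.tiltInt_one_pos (hp z))).ne',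
      Real.log_mul (Real.exp_pos _).ne' (hν.tiltInt_one_pos (hp z)).ne', Real.log_exp]
  rw [score, if_neg hs.ne', hlog]
  have hdiff : DifferentiableAt ℝ (fun z : E d =>
      Real.log K + (-‖z‖ ^ 2 / (2 * v) +
        Real.log (tiltInt ν (fun _ => (1 : ℝ)) (scoreTilt f g α s z)))) x := by
    have h1 : DifferentiableAt ℝ (fun z : E d => -‖z‖ ^ 2 / (2 * v)) x :=
      by
        have h0 : DifferentiableAt ℝ (fun z : E d => ‖z‖ ^ 2) x :=
          (hasStrictFDerivAt_norm_sq x).hasFDerivAt.differentiableAt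
        simpa only [div_eq_mul_inv] using h0.fun_neg.mul_const (2 * v)⁻¹
    have h2 : DifferentiableAt ℝ (scoreTilt (d := d) f g α s) x := by
      unfold scoreTilt
      fun_prop
    have h3 := ((hasFDerivAt_tiltInt hν (expGrowth_const (1 : ℝ)) (hp x)).differentiableAt.comp x
      h2).log (hν.tiltInt_one_pos (hp x)).ne'
    exact (h1.add h3).const_add _
  refine ext_inner_right ℝ fun w => ?_
  have hline : HasDerivAt (fun r : ℝ => x + r • w) w 0 := by
    simpa using ((hasDerivAt_id (0 : ℝ)).smul_const w).const_add x
  have hd1 : HasDerivAt (fun r : ℝ => Real.log K + (-‖x + r • w‖ ^ 2 / (2 * v) +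
        Real.log (tiltInt ν (fun _ => (1 : ℝ)) (scoreTilt f g α s (x + r • w)))))
      (⟪gradient (fun z : E d => Real.log K + (-‖z‖ ^ 2 / (2 * v) +
        Real.log (tiltInt ν (fun _ => (1 : ℝ)) (scoreTilt f g α s z)))) x, w⟫) 0 := by
    have h := hdiff.hasFDerivAt
    rw [show x = x + (0 : ℝ) • w by simp] at h
    have h1 := h.comp_hasDerivAt (0 : ℝ) hline
    refine h1.congr_deriv ?_
    simp [gradient]
  have hd2 : HasDerivAt (fun r : ℝ => Real.log K + (-‖x + r • w‖ ^ 2 / (2 * v) +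
        Real.log (tiltInt ν (fun _ => (1 : ℝ)) (scoreTilt f g α s (x + r • w)))))
      (-(2 * ⟪x, w⟫) / (2 * v) + tiltInt ν (fun y => ⟪(a / v) • w, y⟫) (scoreTilt f g α s x) /
        tiltInt ν (fun _ => (1 : ℝ)) (scoreTilt f g α s x)) 0 := by
    have h1 : HasDerivAt (fun r : ℝ => -‖x + r • w‖ ^ 2 / (2 * v)) (-(2 * ⟪x, w⟫) / (2 * v)) 0 := by
      have := (hasDerivAt_norm_sq_line x w 0).neg.div_const (2 * v)
      simpa using this
    have h2 : HasDerivAt (fun r : ℝ => (a / v) • (x + r • w)) ((a / v) • w) 0 :=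
      hline.fun_const_smul _
    have h3 := hasDerivAt_tiltInt hν (expGrowth_const (1 : ℝ)) h2
      (hasDerivAt_const (0 : ℝ) (a ^ 2 / v + α)) (by simpa [scoreTilt] using hp x)
    have h4 := h3.log (hν.tiltInt_one_pos (by simpa [scoreTilt] using hp x)).ne'
    refine ((h1.add h4).const_add _).congr_deriv ?_
    simp [scoreTilt, ha, hv]
  rw [hd1.unique hd2, inner_add_left, real_inner_smul_left, real_inner_smul_left,
    real_inner_comm w, real_inner_comm w (tiltMean _ _ _)]
  rw [inner_tiltMean_id hν (hp x), tiltMean_eq, smul_eq_mul]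
  have e : tiltInt ν (fun y => ⟪(a / v) • w, y⟫) (scoreTilt f g α s x) =
      (a / v) * tiltInt ν (fun y => ⟪w, y⟫) (scoreTilt f g α s x) := by
    simp only [tiltInt, real_inner_smul_left, smul_eq_mul]
    rw [← integral_const_mul]
    congr 1; ext y; ring
  rw [e]
  have := (hν.tiltInt_one_pos (hp x)).ne'
  field_simp

/-- One-sided Lipschitz bound of the exact score with constant `M_s - α_s`: by `score_eq` it is the
bound `inner_tiltMean_sub_le` for the posterior mean, with precision `b = a² / σ² + α`. -/
theorem inner_score_sub_le (hw : WeakLogConcave V₀ α M) (hV₀ : ContDiff ℝ 1 V₀)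
    (hV₀_int : Integrable (fun x => Real.exp (-V₀ x))) {s : ℝ} (hs : 0 < s)
    (hσ : 0 < sigmaSq f g s) (x y : E d) :
    ⟪score f g V₀ s x - score f g V₀ s y, x - y⟫ ≤
      (MS f g α M s - alphaS f g α s) * ‖x - y‖ ^ 2 := by
  have hW := hw.profilePotential hV₀
  have ha := aCoef_pos f s
  have hα := hw.alpha_pos
  rw [score_eq hw hV₀ hV₀_int hs hσ, score_eq hw hV₀ hV₀_int hs hσ]
  have hb : 0 < aCoef f s ^ 2 / sigmaSq f g s + α := by positivity
  have h := hW.inner_tiltMean_sub_le hb ((aCoef f s / sigmaSq f g s) • x)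
    ((aCoef f s / sigmaSq f g s) • y)
  simp only [scoreTilt]
  set v := sigmaSq f g s
  set a := aCoef f s
  set mx := tiltMean (gibbs (residualPotential V₀ α)) (fun y => y) ((a / v) • x, a ^ 2 / v + α)
  set my := tiltMean (gibbs (residualPotential V₀ α)) (fun y => y) ((a / v) • y, a ^ 2 / v + α)
  rw [← smul_sub, norm_smul, Real.norm_of_nonneg (by positivity), real_inner_smul_left] at h
  have e : -v⁻¹ • x + (a / v) • mx - (-v⁻¹ • y + (a / v) • my) =
      -v⁻¹ • (x - y) + (a / v) • (mx - my) := by module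
  rw [e, inner_add_left, real_inner_smul_left, real_inner_smul_left, real_inner_self_eq_norm_sq,
    real_inner_comm]
  have e2 : ((a ^ 2 / v + α)⁻¹ + M / (a ^ 2 / v + α) ^ 2) * (a / v * ‖x - y‖) ^ 2 =
      (MS f g α M s - alphaS f g α s) * ‖x - y‖ ^ 2 + v⁻¹ * ‖x - y‖ ^ 2 := by
    simp only [MS, alphaS]
    have h0 : a ^ 2 + α * v ≠ 0 := by positivity
    have h1 : a ^ 2 / v + α = (a ^ 2 + α * v) / v := by field_simp
    change _ = (M * a ^ 2 / (a ^ 2 + α * v) ^ 2 - α / (a ^ 2 + α * v)) * _ + _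
    rw [h1]
    field_simp
    ring
  rw [e2] at h
  linarith

lemma continuousOn_score (hw : WeakLogConcave V₀ α M) (hV₀ : ContDiff ℝ 1 V₀)
    (hV₀_int : Integrable (fun x => Real.exp (-V₀ x))) (hT : 0 ≤ T)
    (hf : IntegrableOn f (Ioc 0 T)) (hg : IntegrableOn (fun s => g s ^ 2) (Ioc 0 T))
    (hg_pos : ∀ s ∈ Ioc 0 T, 0 < g s) :
    ContinuousOn (fun p : ℝ × E d => score f g V₀ p.1 p.2) (Ioc 0 T ×ˢ univ) := by
  have hW := hw.profilePotential hV₀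
  have hν := hW.gaussTame
  have := neZero_gibbs hW.contDiff.continuous
  have hσ := fun s hs => sigmaSq_pos hf hg hg_pos (s := s) hs
  have hmaps : MapsTo (fun p : ℝ × E d => p.1) (Ioc 0 T ×ˢ univ) (Icc 0 T) :=
    fun p hp => ⟨hp.1.1.le, hp.1.2⟩
  have ha : ContinuousOn (fun p : ℝ × E d => aCoef f p.1) (Ioc 0 T ×ˢ univ) :=
    (continuousOn_aCoef hT hf).comp continuousOn_fst hmaps
  have hs : ContinuousOn (fun p : ℝ × E d => sigmaSq f g p.1) (Ioc 0 T ×ˢ univ) :=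
    (continuousOn_sigmaSq hT hf hg).comp continuousOn_fst hmaps
  have hs0 : ∀ p ∈ Ioc 0 T ×ˢ (univ : Set (E d)), sigmaSq f g p.1 ≠ 0 :=
    fun p hp => (hσ _ hp.1).ne'
  have htilt : ContinuousOn (fun p : ℝ × E d => scoreTilt f g α p.1 p.2) (Ioc 0 T ×ˢ univ) := by
    unfold scoreTilt
    exact ((ha.div hs hs0).smul continuousOn_snd).prodMk
      (((ha.pow 2).div hs hs0).add continuousOn_const)
  have hmean : ContinuousOn (fun p : ℝ × E d =>
      tiltMean (gibbs (residualPotential V₀ α)) (fun y => y) (scoreTilt f g α p.1 p.2))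
      (Ioc 0 T ×ˢ univ) := fun p hp => by
    refine ContinuousAt.comp_continuousWithinAt (f := fun p : ℝ × E d => scoreTilt f g α p.1 p.2)
      (continuousAt_tiltMean hν expGrowth_id ?_) (htilt p hp)
    have := hσ _ hp.1; have := aCoef_pos f p.1; have := hw.alpha_pos
    simp only [scoreTilt]; positivity
  have h : ContinuousOn (fun p : ℝ × E d => -(sigmaSq f g p.1)⁻¹ • p.2 +
      (aCoef f p.1 / sigmaSq f g p.1) •
      tiltMean (gibbs (residualPotential V₀ α)) (fun y => y) (scoreTilt f g α p.1 p.2))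
      (Ioc 0 T ×ˢ univ) :=
    ((hs.inv₀ hs0).neg.smul continuousOn_snd).add ((ha.div hs hs0).smul hmean)
  exact h.congr fun p hp => score_eq hw hV₀ hV₀_int hp.1.1 (hσ _ hp.1) p.2

end Score

/-! ### Grönwall's inequality for absolutely continuous curves -/

section Gronwall

lemma absolutelyContinuousOnInterval_of_dist_le {X Y : Type*} [PseudoMetricSpace X]
    [PseudoMetricSpace Y] {F : ℝ → X} {G : ℝ → Y} {a b K : ℝ}
    (hG : AbsolutelyContinuousOnInterval G a b)
    (h : ∀ x ∈ uIcc a b, ∀ y ∈ uIcc a b, dist (F x) (F y) ≤ K * dist (G x) (G y)) :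
    AbsolutelyContinuousOnInterval F a b := by
  have hK : Tendsto (fun E : ℕ × (ℕ → ℝ × ℝ) =>
      K * ∑ i ∈ Finset.range E.1, dist (G (E.2 i).1) (G (E.2 i).2))
      (AbsolutelyContinuousOnInterval.totalLengthFilter ⊓
        𝓟 (AbsolutelyContinuousOnInterval.disjWithin a b)) (𝓝 0) := by
    have h0 := Filter.Tendsto.const_mul K hG
    rwa [mul_zero] at h0
  refine squeeze_zero' (Eventually.of_forall fun E => Finset.sum_nonneg fun i _ => dist_nonneg)
    ?_ hK
  filter_upwards [mem_inf_of_right (mem_principal_self _)] with E hE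
  rw [Finset.mul_sum]
  exact Finset.sum_le_sum fun i hi => h _ (hE.1 i hi).1 _ (hE.1 i hi).2

variable {d : ℕ}

lemma absolutelyContinuousOnInterval_integral {φ : ℝ → E d} {u v : ℝ}
    (hφ : IntervalIntegrable φ volume u v) :
    AbsolutelyContinuousOnInterval (fun t => ∫ r in u..t, φ r) u v := by
  refine absolutelyContinuousOnInterval_of_dist_le (K := 1)
    (hφ.norm.absolutelyContinuousOnInterval_intervalIntegral left_mem_uIcc) fun x hx y hy => ?_
  have hi : ∀ x ∈ uIcc u v, IntervalIntegrable φ volume u x := fun x hx =>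
    hφ.mono_set (uIcc_subset_uIcc left_mem_uIcc hx)
  rw [dist_eq_norm, Real.dist_eq, one_mul, intervalIntegral.integral_interval_sub_left (hi x hx)
    (hi y hy), intervalIntegral.integral_interval_sub_left (hi x hx).norm (hi y hy).norm]
  exact intervalIntegral.norm_integral_le_abs_integral_norm

lemma exp_sub_exp_le {K x y : ℝ} (hx : x ≤ K) (hy : y ≤ K) :
    |Real.exp x - Real.exp y| ≤ Real.exp K * |x - y| := by
  wlog h : y ≤ x generalizing x y
  · rw [abs_sub_comm, abs_sub_comm x]
    exact this hy hx (le_of_not_ge h)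
  rw [abs_of_nonneg (sub_nonneg.2 (Real.exp_le_exp.2 h)), abs_of_nonneg (sub_nonneg.2 h)]
  have h1 := Real.add_one_le_exp (y - x)
  have h2 : Real.exp y = Real.exp x * Real.exp (y - x) := by rw [← Real.exp_add]; congr 1; ring
  have h3 : Real.exp x ≤ Real.exp K := Real.exp_le_exp.2 hx
  have h4 := Real.exp_pos x
  have h5 : 0 ≤ x - y := sub_nonneg.2 h
  nlinarith

lemma absolutelyContinuousOnInterval_exp {G : ℝ → ℝ} {a b : ℝ}
    (hG : AbsolutelyContinuousOnInterval G a b) :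
    AbsolutelyContinuousOnInterval (fun t => Real.exp (G t)) a b := by
  obtain ⟨C, hC⟩ := hG.exists_bound
  refine absolutelyContinuousOnInterval_of_dist_le (K := Real.exp C) hG fun x hx y hy => ?_
  exact exp_sub_exp_le ((le_abs_self _).trans (hC x hx)) ((le_abs_self _).trans (hC y hy))

lemma sqrt_norm_sq_add_sub_le (δ : ℝ) (x y : E d) :
    |√(‖x‖ ^ 2 + δ ^ 2) - √(‖y‖ ^ 2 + δ ^ 2)| ≤ ‖x - y‖ := by
  have key : ∀ x y : E d, √(‖x‖ ^ 2 + δ ^ 2) ≤ √(‖y‖ ^ 2 + δ ^ 2) + ‖x - y‖ := by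
    intro x y
    have hs : 0 ≤ √(‖y‖ ^ 2 + δ ^ 2) := Real.sqrt_nonneg _
    have h0 := norm_nonneg (x - y)
    rw [Real.sqrt_le_left (by positivity), add_sq, Real.sq_sqrt (by positivity)]
    have h1 : ‖y‖ ≤ √(‖y‖ ^ 2 + δ ^ 2) := Real.le_sqrt_of_sq_le (by nlinarith [sq_nonneg δ])
    have h2 : ‖x‖ ≤ ‖y‖ + ‖x - y‖ := by
      have := norm_add_le y (x - y); rwa [add_sub_cancel] at this
    have h3 : ‖x‖ ^ 2 ≤ (‖y‖ + ‖x - y‖) ^ 2 := pow_le_pow_left₀ (norm_nonneg _) h2 2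
    nlinarith
  rw [abs_le]
  have h1 := key x y
  have h2 := key y x
  rw [norm_sub_rev y x] at h2
  constructor <;> linarith

/-- Grönwall's inequality for an absolutely continuous curve with a one-sided bound on its
derivative. The norm is regularised as `√(‖·‖² + δ²)` so that it can be differentiated. -/
theorem norm_le_of_inner_deriv_le {u v : ℝ} (huv : u ≤ v) {D φ : ℝ → E d} {β c : ℝ → ℝ}
    (hφ : IntervalIntegrable φ volume u v) (hβ : IntervalIntegrable β volume u v)
    (hc : IntervalIntegrable c volume u v)
    (hD : ∀ t ∈ Icc u v, D t = D u + ∫ r in u..t, φ r)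
    (h : ∀ᵐ r, r ∈ Ioc u v → ⟪φ r, D r⟫ ≤ β r * ‖D r‖ ^ 2 + c r * ‖D r‖)
    (hc0 : ∀ᵐ r, r ∈ Ioc u v → 0 ≤ c r) :
    ‖D v‖ ≤ Real.exp (∫ r in u..v, β r) * ‖D u‖ +
      ∫ r in u..v, Real.exp (∫ s in r..v, β s) * c r := by
  set Λ : ℝ → ℝ := fun t => ∫ r in u..t, β r with hΛ
  have hΛac : AbsolutelyContinuousOnInterval Λ u v :=
    hβ.absolutelyContinuousOnInterval_intervalIntegral left_mem_uIcc
  set e : ℝ → ℝ := fun t => Real.exp (-Λ t) with he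
  have heac : AbsolutelyContinuousOnInterval e u v := absolutelyContinuousOnInterval_exp hΛac.neg
  set D' : ℝ → E d := fun t => D u + ∫ r in u..t, φ r with hD'
  have hD'ac : AbsolutelyContinuousOnInterval D' u v :=
    absolutelyContinuousOnInterval_of_dist_le (K := 1) (absolutelyContinuousOnInterval_integral hφ)
      fun x _ y _ => by simp [hD']
  -- the weight `e = exp (-∫ β)` removes the quadratic term of the bound; `D'` equals `D` on `[u, v]`
  -- and is a primitive on the whole line
  set w : ℝ → E d := fun t => e t • D' t with hw
  have hwac : AbsolutelyContinuousOnInterval w u v := heac.smul hD'ac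
  have hei : IntervalIntegrable (fun r => e r * c r) volume u v :=
    hc.continuousOn_mul heac.continuousOn
  have hreg : ∀ δ : ℝ, 0 < δ → ‖w v‖ ≤ ‖w u‖ + δ + ∫ r in u..v, e r * c r := by
    intro δ hδ
    set ρ : ℝ → ℝ := fun t => √(‖w t‖ ^ 2 + δ ^ 2) with hρ
    have hρac : AbsolutelyContinuousOnInterval ρ u v :=
      absolutelyContinuousOnInterval_of_dist_le (K := 1) hwac fun x _ y _ => by
        rw [one_mul, Real.dist_eq, dist_eq_norm]
        exact sqrt_norm_sq_add_sub_le δ _ _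
    have hder : ∀ᵐ r, r ∈ Ioc u v → deriv ρ r ≤ e r * c r := by
      filter_upwards [hφ.ae_hasDerivAt_integral, hβ.ae_hasDerivAt_integral, h, hc0]
        with r hr1 hr2 hr3 hr4 hr
      have hrm : r ∈ uIcc u v := by rw [uIcc_of_le huv]; exact ⟨hr.1.le, hr.2⟩
      have d1 : HasDerivAt D' (φ r) r := (hr1 hrm u left_mem_uIcc).const_add _
      have d2 : HasDerivAt Λ (β r) r := hr2 hrm u left_mem_uIcc
      have d3 : HasDerivAt e (e r * -β r) r := d2.neg.exp
      have d4 : HasDerivAt w (e r • φ r + (e r * -β r) • D' r) r := d3.smul d1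
      have hpos : 0 < ‖w r‖ ^ 2 + δ ^ 2 := by positivity
      have d5 := (d4.norm_sq.add_const (δ ^ 2)).sqrt hpos.ne'
      have hDr : D' r = D r := (hD r ⟨hr.1.le, hr.2⟩).symm
      rw [show deriv ρ r = _ from d5.deriv]
      have hs : 0 < √(‖w r‖ ^ 2 + δ ^ 2) := Real.sqrt_pos.2 hpos
      rw [div_le_iff₀ (by positivity)]
      have hws : ‖w r‖ ≤ √(‖w r‖ ^ 2 + δ ^ 2) :=
        Real.le_sqrt_of_sq_le (by nlinarith [sq_nonneg δ])
      have her : 0 < e r := Real.exp_pos _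
      have hwr : ‖w r‖ = e r * ‖D r‖ := by
        simp only [hw, hDr]; rw [norm_smul, Real.norm_of_nonneg her.le]
      have hin : ⟪w r, e r • φ r + (e r * -β r) • D' r⟫ ≤ e r * c r * ‖w r‖ := by
        rw [hDr, hwr]
        simp only [hw, hDr]
        rw [inner_add_right, real_inner_smul_left, real_inner_smul_left, real_inner_smul_right,
          real_inner_smul_right, real_inner_self_eq_norm_sq, real_inner_comm]
        have := mul_le_mul_of_nonneg_left (hr3 hr) (mul_pos her her).le
        nlinarith
      have := mul_le_mul_of_nonneg_left hws (mul_nonneg her.le (hr4 hr))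
      linarith
    have hint := hρac.integral_deriv_eq_sub
    have hle : ∫ r in u..v, deriv ρ r ≤ ∫ r in u..v, e r * c r := by
      refine intervalIntegral.integral_mono_ae_restrict huv hρac.intervalIntegrable_deriv hei ?_
      rw [EventuallyLE, ← restrict_Ioc_eq_restrict_Icc, ae_restrict_iff' measurableSet_Ioc]
      exact hder
    have h1 : ‖w v‖ ≤ ρ v := Real.le_sqrt_of_sq_le (by nlinarith [sq_nonneg δ])
    have h2 : ρ u ≤ ‖w u‖ + δ := by
      have h0 := norm_nonneg (w u)
      rw [hρ]
      simp only
      rw [Real.sqrt_le_left (by positivity)]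
      nlinarith
    linarith
  have hlim : ‖w v‖ ≤ ‖w u‖ + ∫ r in u..v, e r * c r := by
    refine le_of_forall_pos_le_add fun δ hδ => ?_
    have := hreg δ hδ
    linarith
  have hwu : ‖w u‖ = ‖D u‖ := by simp [hw, hD', he, hΛ]
  have hwv : ‖w v‖ = e v * ‖D v‖ := by
    simp only [hw, hD', ← hD v (right_mem_Icc.2 huv)]
    rw [norm_smul, Real.norm_of_nonneg (Real.exp_pos _).le]
  rw [hwu, hwv] at hlim
  have h1 := mul_le_mul_of_nonneg_left hlim (Real.exp_pos (Λ v)).le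
  rw [← mul_assoc, he] at h1
  simp only at h1
  rw [← Real.exp_add, add_neg_cancel, Real.exp_zero, one_mul, mul_add,
    ← intervalIntegral.integral_const_mul] at h1
  refine h1.trans_eq ?_
  congr 1
  refine intervalIntegral.integral_congr fun r hr => ?_
  rw [← mul_assoc, ← Real.exp_add]
  congr 2
  have i1 : IntervalIntegrable β volume u r := hβ.mono_set (uIcc_subset_uIcc left_mem_uIcc hr)
  have i2 : IntervalIntegrable β volume r v := hβ.mono_set (uIcc_subset_uIcc hr right_mem_uIcc)
  have := intervalIntegral.integral_add_adjacent_intervals i1 i2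
  simp only [hΛ]
  linarith

end Gronwall

/-! ### Square-mean norms -/

section LTwo

lemma eLpNorm_two_eq {α F : Type*} [MeasurableSpace α] [NormedAddCommGroup F] (f : α → F)
    (μ : Measure α) : eLpNorm f 2 μ = (∫⁻ x, ‖f x‖ₑ ^ 2 ∂μ) ^ (1 / 2 : ℝ) := by
  rw [eLpNorm_eq_lintegral_rpow_enorm_toReal two_ne_zero ENNReal.ofNat_ne_top]
  simp

lemma eLpNorm_two_sq {α F : Type*} [MeasurableSpace α] [NormedAddCommGroup F] (f : α → F)
    (μ : Measure α) : eLpNorm f 2 μ ^ 2 = ∫⁻ x, ‖f x‖ₑ ^ 2 ∂μ := by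
  rw [eLpNorm_two_eq, ← ENNReal.rpow_natCast, ← ENNReal.rpow_mul]
  norm_num

end LTwo

/-! ### Wiener integrals -/

section Wiener

variable {d : ℕ} {Ω : Type*} {mΩ : MeasurableSpace Ω} {F : Filtration ℝ mΩ}
  {B : ℝ → Ω → E d} {P : Measure Ω}

lemma IsBrownianMotion.measurable (hB : IsBrownianMotion F B P) {t : ℝ} (ht : 0 ≤ t) :
    Measurable (B t) :=
  (hB.adapted t ht).mono (F.le t) le_rfl

lemma IsBrownianMotion.integrable_norm_sq_sub (hB : IsBrownianMotion F B P) {s t : ℝ}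
    (hs : 0 ≤ s) (ht : 0 ≤ t) :
    Integrable (fun ω => ‖B t ω - B s ω‖ ^ 2) P ∧
      ∫ ω, ‖B t ω - B s ω‖ ^ 2 ∂P = |t - s| * ∫ x, ‖x‖ ^ 2 ∂(stdGaussian (E d)) := by
  wlog hst : s ≤ t generalizing s t
  · have := this ht hs (le_of_not_ge hst)
    simpa [norm_sub_rev (B t _), abs_sub_comm t] using this
  have hm : Measurable fun ω => B t ω - B s ω := (hB.measurable ht).sub (hB.measurable hs)
  have hl := hB.law s t hs hst
  have hsm : Measurable fun x : E d => Real.sqrt (t - s) • x := by fun_prop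
  have hG : Integrable (fun x : E d => ‖x‖ ^ 2) (stdGaussian (E d)) :=
    (IsGaussian.memLp_two_id (μ := stdGaussian (E d))).integrable_norm_pow two_ne_zero
  have e : (fun x : E d => ‖Real.sqrt (t - s) • x‖ ^ 2) = fun x => (t - s) * ‖x‖ ^ 2 := by
    ext x
    rw [norm_smul, mul_pow, Real.norm_eq_abs, sq_abs, Real.sq_sqrt (sub_nonneg.2 hst)]
  constructor
  · have h1 : Integrable (fun x : E d => ‖x‖ ^ 2) (P.map fun ω => B t ω - B s ω) := by
      rw [hl, integrable_map_measure (by fun_prop) hsm.aemeasurable]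
      simp only [Function.comp_def, e]
      exact hG.const_mul _
    exact (integrable_map_measure (by fun_prop) hm.aemeasurable).1 h1
  · rw [← integral_map (φ := fun ω => B t ω - B s ω) (f := fun x : E d => ‖x‖ ^ 2) hm.aemeasurable
      (by fun_prop), hl, integral_map hsm.aemeasurable (by fun_prop), e, integral_const_mul,
      abs_of_nonneg (sub_nonneg.2 hst)]

/-- Polarisation: the inner product of two increments through four squared distances. -/
lemma inner_sub_sub_eq_norm_sq (a b c e : E d) : ⟪b - a, e - c⟫ =
    (‖b - c‖ ^ 2 + ‖a - e‖ ^ 2 - ‖b - e‖ ^ 2 - ‖a - c‖ ^ 2) / 2 := by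
  simp only [norm_sub_sq_real, inner_sub_left, inner_sub_right]
  ring

lemma integral_indicator_mul_indicator {p q p' q' : ℝ} (h : p ≤ q) (h' : p' ≤ q') :
    Integrable (fun r => (Ioc p q).indicator (fun _ => (1 : ℝ)) r *
        (Ioc p' q').indicator (fun _ => (1 : ℝ)) r) ∧
    ∫ r, (Ioc p q).indicator (fun _ => (1 : ℝ)) r * (Ioc p' q').indicator (fun _ => (1 : ℝ)) r =
      (|q - p'| + |p - q'| - |q - q'| - |p - p'|) / 2 := by
  have e : (fun r => (Ioc p q).indicator (fun _ => (1 : ℝ)) r *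
      (Ioc p' q').indicator (fun _ => (1 : ℝ)) r) =
      (Ioc (max p p') (min q q')).indicator fun _ => (1 : ℝ) := by
    rw [show max p p' = p ⊔ p' from rfl, show min q q' = q ⊓ q' from rfl, ← Ioc_inter_Ioc]
    ext r
    simp only [indicator, mem_inter_iff]
    split_ifs <;> simp_all
  rw [e]
  constructor
  · exact (integrable_indicator_iff measurableSet_Ioc).2 (integrableOn_const (by simp))
  · rw [integral_indicator measurableSet_Ioc]
    simp only [integral_const, smul_eq_mul, mul_one, measureReal_restrict_apply_univ,
      Real.volume_real_Ioc]
    simp only [abs_eq_max_neg, max_def, min_def]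
    split_ifs <;> linarith

/-- The Itô isometry for step functions, proved by polarisation from the variances of the
increments. -/
lemma IsBrownianMotion.integral_norm_sq_step (hB : IsBrownianMotion F B P) {ι : Type*} [Fintype ι]
    {c p q : ι → ℝ} (hp : ∀ i, 0 ≤ p i) (hpq : ∀ i, p i ≤ q i) :
    Integrable (fun ω => ‖∑ i, c i • (B (q i) ω - B (p i) ω)‖ ^ 2) P ∧
    Integrable (fun r => (∑ i, c i * (Ioc (p i) (q i)).indicator (fun _ => (1 : ℝ)) r) ^ 2) ∧
    ∫ ω, ‖∑ i, c i • (B (q i) ω - B (p i) ω)‖ ^ 2 ∂P =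
      (∫ x, ‖x‖ ^ 2 ∂(stdGaussian (E d))) *
        ∫ r, (∑ i, c i * (Ioc (p i) (q i)).indicator (fun _ => (1 : ℝ)) r) ^ 2 := by
  have hq : ∀ i, 0 ≤ q i := fun i => (hp i).trans (hpq i)
  set κ := ∫ x, ‖x‖ ^ 2 ∂(stdGaussian (E d)) with hκ
  have hin : ∀ i j, Integrable (fun ω => ⟪B (q i) ω - B (p i) ω, B (q j) ω - B (p j) ω⟫) P ∧
      ∫ ω, ⟪B (q i) ω - B (p i) ω, B (q j) ω - B (p j) ω⟫ ∂P =
      κ * ((|q i - p j| + |p i - q j| - |q i - q j| - |p i - p j|) / 2) := by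
    intro i j
    simp only [inner_sub_sub_eq_norm_sq]
    have h1 := hB.integrable_norm_sq_sub (hp j) (hq i)
    have h2 := hB.integrable_norm_sq_sub (hq j) (hp i)
    have h3 := hB.integrable_norm_sq_sub (hq j) (hq i)
    have h4 := hB.integrable_norm_sq_sub (hp j) (hp i)
    have i12 := h1.1.add h2.1
    have i123 := i12.sub h3.1
    refine ⟨(i123.sub h4.1).div_const 2, ?_⟩
    have e1 := integral_sub i123 h4.1
    have e2 := integral_sub i12 h3.1
    have e3 := integral_add h1.1 h2.1
    simp only [Pi.add_apply, Pi.sub_apply] at e1 e2 e3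
    rw [integral_div, e1, e2, e3, h1.2, h2.2, h3.2, h4.2]
    ring
  have hind := fun i j => integral_indicator_mul_indicator (hpq i) (hpq j)
  have e1 : ∀ ω, ‖∑ i, c i • (B (q i) ω - B (p i) ω)‖ ^ 2 =
      ∑ i, ∑ j, c i * c j * ⟪B (q i) ω - B (p i) ω, B (q j) ω - B (p j) ω⟫ := by
    intro ω
    rw [← real_inner_self_eq_norm_sq, sum_inner]
    refine Finset.sum_congr rfl fun i _ => ?_
    rw [inner_sum]
    refine Finset.sum_congr rfl fun j _ => ?_
    rw [real_inner_smul_left, real_inner_smul_right]; ring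
  have e2 : ∀ r, (∑ i, c i * (Ioc (p i) (q i)).indicator (fun _ => (1 : ℝ)) r) ^ 2 =
      ∑ i, ∑ j, c i * c j * ((Ioc (p i) (q i)).indicator (fun _ => (1 : ℝ)) r *
        (Ioc (p j) (q j)).indicator (fun _ => (1 : ℝ)) r) := by
    intro r
    rw [sq, Finset.sum_mul_sum]
    refine Finset.sum_congr rfl fun i _ => Finset.sum_congr rfl fun j _ => by ring
  simp only [e1, e2]
  refine ⟨integrable_finsetSum _ fun i _ => integrable_finsetSum _ fun j _ =>
    (hin i j).1.const_mul _, integrable_finsetSum _ fun i _ => integrable_finsetSum _ fun j _ =>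
    (hind i j).1.const_mul _, ?_⟩
  rw [integral_finsetSum _ fun i _ => integrable_finsetSum _ fun j _ => (hin i j).1.const_mul _,
    integral_finsetSum _ fun i _ => integrable_finsetSum _ fun j _ => (hind i j).1.const_mul _,
    Finset.mul_sum]
  refine Finset.sum_congr rfl fun i _ => ?_
  rw [integral_finsetSum _ fun j _ => (hin i j).1.const_mul _,
    integral_finsetSum _ fun j _ => (hind i j).1.const_mul _, Finset.mul_sum]
  refine Finset.sum_congr rfl fun j _ => ?_
  rw [integral_const_mul, integral_const_mul, (hin i j).2, (hind i j).2]
  ring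

lemma IsBrownianMotion.lintegral_step (hB : IsBrownianMotion F B P) {ι : Type*} [Fintype ι]
    {c p q : ι → ℝ} {t : ℝ} (hp : ∀ i, 0 ≤ p i) (hpq : ∀ i, p i ≤ q i) (hqt : ∀ i, q i ≤ t) :
    ∫⁻ ω, ‖∑ i, c i • (B (q i) ω - B (p i) ω)‖ₑ ^ 2 ∂P =
      ENNReal.ofReal (∫ x, ‖x‖ ^ 2 ∂(stdGaussian (E d))) *
        ∫⁻ r in Ioc 0 t,
          ‖∑ i, c i * (Ioc (p i) (q i)).indicator (fun _ => (1 : ℝ)) r‖ₑ ^ 2 := by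
  obtain ⟨h1, h2, h3⟩ := hB.integral_norm_sq_step (c := c) hp hpq
  have e1 : ∀ ω, ‖∑ i, c i • (B (q i) ω - B (p i) ω)‖ₑ ^ 2 =
      ENNReal.ofReal (‖∑ i, c i • (B (q i) ω - B (p i) ω)‖ ^ 2) := fun ω => by
    rw [ENNReal.ofReal_pow (norm_nonneg _), ofReal_norm]
  have e2 : ∀ r, ‖∑ i, c i * (Ioc (p i) (q i)).indicator (fun _ => (1 : ℝ)) r‖ₑ ^ 2 =
      ENNReal.ofReal ((∑ i, c i * (Ioc (p i) (q i)).indicator (fun _ => (1 : ℝ)) r) ^ 2) :=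
    fun r => by rw [← sq_abs, ENNReal.ofReal_pow (abs_nonneg _), ← Real.norm_eq_abs, ofReal_norm]
  have hsupp : ∫⁻ r in Ioc 0 t,
      ‖∑ i, c i * (Ioc (p i) (q i)).indicator (fun _ => (1 : ℝ)) r‖ₑ ^ 2 =
      ∫⁻ r, ‖∑ i, c i * (Ioc (p i) (q i)).indicator (fun _ => (1 : ℝ)) r‖ₑ ^ 2 := by
    refine setLIntegral_eq_of_support_subset fun r hr => ?_
    by_contra hn
    refine hr ?_
    have : ∑ i, c i * (Ioc (p i) (q i)).indicator (fun _ => (1 : ℝ)) r = 0 := by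
      refine Finset.sum_eq_zero fun i _ => ?_
      rw [indicator_of_notMem, mul_zero]
      exact fun hri => hn ⟨(hp i).trans_lt hri.1, hri.2.trans (hqt i)⟩
    simp [this]
  rw [hsupp]
  simp only [e1, e2]
  rw [← ofReal_integral_eq_lintegral_ofReal h1 (ae_of_all _ fun _ => by positivity),
    ← ofReal_integral_eq_lintegral_ofReal h2 (ae_of_all _ fun _ => by positivity), h3,
    ENNReal.ofReal_mul (integral_nonneg fun _ => by positivity)]

lemma stepFn_eq_zero {n : ℕ} {c p q : Fin n → ℝ} {u v r : ℝ}
    (h : ∀ i, u ≤ p i ∧ p i ≤ q i ∧ q i ≤ v) (hr : r ∉ Ioc u v) : stepFn c p q r = 0 := by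
  refine Finset.sum_eq_zero fun i _ => ?_
  rw [indicator_of_notMem, mul_zero]
  exact fun hri => hr ⟨(h i).1.trans_lt hri.1, hri.2.trans (h i).2.2⟩

lemma measurable_stepFn {n : ℕ} (c p q : Fin n → ℝ) : Measurable (stepFn c p q) := by
  unfold stepFn
  exact Finset.measurable_fun_sum _ fun i _ =>
    (measurable_const.indicator measurableSet_Ioc).const_mul _

/-- Wiener integrals are additive in the interval of integration. Approximate all three by step
functions; by the isometry the combination of the step integrals is small, because the step
functions nearly cancel in `L²(0, t)`. -/
theorem HasWienerIntegral.sub_ae_eq (hB : IsBrownianMotion F B P) {h : ℝ → ℝ} (hh : Measurable h)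
    {u t : ℝ} (hu : 0 ≤ u) (hut : u ≤ t) {N₁ N₂ N₃ : Ω → E d}
    (m₁ : AEStronglyMeasurable N₁ P) (m₂ : AEStronglyMeasurable N₂ P)
    (m₃ : AEStronglyMeasurable N₃ P)
    (h₁ : HasWienerIntegral h B P 0 t N₁) (h₂ : HasWienerIntegral h B P 0 u N₂)
    (h₃ : HasWienerIntegral h B P u t N₃) : ∀ᵐ ω ∂P, N₁ ω - N₂ ω = N₃ ω := by
  set κ := ENNReal.ofReal (∫ x, ‖x‖ ^ 2 ∂(stdGaussian (E d))) with hκ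
  have key : ∀ δ : ℝ≥0∞, 0 < δ → eLpNorm (fun ω => N₁ ω - N₂ ω - N₃ ω) 2 P ≤
      3 * δ ^ (1 / 2 : ℝ) + κ ^ (1 / 2 : ℝ) * (δ ^ (1 / 2 : ℝ) + (2 * δ) ^ (1 / 2 : ℝ)) := by
    intro δ hδ
    rcases eq_or_ne δ ⊤ with rfl | hδt
    · simp
    lift δ to ℝ≥0 using hδt
    obtain ⟨n₁, c₁, p₁, q₁, b₁, a₁, d₁⟩ := h₁ δ (by exact_mod_cast hδ)
    obtain ⟨n₂, c₂, p₂, q₂, b₂, a₂, d₂⟩ := h₂ δ (by exact_mod_cast hδ)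
    obtain ⟨n₃, c₃, p₃, q₃, b₃, a₃, d₃⟩ := h₃ δ (by exact_mod_cast hδ)
    have hms : ∀ {n : ℕ} {c p q : Fin n → ℝ} {u v : ℝ}, 0 ≤ u →
        (∀ i, u ≤ p i ∧ p i ≤ q i ∧ q i ≤ v) → Measurable (stepIntegral B c p q) := by
      intro n c p q u v hu hb
      unfold stepIntegral
      refine Finset.measurable_fun_sum _ fun i _ => Measurable.fun_const_smul ?_ _
      have h0 : 0 ≤ p i := hu.trans (hb i).1
      exact (hB.measurable (h0.trans (hb i).2.1)).sub (hB.measurable h0)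
    set S₁ := stepIntegral B c₁ p₁ q₁ with hS₁
    set S₂ := stepIntegral B c₂ p₂ q₂ with hS₂
    set S₃ := stepIntegral B c₃ p₃ q₃ with hS₃
    have s₁ : Measurable S₁ := hms le_rfl b₁
    have s₂ : Measurable S₂ := hms le_rfl b₂
    have s₃ : Measurable S₃ := hms hu b₃
    have hroot : ∀ {N S : Ω → E d}, ∫⁻ ω, ‖N ω - S ω‖ₑ ^ 2 ∂P < (δ : ℝ≥0∞) →
        eLpNorm (N - S) 2 P ≤ (δ : ℝ≥0∞) ^ (1 / 2 : ℝ) := by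
      intro N S h
      rw [eLpNorm_two_eq]
      exact ENNReal.rpow_le_rpow h.le (by norm_num)
    set st : ℝ → ℝ := fun r => stepFn c₁ p₁ q₁ r - stepFn c₂ p₂ q₂ r - stepFn c₃ p₃ q₃ r with hst
    have hstep : eLpNorm (S₁ - S₂ - S₃) 2 P =
        κ ^ (1 / 2 : ℝ) * eLpNorm st 2 (volume.restrict (Ioc 0 t)) := by
      have := hB.lintegral_step (ι := Fin n₁ ⊕ (Fin n₂ ⊕ Fin n₃))
        (c := Sum.elim c₁ (Sum.elim (-c₂) (-c₃))) (p := Sum.elim p₁ (Sum.elim p₂ p₃))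
        (q := Sum.elim q₁ (Sum.elim q₂ q₃)) (t := t)
        (by
          rintro (i | i | i)
          exacts [(b₁ i).1, (b₂ i).1, hu.trans (b₃ i).1])
        (by
          rintro (i | i | i)
          exacts [(b₁ i).2.1, (b₂ i).2.1, (b₃ i).2.1])
        (by
          rintro (i | i | i)
          exacts [(b₁ i).2.2, (b₂ i).2.2.trans hut, (b₃ i).2.2])
      rw [eLpNorm_two_eq, eLpNorm_two_eq, ← ENNReal.mul_rpow_of_nonneg _ _ (by norm_num)]
      congr 1
      simp only [Fintype.sum_sum_type, Sum.elim_inl, Sum.elim_inr, Pi.neg_apply, neg_smul,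
        neg_mul, Finset.sum_neg_distrib] at this
      rw [hκ, hst]
      convert this using 3
      · simp only [hS₁, hS₂, hS₃, stepIntegral, Pi.sub_apply]; congr 2; abel
      · ext r; simp only [stepFn]; congr 2; ring
    have hst2 : eLpNorm st 2 (volume.restrict (Ioc 0 t)) ≤
        (δ : ℝ≥0∞) ^ (1 / 2 : ℝ) + (2 * (δ : ℝ≥0∞)) ^ (1 / 2 : ℝ) := by
      have hsplit : st = (fun r => h r - stepFn c₂ p₂ q₂ r - stepFn c₃ p₃ q₃ r) -
          fun r => h r - stepFn c₁ p₁ q₁ r := by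
        ext r; simp only [hst, Pi.sub_apply]; ring
      have k₁ := measurable_stepFn c₁ p₁ q₁
      have k₂ := measurable_stepFn c₂ p₂ q₂
      have k₃ := measurable_stepFn c₃ p₃ q₃
      rw [hsplit, add_comm]
      refine (eLpNorm_sub_le (by fun_prop) (by fun_prop) (by norm_num)).trans (add_le_add ?_ ?_)
      · rw [eLpNorm_two_eq]
        refine ENNReal.rpow_le_rpow ?_ (by norm_num)
        rw [← Ioc_union_Ioc_eq_Ioc hu hut, lintegral_union measurableSet_Ioc
          (Ioc_disjoint_Ioc_of_le le_rfl), two_mul]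
        refine add_le_add (le_of_eq_of_le ?_ a₂.le) (le_of_eq_of_le ?_ a₃.le)
        · refine setLIntegral_congr_fun measurableSet_Ioc fun r hr => ?_
          rw [stepFn_eq_zero b₃ (fun h => absurd hr.2 (not_le.2 h.1)), sub_zero]
        · refine setLIntegral_congr_fun measurableSet_Ioc fun r hr => ?_
          rw [stepFn_eq_zero b₂ (fun h => absurd hr.1 (not_lt.2 h.2)), sub_zero]
      · rw [eLpNorm_two_eq]
        exact ENNReal.rpow_le_rpow a₁.le (by norm_num)
    have hdec : (fun ω => N₁ ω - N₂ ω - N₃ ω) =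
        ((N₁ - S₁) - (N₂ - S₂) - (N₃ - S₃)) + (S₁ - S₂ - S₃) := by
      ext1 ω; simp only [Pi.add_apply, Pi.sub_apply]; abel
    have v₁ := m₁.sub s₁.aestronglyMeasurable
    have v₂ := m₂.sub s₂.aestronglyMeasurable
    have v₃ := m₃.sub s₃.aestronglyMeasurable
    rw [hdec]
    refine (eLpNorm_add_le ((v₁.sub v₂).sub v₃)
      ((s₁.sub s₂).sub s₃).aestronglyMeasurable (by norm_num)).trans (add_le_add ?_ ?_)
    · refine (eLpNorm_sub_le (v₁.sub v₂) v₃ (by norm_num)).trans ?_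
      have h12 := (eLpNorm_sub_le (p := 2) v₁ v₂ (by norm_num)).trans
        (add_le_add (hroot d₁) (hroot d₂))
      refine (add_le_add h12 (hroot d₃)).trans (le_of_eq ?_)
      ring
    · rw [hstep]
      gcongr
  have hzero : eLpNorm (fun ω => N₁ ω - N₂ ω - N₃ ω) 2 P = 0 := by
    have hlim : Tendsto (fun δ : ℝ≥0∞ => 3 * δ ^ (1 / 2 : ℝ) + κ ^ (1 / 2 : ℝ) *
        (δ ^ (1 / 2 : ℝ) + (2 * δ) ^ (1 / 2 : ℝ))) (𝓝[>] 0) (𝓝 0) := by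
      have hκt : κ ^ (1 / 2 : ℝ) ≠ ⊤ :=
        ENNReal.rpow_ne_top_of_nonneg (by norm_num) ENNReal.ofReal_ne_top
      have r1 : Tendsto (fun δ : ℝ≥0∞ => δ ^ (1 / 2 : ℝ)) (𝓝 0) (𝓝 0) := by
        have := (ENNReal.continuous_rpow_const (y := 1 / 2)).tendsto 0
        simpa using this
      have r2 : Tendsto (fun δ : ℝ≥0∞ => (2 * δ) ^ (1 / 2 : ℝ)) (𝓝 0) (𝓝 0) := by
        have h0 : Tendsto (fun δ : ℝ≥0∞ => 2 * δ) (𝓝 0) (𝓝 0) := by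
          have := ENNReal.Tendsto.const_mul (a := (2 : ℝ≥0∞)) (tendsto_id (x := 𝓝 (0 : ℝ≥0∞)))
            (Or.inr (by norm_num))
          simpa using this
        exact r1.comp h0
      have h1 := ENNReal.Tendsto.const_mul (a := (3 : ℝ≥0∞)) r1 (Or.inr (by norm_num))
      have h2 := ENNReal.Tendsto.const_mul (a := κ ^ (1 / 2 : ℝ)) (r1.add r2) (Or.inr hκt)
      have := h1.add h2
      simp only [mul_zero, add_zero] at this
      exact this.mono_left nhdsWithin_le_nhds
    refine le_antisymm (ge_of_tendsto hlim ?_) zero_le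
    filter_upwards [self_mem_nhdsWithin] with δ hδ using key δ hδ
  have hz := (eLpNorm_eq_zero_iff ((m₁.sub m₂).sub m₃) two_ne_zero).1 hzero
  filter_upwards [hz] with ω hω
  exact sub_eq_zero.1 hω

end Wiener

/-! ### Independence of the past and the later noise -/

section Independence

variable {d : ℕ} {Ω : Type*} {mΩ : MeasurableSpace Ω} {P : Measure Ω}

/-- If `m₁` is independent of `m₃`, and `m₂` is independent of a σ-algebra `m'` containing both,
then `m₁ ⊔ m₂` is independent of `m₃`. -/
lemma indep_sup_of_indep [IsProbabilityMeasure P] {m₁ m₂ m₃ m' : MeasurableSpace Ω}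
    (h₁ : m₁ ≤ m') (h₃ : m₃ ≤ m')
    (hm' : m' ≤ mΩ) (h₂ : m₂ ≤ mΩ) (h₁₃ : Indep m₁ m₃ P) (h₂' : Indep m₂ m' P) :
    Indep (m₁ ⊔ m₂) m₃ P := by
  refine IndepSets.indep (p1 := image2 (· ∩ ·) {s | MeasurableSet[m₁] s} {s | MeasurableSet[m₂] s})
    (p2 := {s | MeasurableSet[m₃] s}) (sup_le (h₁.trans hm') h₂) (h₃.trans hm') ?_
    (@MeasurableSpace.isPiSystem_measurableSet Ω m₃) ?_
    (@MeasurableSpace.generateFrom_measurableSet Ω m₃).symm ?_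
  · rintro _ ⟨a, ha, b, hb, rfl⟩ _ ⟨a', ha', b', hb', rfl⟩ -
    exact ⟨a ∩ a', MeasurableSet.inter ha ha', b ∩ b', MeasurableSet.inter hb hb',
      inter_inter_inter_comm _ _ _ _⟩
  · refine le_antisymm (sup_le (fun s hs => ?_) fun s hs => ?_) (MeasurableSpace.generateFrom_le ?_)
    · exact MeasurableSpace.measurableSet_generateFrom ⟨s, hs, univ, MeasurableSet.univ, by simp⟩
    · exact MeasurableSpace.measurableSet_generateFrom ⟨univ, MeasurableSet.univ, s, hs, by simp⟩
    · rintro _ ⟨a, ha, b, hb, rfl⟩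
      exact @MeasurableSet.inter _ (m₁ ⊔ m₂) _ _ ((le_sup_left : m₁ ≤ m₁ ⊔ m₂) _ ha)
        ((le_sup_right : m₂ ≤ m₁ ⊔ m₂) _ hb)
  · rw [IndepSets_iff]
    rintro _ c ⟨a, ha, b, hb, rfl⟩ hc
    rw [Indep_iff] at h₁₃ h₂'
    have e1 : a ∩ b ∩ c = b ∩ (a ∩ c) := by ext; simp only [mem_inter_iff]; tauto
    have e2 : a ∩ b = b ∩ a := inter_comm _ _
    simp only
    rw [e1, e2, h₂' _ _ hb (@MeasurableSet.inter _ m' _ _ (h₁ _ ha) (h₃ _ hc)),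
      h₂' _ _ hb (h₁ _ ha), h₁₃ _ _ ha hc, mul_assoc]

/-- Null sets may be added to a σ-algebra without loss of independence. -/
lemma indep_sup_null {m m' : MeasurableSpace Ω} (h : Indep m m' P) :
    Indep (m ⊔ MeasurableSpace.generateFrom {A | MeasurableSet[mΩ] A ∧ P A = 0}) m' P := by
  rw [Indep_iff] at h ⊢
  have hle : m ⊔ MeasurableSpace.generateFrom {A | MeasurableSet[mΩ] A ∧ P A = 0} ≤
      eventuallyMeasurableSpace m (ae P) := by
    refine sup_le le_eventuallyMeasurableSpace (MeasurableSpace.generateFrom_le ?_)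
    rintro A ⟨-, hA⟩
    exact ⟨∅, @MeasurableSet.empty _ m, ae_eq_empty.2 hA⟩
  intro s t hs ht
  obtain ⟨s', hs', hss'⟩ := hle _ hs
  rw [measure_congr (hss'.inter (ae_eq_refl t)), measure_congr hss', h s' t hs' ht]

variable {F : Filtration ℝ mΩ} {B : ℝ → Ω → E d} [IsProbabilityMeasure P]

/-- Finitely many increments after time `u` are jointly independent of the past: add the times in
increasing order. The form `B (max u r)` admits all real `r`. -/
lemma IsBrownianMotion.indep_increments (hB : IsBrownianMotion F B P) {u : ℝ} (hu : 0 ≤ u)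
    (S : Finset ℝ) :
    Indep (⨆ r ∈ S, MeasurableSpace.comap (fun ω => B (max u r) ω - B u ω) inferInstance) (F u)
      P := by
  induction S using Finset.induction_on_max with
  | empty => simpa using indep_bot_left (F u)
  | insert a S hS ih =>
    rcases S.eq_empty_or_nonempty with rfl | hne
    · simpa using hB.indep u (max u a) hu (le_max_left _ _)
    set w := S.max' hne with hw
    have hwa : max u w ≤ max u a := max_le_max le_rfl (hS w (S.max'_mem hne)).le
    have hw0 : 0 ≤ max u w := hu.trans (le_max_left _ _)
    have hSw : ∀ r ∈ S, max u r ≤ max u w := fun r hr => max_le_max le_rfl (S.le_max' r hr)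
    have hleF : (⨆ r ∈ S, MeasurableSpace.comap (fun ω => B (max u r) ω - B u ω) inferInstance) ≤
        F (max u w) := by
      refine iSup₂_le fun r hr => ?_
      rw [← measurable_iff_comap_le]
      exact ((hB.adapted _ (hu.trans (le_max_left _ _))).mono (F.mono (hSw r hr)) le_rfl).sub
        ((hB.adapted u hu).mono (F.mono (le_max_left _ _)) le_rfl)
    have hle2 : MeasurableSpace.comap (fun ω => B (max u a) ω - B (max u w) ω) inferInstance ≤
        mΩ := by
      rw [← measurable_iff_comap_le]
      exact (hB.measurable (hw0.trans hwa)).sub (hB.measurable hw0)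
    have h := indep_sup_of_indep hleF (F.mono (le_max_left u w)) (F.le _) hle2 ih
      (hB.indep _ _ hw0 hwa)
    refine indep_of_indep_of_le_left h ?_
    rw [Finset.iSup_insert]
    refine sup_le ?_ le_sup_left
    rw [← measurable_iff_comap_le]
    have e : (fun ω => B (max u a) ω - B u ω) =
        fun ω => (B (max u a) ω - B (max u w) ω) + (B (max u w) ω - B u ω) := by
      ext1 ω; abel
    rw [e]
    refine Measurable.add ?_ ?_
    · exact measurable_iff_comap_le.2 le_sup_right
    · refine measurable_iff_comap_le.2 (le_trans ?_ le_sup_left)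
      exact le_iSup₂ (f := fun r (_ : r ∈ S) =>
        MeasurableSpace.comap (fun ω => B (max u r) ω - B u ω) inferInstance) w (S.max'_mem hne)

/-- The noise input of a solution started from a point at time `u` is independent of the past. -/
theorem IsBrownianMotion.indep_inputSigma (hB : IsBrownianMotion F B P) {u : ℝ} (hu : 0 ≤ u)
    (x : E d) (t : ℝ) : Indep (inputSigma B P u (fun _ => x) t) (F u) P := by
  unfold inputSigma
  refine indep_sup_null ?_
  rw [MeasurableSpace.comap_const, bot_sup_eq]
  have h := indep_iSup_of_directed_le (μ := P) (hB.indep_increments hu)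
    (fun S => iSup₂_le fun r _ => by
      rw [← measurable_iff_comap_le]
      exact (hB.measurable (hu.trans (le_max_left _ _))).sub (hB.measurable hu)) (F.le u)
    (directed_of_isDirected_le fun S T hST => iSup₂_le fun r hr =>
      le_iSup₂ (f := fun r (_ : r ∈ T) =>
        MeasurableSpace.comap (fun ω => B (max u r) ω - B u ω) inferInstance) r
        (Finset.subset_iff.1 hST hr))
  refine indep_of_indep_of_le_left h (iSup₂_le fun r hr => ?_)
  refine le_iSup_of_le {r} ?_
  simp [max_eq_right hr.1]

end Independence

/-! ### Measurability along continuous paths -/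

section Paths

variable {d : ℕ} {Ω : Type*} {mΩ : MeasurableSpace Ω} {P : Measure Ω}

lemma IsBrownianMotion.inputSigma_le {F : Filtration ℝ mΩ}
    {B : ℝ → Ω → E d} (hB : IsBrownianMotion F B P) {u : ℝ} (hu : 0 ≤ u)
    (x : E d) (t : ℝ) : inputSigma B P u (fun _ => x) t ≤ mΩ := by
  refine sup_le (sup_le ?_ (iSup₂_le fun r hr => ?_)) (MeasurableSpace.generateFrom_le ?_)
  · rw [MeasurableSpace.comap_const]; exact bot_le
  · rw [← measurable_iff_comap_le]
    exact (hB.measurable (hu.trans hr.1)).sub (hB.measurable hu)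
  · exact fun A hA => hA.1

/-- A process with almost surely continuous paths has a jointly measurable modification with
continuous paths. -/
lemma exists_measurable_modification {Y : ℝ → Ω → E d} {u v : ℝ} (huv : u ≤ v)
    (hm : ∀ t ∈ Icc u v, Measurable (Y t))
    (hc : ∀ᵐ ω ∂P, ContinuousOn (fun t => Y t ω) (Icc u v)) :
    ∃ Y' : ℝ → Ω → E d, Measurable (Function.uncurry Y') ∧
      ∀ᵐ ω ∂P, ∀ t ∈ Icc u v, Y' t ω = Y t ω := by
  classical
  obtain ⟨A, hA, hAm, hA0⟩ := exists_measurable_superset_of_null hc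
  let Y' : ℝ → Ω → E d := fun t ω => if ω ∈ A then 0 else Y (projIcc u v huv t) ω
  refine ⟨Y', measurable_uncurry_of_continuous_of_measurable (fun ω => ?_) (fun t => ?_), ?_⟩
  · by_cases hω : ω ∈ A
    · simp only [Y', hω, if_true]; exact continuous_const
    · simp only [Y', hω, if_false]
      have : ContinuousOn (fun t => Y t ω) (Icc u v) := by
        by_contra h
        exact hω (hA h)
      exact (continuousOn_iff_continuous_domRestrict.1 this).comp continuous_projIcc
  · exact Measurable.ite hAm measurable_const (hm _ (projIcc u v huv t).2)
  · have : ∀ᵐ ω ∂P, ω ∉ A := measure_eq_zero_iff_ae_notMem.1 hA0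
    filter_upwards [this] with ω hω t ht
    simp [Y', hω, projIcc_of_mem huv ht]

lemma aemeasurable_integral_path {Y : ℝ → Ω → E d} {u v : ℝ} (huv : u ≤ v) [SFinite P]
    (hm : ∀ t ∈ Icc u v, Measurable (Y t))
    (hc : ∀ᵐ ω ∂P, ContinuousOn (fun t => Y t ω) (Icc u v)) {b : ℝ → E d → E d}
    (hb : Measurable (Function.uncurry b)) :
    AEStronglyMeasurable (fun ω => ∫ r in u..v, b r (Y r ω)) P := by
  obtain ⟨Y', hY', hYY'⟩ := exists_measurable_modification huv hm hc
  have h1 : Measurable fun p : Ω × ℝ => b p.2 (Y' p.2 p.1) :=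
    hb.comp (measurable_snd.prodMk (hY'.comp (measurable_snd.prodMk measurable_fst)))
  have h2 : StronglyMeasurable fun ω => ∫ r in Ioc u v, b r (Y' r ω) :=
    h1.stronglyMeasurable.integral_prod_right (ν := volume.restrict (Ioc u v))
  refine ⟨_, h2, ?_⟩
  filter_upwards [hYY'] with ω hω
  rw [intervalIntegral.integral_of_le huv]
  refine setIntegral_congr_fun measurableSet_Ioc fun r hr => ?_
  rw [hω r ⟨hr.1.le, hr.2⟩]

end Paths

/-! ### Minkowski's integral inequality -/

section Minkowski

/-- Minkowski's integral inequality in `L²`: expand the square of the inner integral as a double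
integral and apply the Cauchy–Schwarz inequality to each pair. -/
lemma lintegral_sq_lintegral_le {Ω : Type*} {mΩ : MeasurableSpace Ω} {P : Measure Ω} [SFinite P]
    {S : Type*} [MeasurableSpace S] {μ : Measure S} [SFinite μ]
    {Φ : S → Ω → ℝ≥0∞} (hΦ : Measurable (Function.uncurry Φ)) {e : S → ℝ≥0∞} (he : AEMeasurable e μ)
    (h : ∀ᵐ r ∂μ, (∫⁻ ω, Φ r ω ^ 2 ∂P) ^ (1 / 2 : ℝ) ≤ e r) :
    (∫⁻ ω, (∫⁻ r, Φ r ω ∂μ) ^ 2 ∂P) ^ (1 / 2 : ℝ) ≤ ∫⁻ r, e r ∂μ := by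
  have hr : ∀ r, Measurable (Φ r) := fun r => hΦ.comp measurable_prodMk_left
  have hω : ∀ ω, Measurable fun r => Φ r ω := fun ω => hΦ.comp measurable_prodMk_right
  have hCS : ∀ r s, ∫⁻ ω, Φ r ω * Φ s ω ∂P ≤
      (∫⁻ ω, Φ r ω ^ 2 ∂P) ^ (1 / 2 : ℝ) * (∫⁻ ω, Φ s ω ^ 2 ∂P) ^ (1 / 2 : ℝ) := by
    intro r s
    have := ENNReal.lintegral_mul_le_Lp_mul_Lq P (p := 2) (q := 2) Real.HolderConjugate.two_two
      (hr r).aemeasurable (hr s).aemeasurable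
    simpa using this
  have h1 : ∫⁻ ω, (∫⁻ r, Φ r ω ∂μ) ^ 2 ∂P = ∫⁻ r, ∫⁻ s, ∫⁻ ω, Φ r ω * Φ s ω ∂P ∂μ ∂μ := by
    have e1 : ∀ ω, (∫⁻ r, Φ r ω ∂μ) ^ 2 = ∫⁻ r, ∫⁻ s, Φ r ω * Φ s ω ∂μ ∂μ := by
      intro ω
      simp_rw [lintegral_const_mul _ (hω ω)]
      rw [lintegral_mul_const _ (hω ω), sq]
    have hm3 : Measurable fun p : (S × S) × Ω => Φ p.1.1 p.2 * Φ p.1.2 p.2 :=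
      (hΦ.comp (f := fun p : (S × S) × Ω => (p.1.1, p.2)) (by fun_prop)).mul
        (hΦ.comp (f := fun p : (S × S) × Ω => (p.1.2, p.2)) (by fun_prop))
    simp_rw [e1]
    rw [lintegral_lintegral_swap]
    · refine lintegral_congr fun r => ?_
      rw [lintegral_lintegral_swap]
      exact (hm3.comp (f := fun q : Ω × S => ((r, q.2), q.1)) (by fun_prop)).aemeasurable
    · refine Measurable.aemeasurable ?_
      exact (hm3.comp (f := fun q : (Ω × S) × S => ((q.1.2, q.2), q.1.1))
        (by fun_prop)).lintegral_prod_right'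
  have h2 : ∫⁻ ω, (∫⁻ r, Φ r ω ∂μ) ^ 2 ∂P ≤ (∫⁻ r, e r ∂μ) ^ 2 := by
    rw [h1, sq, ← lintegral_mul_const'' _ he]
    refine lintegral_mono_ae ?_
    filter_upwards [h] with r hr
    rw [← lintegral_const_mul'' _ he]
    refine lintegral_mono_ae ?_
    filter_upwards [h] with s hs
    exact (hCS r s).trans (mul_le_mul' hr hs)
  calc _ ≤ ((∫⁻ r, e r ∂μ) ^ 2) ^ (1 / 2 : ℝ) := ENNReal.rpow_le_rpow h2 (by norm_num)
    _ = _ := by rw [← ENNReal.rpow_natCast, ← ENNReal.rpow_mul]; norm_num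

end Minkowski

/-! ### The difference of the learned and the ideal dynamics -/

section Comparison

/-- The analytic hypotheses on the schedule, the data law and the learned score. -/
structure Setting {d : ℕ} (T : ℝ) (f g : ℝ → ℝ) (V₀ : E d → ℝ) (sθ : ℝ → E d → E d) (α M : ℝ)
    (ε ℓ : ℝ → ℝ) : Prop where
  T_pos : 0 < T
  f_meas : Measurable f
  g_meas : Measurable g
  g_pos : ∀ s ∈ Ioc 0 T, 0 < g s
  f_int : IntegrableOn f (Ioc 0 T)
  g_int : IntegrableOn (fun s => g s ^ 2) (Ioc 0 T)
  contDiff : ContDiff ℝ 1 V₀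
  exp_int : Integrable (fun x => Real.exp (-V₀ x))
  score_meas : Measurable (Function.uncurry sθ)
  weak : WeakLogConcave V₀ α M
  errorL2 : ScoreErrorL2 f g V₀ sθ T ε
  mono : ScoreErrorMonotone f g V₀ sθ T ℓ
  load_int : IntegrableOn (load f g α M ℓ) (Ioc 0 T)

/-- The exact score, set to zero outside `(0, T]`; it is jointly measurable. -/
def truncScore {d : ℕ} (f g : ℝ → ℝ) (V₀ : E d → ℝ) (T s : ℝ) (x : E d) : E d :=
  (Ioc 0 T).indicator (fun s => score f g V₀ s x) s

variable {d : ℕ} {T : ℝ} {f g : ℝ → ℝ} {V₀ : E d → ℝ} {sθ : ℝ → E d → E d} {α M : ℝ}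
    {ε ℓ : ℝ → ℝ}

lemma truncScore_of_mem {s : ℝ} (hs : s ∈ Ioc 0 T) (x : E d) :
    truncScore f g V₀ T s x = score f g V₀ s x := by
  rw [truncScore, indicator_of_mem hs]

lemma Setting.measurable_truncScore (h : Setting T f g V₀ sθ α M ε ℓ) :
    Measurable (Function.uncurry (truncScore f g V₀ T)) := by
  classical
  have hc := continuousOn_score h.weak h.contDiff h.exp_int h.T_pos.le h.f_int h.g_int h.g_pos
  have hm := ContinuousOn.measurable_piecewise (g := fun _ => 0) hc continuousOn_const
    (measurableSet_Ioc.prod MeasurableSet.univ)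
  convert hm using 1
  ext1 p
  by_cases hp : p.1 ∈ Ioc 0 T
  · rw [piecewise_eq_of_mem _ _ _ (show p ∈ Ioc 0 T ×ˢ univ from ⟨hp, mem_univ _⟩)]
    exact truncScore_of_mem hp _
  · rw [piecewise_eq_of_notMem _ _ _ (show p ∉ Ioc 0 T ×ˢ univ from fun h => hp h.1)]
    exact indicator_of_notMem hp (fun s => score f g V₀ s p.2)

lemma measurable_reverseDrift (hf : Measurable f) (hg : Measurable g) {S : ℝ → E d → E d}
    (hS : Measurable (Function.uncurry S)) :
    Measurable (Function.uncurry (reverseDrift f g T S)) := by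
  have h1 : Measurable fun p : ℝ × E d => S (T - p.1) p.2 :=
    hS.comp (f := fun p : ℝ × E d => (T - p.1, p.2)) (by fun_prop)
  unfold reverseDrift Function.uncurry
  exact ((hf.comp (by fun_prop)).smul measurable_snd).add
    (((hg.comp (by fun_prop)).pow_const 2).smul h1)

/-- One-sided comparison of the learned drift at `y` with the ideal drift at `x`. -/
lemma Setting.inner_drift_sub_le (h : Setting T f g V₀ sθ α M ε ℓ) {r : ℝ} (hr : T - r ∈ Ioc 0 T)
    (x y : E d) :
    ⟪reverseDrift f g T sθ r y - reverseDrift f g T (score f g V₀) r x, y - x⟫ ≤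
      load f g α M ℓ (T - r) * ‖y - x‖ ^ 2 +
        (g (T - r) ^ 2 * ‖scoreError f g V₀ sθ (T - r) x‖) * ‖y - x‖ := by
  set s := T - r with hs
  have h1 := inner_score_sub_le h.weak h.contDiff h.exp_int hr.1
    (sigmaSq_pos h.f_int h.g_int h.g_pos hr) y x
  have h2 := h.mono.bound s hr y x
  have h3 := real_inner_le_norm (scoreError f g V₀ sθ s x) (y - x)
  have e : reverseDrift f g T sθ r y - reverseDrift f g T (score f g V₀) r x =
      f s • (y - x) + g s ^ 2 • ((score f g V₀ s y - score f g V₀ s x) +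
        (scoreError f g V₀ sθ s y - scoreError f g V₀ sθ s x) + scoreError f g V₀ sθ s x) := by
    simp only [reverseDrift, scoreError, ← hs]
    module
  rw [e, inner_add_left, real_inner_smul_left, real_inner_smul_left, inner_add_left,
    inner_add_left, real_inner_self_eq_norm_sq, load]
  have hg := sq_nonneg (g s)
  nlinarith [mul_le_mul_of_nonneg_left (add_le_add (add_le_add h1 h2) h3) hg]

lemma Setting.intervalIntegrable_load (h : Setting T f g V₀ sθ α M ε ℓ) {u v : ℝ} (hu : 0 ≤ u)
    (huv : u ≤ v) (hv : v ≤ T) : IntervalIntegrable (load f g α M ℓ) volume u v := by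
  rw [intervalIntegrable_iff_integrableOn_Ioc_of_le huv]
  exact h.load_int.mono_set (Ioc_subset_Ioc hu hv)

lemma Setting.intervalIntegrable_load_sub (h : Setting T f g V₀ sθ α M ε ℓ) {u v : ℝ} (hu : 0 ≤ u)
    (huv : u ≤ v) (hv : v ≤ T) :
    IntervalIntegrable (fun r => load f g α M ℓ (T - r)) volume u v := by
  have := (h.intervalIntegrable_load (u := T - v) (v := T - u) (by linarith) (by linarith)
    (by linarith)).comp_sub_left T
  simpa using this.symm

lemma Setting.integral_load_sub (h : Setting T f g V₀ sθ α M ε ℓ) {u v : ℝ} (hu : 0 ≤ u)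
    (huv : u ≤ v) (hv : v ≤ T) :
    ∫ r in u..v, load f g α M ℓ (T - r) = Gam f g α M ℓ (T - u) - Gam f g α M ℓ (T - v) := by
  rw [intervalIntegral.integral_comp_sub_left (fun s => load f g α M ℓ s), Gam, Gam,
    intervalIntegral.integral_interval_sub_left]
  · exact h.intervalIntegrable_load le_rfl (by linarith) (by linarith)
  · exact h.intervalIntegrable_load le_rfl (by linarith) (by linarith)

lemma Setting.continuousOn_Gam (h : Setting T f g V₀ sθ α M ε ℓ) :
    ContinuousOn (Gam f g α M ℓ) (Icc 0 T) := by
  have := intervalIntegral.continuousOn_primitive_interval (a := 0) (b := T) (μ := volume)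
    (f := load f g α M ℓ)
    (by rw [uIcc_of_le h.T_pos.le]; exact (integrableOn_Icc_iff_integrableOn_Ioc).2 h.load_int)
  rwa [uIcc_of_le h.T_pos.le] at this

lemma Setting.integrableOn_error (h : Setting T f g V₀ sθ α M ε ℓ) :
    IntegrableOn (fun s => Real.exp (Gam f g α M ℓ s) * g s ^ 2 * ε s) (Icc 0 T) := by
  simp only [mul_assoc]
  exact IntegrableOn.continuousOn_mul h.continuousOn_Gam.rexp
    ((integrableOn_Icc_iff_integrableOn_Ioc).2 h.errorL2.integrable) isCompact_Icc

variable {Ω : Type*} {mΩ : MeasurableSpace Ω} {P : Measure Ω} [IsProbabilityMeasure P]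
  {F : Filtration ℝ mΩ} {B : ℝ → Ω → E d} {X : ℝ → Ω → E d}

/-- The noise cancels in the difference of two solutions driven by the same Brownian motion. -/
lemma Setting.sub_eq_integral (h : Setting T f g V₀ sθ α M ε ℓ) (hB : IsBrownianMotion F B P)
    (hX : IsSolution F B P (reverseDrift f g T (score f g V₀)) (fun t => g (T - t)) 0 T (X 0) X)
    {u v : ℝ} (hu : 0 ≤ u) (huv : u ≤ v) (hv : v ≤ T) {𝓖 : ℝ → MeasurableSpace Ω}
    (h𝓖 : ∀ t, 𝓖 t ≤ mΩ) {x : Ω → E d} {Y : ℝ → Ω → E d}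
    (hY : IsSolution 𝓖 B P (reverseDrift f g T sθ) (fun t => g (T - t)) u v x Y) :
    ∀ᵐ ω ∂P, ∀ t ∈ Icc u v, Y t ω - X t ω = Y u ω - X u ω +
      ∫ r in u..t, (reverseDrift f g T sθ r (Y r ω) -
        reverseDrift f g T (score f g V₀) r (X r ω)) := by
  have hXm : ∀ t ∈ Icc 0 T, Measurable (X t) := fun t ht => (hX.adapted t ht).mono (F.le t) le_rfl
  have hYm : ∀ t ∈ Icc u v, Measurable (Y t) := fun t ht => (hY.adapted t ht).mono (h𝓖 t) le_rfl
  have hmX := measurable_reverseDrift (T := T) h.f_meas h.g_meas h.measurable_truncScore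
  have hmY := measurable_reverseDrift (T := T) h.f_meas h.g_meas h.score_meas
  -- The exact score is replaced by its measurable truncation; they differ only at `r = T`, where
  -- the score is evaluated at time `0`.
  have hcongr : ∀ t ∈ Icc 0 T, ∀ ω,
      ∫ r in (0 : ℝ)..t, reverseDrift f g T (truncScore f g V₀ T) r (X r ω) =
      ∫ r in (0 : ℝ)..t, reverseDrift f g T (score f g V₀) r (X r ω) := by
    intro t ht ω
    rw [intervalIntegral.integral_of_le ht.1, intervalIntegral.integral_of_le ht.1]
    refine setIntegral_congr_ae measurableSet_Ioc ?_
    have : ∀ᵐ r : ℝ, r ≠ T := by simp [ae_iff, measure_singleton]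
    filter_upwards [this] with r hrT hr
    have hmem : T - r ∈ Ioc 0 T := by
      have := lt_of_le_of_ne (hr.2.trans ht.2) hrT
      exact ⟨by linarith, by linarith [hr.1]⟩
    simp only [reverseDrift, truncScore_of_mem hmem]
  have hN : ∀ t ∈ Icc 0 T, AEStronglyMeasurable (fun ω => X t ω - X 0 ω -
      ∫ r in (0 : ℝ)..t, reverseDrift f g T (score f g V₀) r (X r ω)) P := by
    intro t ht
    simp only [← hcongr t ht]
    refine AEStronglyMeasurable.sub
      ((hXm t ht).sub (hXm 0 ⟨le_rfl, h.T_pos.le⟩)).aestronglyMeasurable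
      (aemeasurable_integral_path ht.1 (fun r hr => hXm r ⟨hr.1, hr.2.trans ht.2⟩) ?_ hmX)
    exact hX.cont.mono fun ω hω => hω.mono (Icc_subset_Icc_right ht.2)
  have hN' : ∀ t ∈ Icc u v, AEStronglyMeasurable (fun ω => Y t ω - Y u ω -
      ∫ r in u..t, reverseDrift f g T sθ r (Y r ω)) P := by
    intro t ht
    refine AEStronglyMeasurable.sub ((hYm t ht).sub (hYm u ⟨le_rfl, huv⟩)).aestronglyMeasurable
      (aemeasurable_integral_path ht.1 (fun r hr => hYm r ⟨hr.1, hr.2.trans ht.2⟩) ?_ hmY)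
    exact hY.cont.mono fun ω hω => hω.mono (Icc_subset_Icc_right ht.2)
  have hσ : Measurable fun t => g (T - t) := h.g_meas.comp (by fun_prop)
  have hfix : ∀ t ∈ Icc u v, ∀ᵐ ω ∂P, Y t ω - X t ω = Y u ω - X u ω +
      ∫ r in u..t, (reverseDrift f g T sθ r (Y r ω) -
        reverseDrift f g T (score f g V₀) r (X r ω)) := by
    intro t ht
    have ht0 : t ∈ Icc 0 T := ⟨hu.trans ht.1, ht.2.trans hv⟩
    have hu0 : u ∈ Icc 0 T := ⟨hu, huv.trans hv⟩
    have hsub := HasWienerIntegral.sub_ae_eq hB hσ hu ht.1 (hN t ht0) (hN u hu0) (hN' t ht)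
      (hX.eq t ht0) (hX.eq u hu0) (hY.eq t ht)
    filter_upwards [hsub, hX.drift_integrable, hY.drift_integrable] with ω h1 h2 h3
    have i1 : ∀ s ∈ Icc 0 T, ∀ s' ∈ Icc 0 T, IntervalIntegrable
        (fun r => reverseDrift f g T (score f g V₀) r (X r ω)) volume s s' := fun s hs s' hs' =>
      h2.mono_set (uIcc_subset_uIcc (by rwa [uIcc_of_le h.T_pos.le])
        (by rwa [uIcc_of_le h.T_pos.le]))
    have i3 : IntervalIntegrable (fun r => reverseDrift f g T sθ r (Y r ω)) volume u t :=
      h3.mono_set (uIcc_subset_uIcc left_mem_uIcc (by rwa [uIcc_of_le huv]))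
    have h00 : (0 : ℝ) ∈ Icc 0 T := ⟨le_rfl, h.T_pos.le⟩
    have e1 := intervalIntegral.integral_add_adjacent_intervals (i1 0 h00 u hu0) (i1 u hu0 t ht0)
    rw [intervalIntegral.integral_sub i3 (i1 u hu0 t ht0)]
    rw [← e1] at h1
    have h4 : X t ω - X u ω - ∫ r in u..t, reverseDrift f g T (score f g V₀) r (X r ω) =
        Y t ω - Y u ω - ∫ r in u..t, reverseDrift f g T sθ r (Y r ω) := by
      rw [← h1]; abel
    rw [sub_eq_iff_eq_add] at h4
    rw [show X t ω = (X t ω - X u ω) + X u ω by abel, h4]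
    abel
  -- the identity at each time extends to all times at once by continuity of the paths
  obtain ⟨D, hDc, hDd⟩ := TopologicalSpace.exists_countable_dense (Icc u v)
  have hall : ∀ᵐ ω ∂P, ∀ t ∈ D, Y t ω - X t ω = Y u ω - X u ω +
      ∫ r in u..(t : ℝ), (reverseDrift f g T sθ r (Y r ω) -
        reverseDrift f g T (score f g V₀) r (X r ω)) :=
    (ae_ball_iff hDc).2 fun t _ => hfix t t.2
  filter_upwards [hall, hX.cont, hY.cont, hX.drift_integrable, hY.drift_integrable]
    with ω h1 h2 h3 h4 h5
  have hI : IntervalIntegrable (fun r => reverseDrift f g T sθ r (Y r ω) -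
      reverseDrift f g T (score f g V₀) r (X r ω)) volume u v := by
    refine h5.sub (h4.mono_set (uIcc_subset_uIcc ?_ ?_)) <;> rw [uIcc_of_le h.T_pos.le]
    exacts [⟨hu, huv.trans hv⟩, ⟨hu.trans huv, hv⟩]
  have c1 : ContinuousOn (fun t => Y t ω - X t ω) (Icc u v) :=
    h3.sub (h2.mono (Icc_subset_Icc hu hv))
  have c2 : ContinuousOn (fun t => Y u ω - X u ω + ∫ r in u..t, (reverseDrift f g T sθ r (Y r ω) -
      reverseDrift f g T (score f g V₀) r (X r ω))) (Icc u v) := by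
    refine continuousOn_const.add ?_
    have := intervalIntegral.continuousOn_primitive_interval' hI left_mem_uIcc
    rwa [uIcc_of_le huv] at this
  have := Continuous.ext_on hDd (continuousOn_iff_continuous_domRestrict.1 c1)
    (continuousOn_iff_continuous_domRestrict.1 c2) (fun t ht => h1 t ht)
  intro t ht
  exact congrFun this ⟨t, ht⟩

end Comparison

/-! ### Stability of the learned dynamics -/

section ErrorIntegral

variable {d : ℕ} {T : ℝ} {f g : ℝ → ℝ} {V₀ : E d → ℝ} {sθ : ℝ → E d → E d} {α M : ℝ}
    {ε ℓ : ℝ → ℝ} {Ω : Type*} {mΩ : MeasurableSpace Ω} {P : Measure Ω} [IsProbabilityMeasure P]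
    {F : Filtration ℝ mΩ} {B : ℝ → Ω → E d} {X : ℝ → Ω → E d}

/-- Pathwise stability: a solution of the learned equation follows the ideal trajectory up to the
score error accumulated along the latter. -/
lemma Setting.enorm_sub_le (h : Setting T f g V₀ sθ α M ε ℓ) (hB : IsBrownianMotion F B P)
    (hX : IsSolution F B P (reverseDrift f g T (score f g V₀)) (fun t => g (T - t)) 0 T (X 0) X)
    {u v : ℝ} (hu : 0 ≤ u) (huv : u ≤ v) (hv : v ≤ T) {𝓖 : ℝ → MeasurableSpace Ω}
    (h𝓖 : ∀ t, 𝓖 t ≤ mΩ) {x : Ω → E d} {Y : ℝ → Ω → E d}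
    (hY : IsSolution 𝓖 B P (reverseDrift f g T sθ) (fun t => g (T - t)) u v x Y) :
    ∀ᵐ ω ∂P, ‖Y v ω - X v ω‖ₑ ≤
      ENNReal.ofReal (Real.exp (Gam f g α M ℓ (T - u) - Gam f g α M ℓ (T - v))) *
        ‖x ω - X u ω‖ₑ +
      ∫⁻ r in Ioc u v, ENNReal.ofReal
        (Real.exp (Gam f g α M ℓ (T - r) - Gam f g α M ℓ (T - v)) * g (T - r) ^ 2) *
        ‖sθ (T - r) (X r ω) - truncScore f g V₀ T (T - r) (X r ω)‖ₑ := by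
  have hT := h.T_pos.le
  filter_upwards [h.sub_eq_integral hB hX hu huv hv h𝓖 hY, hX.cont, hX.drift_integrable,
    hY.drift_integrable, hY.init] with ω h1 h2 h3 h4 h5
  set w : ℝ → ℝ := fun r => Real.exp (Gam f g α M ℓ (T - r) - Gam f g α M ℓ (T - v)) with hw
  set c : ℝ → ℝ := fun r => g (T - r) ^ 2 *
    ‖sθ (T - r) (X r ω) - truncScore f g V₀ T (T - r) (X r ω)‖ with hc
  have hwc : ContinuousOn w (Icc u v) := by
    refine ((h.continuousOn_Gam.comp (continuousOn_const.sub continuousOn_id) ?_).sub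
      continuousOn_const).rexp
    intro r hr
    exact ⟨show 0 ≤ T - r by linarith [hr.2], show T - r ≤ T by linarith [hr.1]⟩
  have hXm : AEMeasurable (fun r => X r ω) (volume.restrict (Ioc u v)) :=
    (h2.mono fun r hr => ⟨hu.trans hr.1.le, hr.2.trans hv⟩).aemeasurable measurableSet_Ioc
  have hpair : AEMeasurable (fun r => (T - r, X r ω)) (volume.restrict (Ioc u v)) :=
    (Measurable.aemeasurable (by fun_prop)).prodMk hXm
  have hcm : AEMeasurable c (volume.restrict (Ioc u v)) := by
    have e1 := (h.score_meas.comp_aemeasurable hpair).sub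
      (h.measurable_truncScore.comp_aemeasurable hpair)
    have e2 : AEMeasurable (fun r => g (T - r) ^ 2) (volume.restrict (Ioc u v)) :=
      ((h.g_meas.comp (by fun_prop)).pow_const 2).aemeasurable
    exact e2.mul e1.norm
  have hwm : AEMeasurable w (volume.restrict (Ioc u v)) :=
    (hwc.mono Ioc_subset_Icc_self).aemeasurable measurableSet_Ioc
  have hc0 : ∀ r, 0 ≤ c r := fun r => by positivity
  have hwc0 : ∀ r, 0 ≤ w r * c r := fun r => mul_nonneg (Real.exp_pos _).le (hc0 r)
  have hlint : ∫⁻ r in Ioc u v, ENNReal.ofReal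
      (Real.exp (Gam f g α M ℓ (T - r) - Gam f g α M ℓ (T - v)) * g (T - r) ^ 2) *
      ‖sθ (T - r) (X r ω) - truncScore f g V₀ T (T - r) (X r ω)‖ₑ =
      ∫⁻ r in Ioc u v, ENNReal.ofReal (w r * c r) := by
    refine lintegral_congr fun r => ?_
    rw [← ofReal_norm, ← ENNReal.ofReal_mul (by positivity), hc, hw]
    simp only [mul_assoc]
  rw [hlint]
  -- an infinite accumulated error leaves nothing to prove; a finite one is integrable, as Grönwall's
  -- inequality requires
  by_cases hfin : ∫⁻ r in Ioc u v, ENNReal.ofReal (w r * c r) = ⊤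
  · rw [hfin, add_top]; exact le_top
  have hwcint : IntegrableOn (fun r => w r * c r) (Ioc u v) := by
    refine ⟨(hwm.mul hcm).aestronglyMeasurable, ?_⟩
    rw [hasFiniteIntegral_iff_ofReal (ae_of_all _ hwc0)]
    exact lt_top_iff_ne_top.2 hfin
  have hcint : IntervalIntegrable c volume u v := by
    have i1 : IntervalIntegrable (fun r => w r * c r) volume u v :=
      (intervalIntegrable_iff_integrableOn_Ioc_of_le huv).2 hwcint
    have i2 : ContinuousOn (fun r => (w r)⁻¹) (uIcc u v) := by
      rw [uIcc_of_le huv]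
      exact hwc.inv₀ fun r _ => (Real.exp_pos _).ne'
    refine (i1.continuousOn_mul i2).congr fun r _ => ?_
    have : w r ≠ 0 := (Real.exp_pos _).ne'
    field_simp
  have hI : IntervalIntegrable (fun r => reverseDrift f g T sθ r (Y r ω) -
      reverseDrift f g T (score f g V₀) r (X r ω)) volume u v := by
    refine h4.sub (h3.mono_set (uIcc_subset_uIcc ?_ ?_)) <;> rw [uIcc_of_le hT]
    exacts [⟨hu, huv.trans hv⟩, ⟨hu.trans huv, hv⟩]
  -- At `r = T` the drifts involve the score at time `0`, where no bound is assumed.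
  have hne : ∀ᵐ r : ℝ, r ≠ T := by simp [ae_iff, measure_singleton]
  have hG := norm_le_of_inner_deriv_le huv (D := fun t => Y t ω - X t ω) hI
    (h.intervalIntegrable_load_sub hu huv hv) hcint h1
    (by
      filter_upwards [hne] with r hrT hr
      have hmem : T - r ∈ Ioc 0 T := by
        have := lt_of_le_of_ne (hr.2.trans hv) hrT
        exact ⟨by linarith, by linarith [hr.1]⟩
      have := h.inner_drift_sub_le hmem (X r ω) (Y r ω)
      simpa only [hc, truncScore_of_mem hmem, scoreError] using this)
    (ae_of_all _ fun r _ => hc0 r)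
  rw [h.integral_load_sub hu huv hv] at hG
  have hG2 : ∫ r in u..v, Real.exp (∫ s in r..v, load f g α M ℓ (T - s)) * c r =
      ∫ r in Ioc u v, w r * c r := by
    rw [intervalIntegral.integral_of_le huv]
    refine setIntegral_congr_fun measurableSet_Ioc fun r hr => ?_
    simp only [hw]
    rw [h.integral_load_sub (hu.trans hr.1.le) hr.2 hv]
  rw [hG2] at hG
  have h6 := ENNReal.ofReal_le_ofReal hG
  rw [ENNReal.ofReal_add (by positivity) (integral_nonneg hwc0),
    ENNReal.ofReal_mul (Real.exp_pos _).le, ofReal_norm, ofReal_norm,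
    ofReal_integral_eq_lintegral_ofReal hwcint (ae_of_all _ hwc0)] at h6
  rwa [h5] at h6

/-- The score error `R` accumulated on `[u, v]` along the ideal trajectory serves every solution of
the learned equation on `[u, v]`. As `X_r` has law `p_{T - r}`, Minkowski's inequality bounds `R`
in `L²` through `ε`. -/
theorem Setting.exists_error_bound (h : Setting T f g V₀ sθ α M ε ℓ) (hB : IsBrownianMotion F B P)
    (hX : IsSolution F B P (reverseDrift f g T (score f g V₀)) (fun t => g (T - t)) 0 T (X 0) X)
    (hX_law : ∀ t ∈ Icc 0 T, P.map (X t) = forwardMarginal f g V₀ (T - t))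
    {u v : ℝ} (hu : 0 ≤ u) (huv : u ≤ v) (hv : v ≤ T) :
    ∃ R : Ω → ℝ≥0∞, Measurable R ∧
      (∫⁻ ω, R ω ^ 2 ∂P) ^ (1 / 2 : ℝ) ≤ ENNReal.ofReal (Real.exp (-Gam f g α M ℓ (T - v)) *
        ∫ s in (T - v)..(T - u), Real.exp (Gam f g α M ℓ s) * g s ^ 2 * ε s) ∧
      ∀ (𝓖 : ℝ → MeasurableSpace Ω), (∀ t, 𝓖 t ≤ mΩ) → ∀ (x : Ω → E d) (Y : ℝ → Ω → E d),
        IsSolution 𝓖 B P (reverseDrift f g T sθ) (fun t => g (T - t)) u v x Y →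
        ∀ᵐ ω ∂P, ‖Y v ω - X v ω‖ₑ ≤
          ENNReal.ofReal (Real.exp (Gam f g α M ℓ (T - u) - Gam f g α M ℓ (T - v))) *
            ‖x ω - X u ω‖ₑ + R ω := by
  have hXm : ∀ t ∈ Icc u v, Measurable (X t) := fun t ht =>
    (hX.adapted t ⟨hu.trans ht.1, ht.2.trans hv⟩).mono (F.le t) le_rfl
  obtain ⟨X', hX'm, hX'⟩ := exists_measurable_modification huv hXm
    (hX.cont.mono fun ω hω => hω.mono (Icc_subset_Icc hu hv))
  set w : ℝ → ℝ := (Icc u v).indicator fun r =>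
    Real.exp (Gam f g α M ℓ (T - r) - Gam f g α M ℓ (T - v)) with hw
  have hwm : Measurable w := by
    classical
    rw [hw, ← piecewise_eq_indicator]
    refine ContinuousOn.measurable_piecewise ?_ continuousOn_const measurableSet_Icc
    refine ((h.continuousOn_Gam.comp (continuousOn_const.sub continuousOn_id) ?_).sub
      continuousOn_const).rexp
    intro r hr
    exact ⟨show 0 ≤ T - r by linarith [hr.2], show T - r ≤ T by linarith [hr.1]⟩
  have hw0 : ∀ r, 0 ≤ w r := fun r => indicator_nonneg (fun _ _ => (Real.exp_pos _).le) r
  set es : ℝ → E d → E d := fun s x => sθ s x - truncScore f g V₀ T s x with hes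
  have hesm : Measurable (Function.uncurry es) := h.score_meas.sub h.measurable_truncScore
  set Φ : ℝ → Ω → ℝ≥0∞ := fun r ω => ENNReal.ofReal (w r * g (T - r) ^ 2) * ‖es (T - r) (X' r ω)‖ₑ
    with hΦ
  have hgm : Measurable fun r => g (T - r) := h.g_meas.comp (by fun_prop)
  have hesr : ∀ s, Measurable (es s) := fun s => hesm.comp measurable_prodMk_left
  have hΦm : Measurable (Function.uncurry Φ) := by
    refine Measurable.fun_mul (f := fun p : ℝ × Ω => ENNReal.ofReal (w p.1 * g (T - p.1) ^ 2))
      (g := fun p : ℝ × Ω => ‖es (T - p.1) (X' p.1 p.2)‖ₑ) ?_ ?_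
    · exact ((hwm.mul (hgm.pow_const 2)).ennreal_ofReal).comp measurable_fst
    · exact (hesm.comp (f := fun p : ℝ × Ω => (T - p.1, X' p.1 p.2))
        ((by fun_prop : Measurable fun p : ℝ × Ω => T - p.1).prodMk hX'm)).enorm
  -- the bound for the `L²` norm of the integrand at time `r`
  set e : ℝ → ℝ := fun r => Real.exp (-Gam f g α M ℓ (T - v)) *
    (Real.exp (Gam f g α M ℓ (T - r)) * g (T - r) ^ 2 * ε (T - r)) with he
  have hei : IntervalIntegrable e volume u v := by
    have i1 : IntervalIntegrable (fun s => Real.exp (Gam f g α M ℓ s) * g s ^ 2 * ε s) volume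
        (T - v) (T - u) := by
      rw [intervalIntegrable_iff_integrableOn_Icc_of_le (by linarith)]
      exact h.integrableOn_error.mono_set (Icc_subset_Icc (by linarith) (by linarith))
    have i2 := (i1.comp_sub_left T).symm.const_mul (Real.exp (-Gam f g α M ℓ (T - v)))
    simpa using i2
  have heon : IntegrableOn e (Ioc u v) :=
    (intervalIntegrable_iff_integrableOn_Ioc_of_le huv).1 hei
  have hne : ∀ᵐ r : ℝ, r ≠ T := by simp [ae_iff, measure_singleton]
  have hmem : ∀ {r}, r ∈ Ioc u v → r ≠ T → T - r ∈ Ioc 0 T := fun {r} hr hrT => by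
    have := lt_of_le_of_ne (hr.2.trans hv) hrT
    exact ⟨by linarith, by linarith [hr.1]⟩
  refine ⟨fun ω => ∫⁻ r in Ioc u v, Φ r ω, ?_, ?_, ?_⟩
  · exact Measurable.lintegral_prod_left' hΦm
  · refine (lintegral_sq_lintegral_le (e := fun r => ENNReal.ofReal (e r)) hΦm
      heon.1.aemeasurable.ennreal_ofReal ?_).trans ?_
    · rw [ae_restrict_iff' measurableSet_Ioc]
      filter_upwards [hne] with r hrT hr
      have hs := hmem hr hrT
      have hrI : r ∈ Icc u v := ⟨hr.1.le, hr.2⟩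
      have hk : 0 ≤ w r * g (T - r) ^ 2 := mul_nonneg (hw0 r) (sq_nonneg _)
      have hm1 : Measurable fun ω => ‖es (T - r) (X' r ω)‖ₑ ^ 2 :=
        ((hesr _).comp (hX'm.comp (measurable_prodMk_left (x := r)))).enorm.pow_const 2
      simp only [hΦ, mul_pow]
      rw [lintegral_const_mul _ hm1, ENNReal.mul_rpow_of_nonneg _ _ (by norm_num)]
      have e1 : (ENNReal.ofReal (w r * g (T - r) ^ 2) ^ 2) ^ (1 / 2 : ℝ) =
          ENNReal.ofReal (w r * g (T - r) ^ 2) := by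
        rw [← ENNReal.rpow_natCast, ← ENNReal.rpow_mul]; norm_num
      have e2 : ∫⁻ ω, ‖es (T - r) (X' r ω)‖ₑ ^ 2 ∂P ≤ ENNReal.ofReal (ε (T - r) ^ 2) := by
        have := h.errorL2.bound (T - r) hs
        have hr0 : r ∈ Icc 0 T := ⟨hu.trans hr.1.le, hr.2.trans hv⟩
        have hl := hX_law r hr0
        rw [← hl] at this
        have e3 : ∫⁻ ω, ‖es (T - r) (X' r ω)‖ₑ ^ 2 ∂P =
            ∫⁻ y, ‖es (T - r) y‖ₑ ^ 2 ∂(P.map (X r)) := by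
          rw [lintegral_map ((hesr _).enorm.pow_const 2) (hXm r hrI)]
          refine lintegral_congr_ae ?_
          filter_upwards [hX'] with ω hω
          rw [hω r hrI]
        rw [e3]
        refine le_trans (le_of_eq ?_) this
        refine lintegral_congr fun y => ?_
        simp only [hes, scoreError, truncScore_of_mem hs]
      have hε := h.errorL2.nonneg (T - r) hs
      have e4 : (∫⁻ ω, ‖es (T - r) (X' r ω)‖ₑ ^ 2 ∂P) ^ (1 / 2 : ℝ) ≤
          ENNReal.ofReal (ε (T - r)) := by
        refine (ENNReal.rpow_le_rpow e2 (by norm_num)).trans (le_of_eq ?_)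
        rw [ENNReal.ofReal_pow hε, ← ENNReal.rpow_natCast, ← ENNReal.rpow_mul]; norm_num
      rw [e1]
      refine (mul_le_mul' le_rfl e4).trans (le_of_eq ?_)
      rw [← ENNReal.ofReal_mul hk]
      congr 1
      rw [hw, indicator_of_mem hrI, he]
      simp only
      rw [sub_eq_add_neg, Real.exp_add]
      ring
    · rw [← ofReal_integral_eq_lintegral_ofReal heon ?_]
      · refine le_of_eq ?_
        congr 1
        rw [← intervalIntegral.integral_of_le huv, he, intervalIntegral.integral_const_mul,
          intervalIntegral.integral_comp_sub_left
            (fun s => Real.exp (Gam f g α M ℓ s) * g s ^ 2 * ε s)]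
      · rw [EventuallyLE, ae_restrict_iff' measurableSet_Ioc]
        filter_upwards [hne] with r hrT hr
        have := h.errorL2.nonneg (T - r) (hmem hr hrT)
        simp only [he, Pi.zero_apply]
        positivity
  · intro 𝓖 h𝓖 x Y hY
    filter_upwards [h.enorm_sub_le hB hX hu huv hv h𝓖 hY, hX'] with ω h1 h2
    refine h1.trans (add_le_add le_rfl (le_of_eq ?_))
    refine setLIntegral_congr_fun measurableSet_Ioc fun r hr => ?_
    have hrI : r ∈ Icc u v := ⟨hr.1.le, hr.2⟩
    simp only [hΦ, hes]
    rw [h2 r hrI, hw, indicator_of_mem hrI]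

end ErrorIntegral

/-! ### The quadratic Wasserstein distance -/

section Wasserstein

variable {d : ℕ}

lemma sq_rpow_half (c : ℝ≥0∞) : (c ^ 2) ^ (1 / 2 : ℝ) = c := by
  rw [← ENNReal.rpow_natCast, ← ENNReal.rpow_mul]; norm_num

lemma rpow_half_sq (c : ℝ≥0∞) : (c ^ (1 / 2 : ℝ)) ^ 2 = c := by
  rw [← ENNReal.rpow_natCast, ← ENNReal.rpow_mul]; norm_num

/-- Every coupling bounds the Wasserstein distance of its marginals. -/
lemma W2_le_of_coupling {μ ν : Measure (E d)} (π : Measure (E d × E d))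
    (h₁ : π.map Prod.fst = μ) (h₂ : π.map Prod.snd = ν) :
    W2 μ ν ≤ (∫⁻ z, ‖z.1 - z.2‖ₑ ^ 2 ∂π) ^ (1 / 2 : ℝ) :=
  ENNReal.rpow_le_rpow (iInf₂_le π ⟨h₁, h₂⟩) (by norm_num)

lemma W2_map_le {Ω : Type*} {mΩ : MeasurableSpace Ω} (P : Measure Ω) {A A' : Ω → E d}
    (hA : AEMeasurable A P) (hA' : AEMeasurable A' P) :
    W2 (P.map A) (P.map A') ≤ (∫⁻ ω, ‖A ω - A' ω‖ₑ ^ 2 ∂P) ^ (1 / 2 : ℝ) := by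
  have hm : AEMeasurable (fun ω => (A ω, A' ω)) P := hA.prodMk hA'
  refine (W2_le_of_coupling (P.map fun ω => (A ω, A' ω)) ?_ ?_).trans_eq ?_
  · rw [AEMeasurable.map_map_of_aemeasurable measurable_fst.aemeasurable hm]; rfl
  · rw [AEMeasurable.map_map_of_aemeasurable measurable_snd.aemeasurable hm]; rfl
  · rw [lintegral_map' (by fun_prop) hm]

lemma W2_comm_le (μ ν : Measure (E d)) : W2 μ ν ≤ W2 ν μ := by
  refine ENNReal.rpow_le_rpow (le_iInf₂ fun π hπ => ?_) (by norm_num)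
  refine (iInf₂_le (π.map Prod.swap) ?_).trans_eq ?_
  · constructor
    · rw [Measure.map_map measurable_fst measurable_swap]; exact hπ.2
    · rw [Measure.map_map measurable_snd measurable_swap]; exact hπ.1
  · rw [lintegral_map (by fun_prop) measurable_swap]
    refine lintegral_congr fun z => ?_
    simp only [Prod.fst_swap, Prod.snd_swap]
    rw [enorm_sub_rev]

lemma W2_comm (μ ν : Measure (E d)) : W2 μ ν = W2 ν μ :=
  le_antisymm (W2_comm_le μ ν) (W2_comm_le ν μ)

/-- Near-optimal couplings; the product coupling serves where the distance is infinite. -/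
lemma exists_coupling_le {μ ν : Measure (E d)} [IsProbabilityMeasure μ] [IsProbabilityMeasure ν]
    {c κ : ℝ≥0∞} (h : W2 μ ν ≤ c) (hκ : κ ≠ 0) :
    ∃ π : Measure (E d × E d), (π.map Prod.fst = μ ∧ π.map Prod.snd = ν) ∧
      ∫⁻ z, ‖z.1 - z.2‖ₑ ^ 2 ∂π ≤ c ^ 2 + κ := by
  by_cases hc : c = ⊤
  · refine ⟨μ.prod ν, ⟨Measure.fst_prod, Measure.snd_prod⟩, ?_⟩
    simp [hc]
  have h1 := ENNReal.pow_le_pow_left (n := 2) h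
  rw [W2, rpow_half_sq] at h1
  have h2 : c ^ 2 < c ^ 2 + κ := ENNReal.lt_add_right (ENNReal.pow_ne_top hc) hκ
  obtain ⟨π, hπ⟩ := iInf_lt_iff.1 (h1.trans_lt h2)
  obtain ⟨hm, hlt⟩ := iInf_lt_iff.1 hπ
  exact ⟨π, hm, hlt.le⟩

/-- Triangle inequality: glue near-optimal couplings along the middle marginal. -/
theorem W2_triangle (μ ν ρ : Measure (E d)) [IsProbabilityMeasure μ] [IsProbabilityMeasure ν]
    [IsProbabilityMeasure ρ] : W2 μ ρ ≤ W2 μ ν + W2 ν ρ := by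
  have key : ∀ κ : ℝ≥0∞, κ ≠ 0 →
      W2 μ ρ ≤ (W2 μ ν ^ 2 + κ) ^ (1 / 2 : ℝ) + (W2 ν ρ ^ 2 + κ) ^ (1 / 2 : ℝ) := by
    intro κ hκ
    obtain ⟨π₁, ⟨h11, h12⟩, h1⟩ := exists_coupling_le (W2_comm μ ν).ge hκ
    obtain ⟨π₂, ⟨h21, h22⟩, h2⟩ := exists_coupling_le (le_refl (W2 ν ρ)) hκ
    have : IsProbabilityMeasure π₁ := by
      have : IsProbabilityMeasure (π₁.map Prod.fst) := by rw [h11]; infer_instance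
      exact (Measure.isProbabilityMeasure_map_iff measurable_fst.aemeasurable).1 this
    have : IsProbabilityMeasure π₂ := by
      have : IsProbabilityMeasure (π₂.map Prod.fst) := by rw [h21]; infer_instance
      exact (Measure.isProbabilityMeasure_map_iff measurable_fst.aemeasurable).1 this
    have e1 : ν ⊗ₘ π₁.condKernel = π₁ := by
      conv_rhs => rw [← π₁.disintegrate π₁.condKernel]
      rw [Measure.fst, h11]
    have e2 : ν ⊗ₘ π₂.condKernel = π₂ := by
      conv_rhs => rw [← π₂.disintegrate π₂.condKernel]
      rw [Measure.fst, h21]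
    set Q : Measure (E d × (E d × E d)) := ν ⊗ₘ (π₁.condKernel ×ₖ π₂.condKernel)
    have m1 : Measurable fun p : E d × (E d × E d) => (p.1, p.2.1) := by fun_prop
    have m2 : Measurable fun p : E d × (E d × E d) => (p.1, p.2.2) := by fun_prop
    have q1 : Q.map (fun p => (p.1, p.2.1)) = π₁ := by
      rw [← e1, ← Kernel.fst_prod π₁.condKernel π₂.condKernel, Kernel.fst_eq,
        Measure.compProd_map measurable_fst]
      rfl
    have q2 : Q.map (fun p => (p.1, p.2.2)) = π₂ := by
      rw [← e2, ← Kernel.snd_prod π₁.condKernel π₂.condKernel, Kernel.snd_eq,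
        Measure.compProd_map measurable_snd]
      rfl
    have l1 : Q.map (fun p => p.2.1) = μ := by
      rw [← h12, ← q1, Measure.map_map measurable_snd m1]; rfl
    have l2 : Q.map (fun p => p.2.2) = ρ := by
      rw [← h22, ← q2, Measure.map_map measurable_snd m2]; rfl
    have hW := W2_map_le Q (A := fun p => p.2.1) (A' := fun p => p.2.2) (by fun_prop) (by fun_prop)
    rw [l1, l2, ← eLpNorm_two_eq (fun p : E d × (E d × E d) => p.2.1 - p.2.2)] at hW
    have hadd := eLpNorm_add_le (μ := Q) (p := 2)
      (f := fun p : E d × (E d × E d) => p.2.1 - p.1) (g := fun p => p.1 - p.2.2)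
      (by fun_prop) (by fun_prop) (by norm_num)
    have e : (fun p : E d × (E d × E d) => p.2.1 - p.1) + (fun p => p.1 - p.2.2) =
        fun p => p.2.1 - p.2.2 := by ext1 p; simp
    rw [e, eLpNorm_two_eq (fun p : E d × (E d × E d) => p.2.1 - p.1),
      eLpNorm_two_eq (fun p : E d × (E d × E d) => p.1 - p.2.2)] at hadd
    refine hW.trans (hadd.trans (add_le_add ?_ ?_)) <;>
      refine ENNReal.rpow_le_rpow ?_ (by norm_num)
    · refine le_trans (le_of_eq ?_) h1
      rw [← q1, lintegral_map (by fun_prop) m1]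
      refine lintegral_congr fun p => ?_
      rw [enorm_sub_rev]
    · refine le_trans (le_of_eq ?_) h2
      rw [← q2, lintegral_map (by fun_prop) m2]
  have hlim : Tendsto (fun κ : ℝ≥0∞ => (W2 μ ν ^ 2 + κ) ^ (1 / 2 : ℝ) +
      (W2 ν ρ ^ 2 + κ) ^ (1 / 2 : ℝ)) (𝓝[≠] 0) (𝓝 (W2 μ ν + W2 ν ρ)) := by
    have : Continuous fun κ : ℝ≥0∞ => (W2 μ ν ^ 2 + κ) ^ (1 / 2 : ℝ) +
        (W2 ν ρ ^ 2 + κ) ^ (1 / 2 : ℝ) :=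
      (ENNReal.continuous_rpow_const.comp (continuous_const.add continuous_id)).add
        (ENNReal.continuous_rpow_const.comp (continuous_const.add continuous_id))
    have h := (this.tendsto 0).mono_left (nhdsWithin_le_nhds (s := {0}ᶜ))
    simpa only [add_zero, sq_rpow_half] using h
  exact ge_of_tendsto hlim (eventually_nhdsWithin_of_forall fun κ hκ => key κ hκ)

/-- Convexity of the squared distance along countable mixtures. -/
lemma W2_sum_le (m : ℕ → ℝ≥0∞) (ν ν' : ℕ → Measure (E d)) [∀ n, IsProbabilityMeasure (ν n)]
    [∀ n, IsProbabilityMeasure (ν' n)] (c : ℕ → ℝ≥0∞) (h : ∀ n, W2 (ν n) (ν' n) ≤ c n)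
    {κ : ℝ≥0∞} (hκ : κ ≠ 0) :
    W2 (Measure.sum fun n => m n • ν n) (Measure.sum fun n => m n • ν' n) ≤
      (∑' n, m n * (c n ^ 2 + κ)) ^ (1 / 2 : ℝ) := by
  choose π hπ hle using fun n => exists_coupling_le (h n) hκ
  refine (W2_le_of_coupling (Measure.sum fun n => m n • π n) ?_ ?_).trans ?_
  · rw [Measure.map_sum measurable_fst.aemeasurable]
    simp only [Measure.map_smul, (hπ _).1]
  · rw [Measure.map_sum measurable_snd.aemeasurable]
    simp only [Measure.map_smul, (hπ _).2]
  · refine ENNReal.rpow_le_rpow ?_ (by norm_num)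
    rw [lintegral_sum_measure]
    refine ENNReal.tsum_le_tsum fun n => ?_
    rw [lintegral_smul_measure]
    exact mul_le_mul_right (hle n) _

/-- Two laws on a common finite set of atoms in the ball of radius `R`: keep the common mass in
place and couple the two remainders, of total mass `∑ j, (a j - b j)`, independently. -/
lemma W2_atoms_le {ι : Type*} [Fintype ι] (y : ι → E d) (a b : ι → ℝ≥0∞) {R : ℝ≥0∞}
    (hR : ∀ j, ‖y j‖ₑ ≤ R) (hab : ∑ j, a j = ∑ j, b j) (ha : ∑ j, a j ≠ ⊤) :
    W2 (Measure.sum fun j => a j • Measure.dirac (y j))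
      (Measure.sum fun j => b j • Measure.dirac (y j)) ≤
      ((2 * R) ^ 2 * ∑ j, (a j - b j)) ^ (1 / 2 : ℝ) := by
  set s := ∑ j, (a j - b j) with hs
  have hsb : ∑ j, (b j - a j) = s := by
    have e : ∑ j, a j + ∑ j, (b j - a j) = ∑ j, a j + s := by
      rw [hs]
      conv_rhs => rw [hab]
      rw [← Finset.sum_add_distrib, ← Finset.sum_add_distrib]
      refine Finset.sum_congr rfl fun j _ => ?_
      rw [add_tsub_eq_max, add_tsub_eq_max, max_comm]
    exact (ENNReal.add_right_inj ha).1 e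
  have hsa : s ≤ ∑ j, a j := Finset.sum_le_sum fun j _ => tsub_le_self
  have hst : s ≠ ⊤ := ne_top_of_le_ne_top ha hsa
  -- `s⁻¹ * s` is one unless the remainders vanish
  have hc : ∀ c : ℝ≥0∞, c ≤ s → c * (s⁻¹ * s) = c := by
    intro c hcs
    rcases eq_or_ne s 0 with h0 | h0
    · rw [h0] at hcs; simp [le_antisymm hcs zero_le]
    · rw [ENNReal.inv_mul_cancel h0 hst, mul_one]
  have hja : ∀ j, a j - b j ≤ s := fun j =>
    Finset.single_le_sum (f := fun j => a j - b j) (fun _ _ => zero_le) (Finset.mem_univ j)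
  have hjb : ∀ j, b j - a j ≤ s := fun j => hsb ▸
    Finset.single_le_sum (f := fun j => b j - a j) (fun _ _ => zero_le) (Finset.mem_univ j)
  let π : Measure (E d × E d) := Measure.sum (fun j => min (a j) (b j) • Measure.dirac (y j, y j)) +
    Measure.sum fun j => Measure.sum fun k =>
      ((a j - b j) * (s⁻¹ * (b k - a k))) • Measure.dirac (y j, y k)
  refine (W2_le_of_coupling π ?_ ?_).trans ?_
  · ext A hA
    rw [Measure.map_apply measurable_fst hA]
    have hA' : MeasurableSet (Prod.fst ⁻¹' A : Set (E d × E d)) := measurable_fst hA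
    simp only [π, Measure.add_apply, Measure.sum_apply _ hA, Measure.sum_apply _ hA',
      Measure.smul_apply, Measure.dirac_apply' _ hA, Measure.dirac_apply' _ hA', tsum_fintype,
      smul_eq_mul]
    rw [← Finset.sum_add_distrib]
    refine Finset.sum_congr rfl fun j _ => ?_
    have e : ∀ k, (Prod.fst ⁻¹' A : Set (E d × E d)).indicator (1 : E d × E d → ℝ≥0∞) (y j, y k) =
        A.indicator 1 (y j) := fun k => rfl
    simp only [e]
    rw [← Finset.sum_mul, ← Finset.mul_sum, ← Finset.mul_sum, hsb, hc _ (hja j), ← add_mul]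
    congr 1
    rw [add_comm, tsub_add_min]
  · ext A hA
    rw [Measure.map_apply measurable_snd hA]
    have hA' : MeasurableSet (Prod.snd ⁻¹' A : Set (E d × E d)) := measurable_snd hA
    simp only [π, Measure.add_apply, Measure.sum_apply _ hA, Measure.sum_apply _ hA',
      Measure.smul_apply, Measure.dirac_apply' _ hA, Measure.dirac_apply' _ hA', tsum_fintype,
      smul_eq_mul]
    rw [Finset.sum_comm, ← Finset.sum_add_distrib]
    refine Finset.sum_congr rfl fun j _ => ?_
    have e : ∀ k, (Prod.snd ⁻¹' A : Set (E d × E d)).indicator (1 : E d × E d → ℝ≥0∞) (y k, y j) =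
        A.indicator 1 (y j) := fun k => rfl
    simp only [e]
    rw [← Finset.sum_mul, ← Finset.sum_mul, ← hs, ← mul_assoc, mul_comm (s * s⁻¹), mul_comm s,
      hc _ (hjb j), ← add_mul]
    congr 1
    rw [add_comm, min_comm, tsub_add_min]
  · refine ENNReal.rpow_le_rpow ?_ (by norm_num)
    have hn : ∀ j k, ‖y j - y k‖ₑ ^ 2 ≤ (2 * R) ^ 2 := fun j k => by
      refine pow_le_pow_left' ((enorm_sub_le).trans ?_) 2
      rw [two_mul]
      exact add_le_add (hR j) (hR k)
    have hmeas : Measurable fun z : E d × E d => ‖z.1 - z.2‖ₑ ^ 2 := by fun_prop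
    simp only [π, lintegral_add_measure, lintegral_sum_measure, lintegral_smul_measure,
      lintegral_dirac' _ hmeas, tsum_fintype, sub_self, enorm_zero]
    simp only [ne_eq, OfNat.ofNat_ne_zero, not_false_eq_true, zero_pow, smul_eq_mul, mul_zero,
      Finset.sum_const_zero, zero_add]
    calc ∑ j, ∑ k, (a j - b j) * (s⁻¹ * (b k - a k)) * ‖y j - y k‖ₑ ^ 2
        ≤ ∑ j, ∑ k, (a j - b j) * (s⁻¹ * (b k - a k)) * (2 * R) ^ 2 :=
          Finset.sum_le_sum fun j _ => Finset.sum_le_sum fun k _ => mul_le_mul_right (hn j k) _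
      _ = (2 * R) ^ 2 * s := by
          simp only [← Finset.sum_mul, ← Finset.mul_sum]
          rw [hsb, ← hs, hc s le_rfl, mul_comm]

end Wasserstein

/-! ### Countable mixtures approximating a Markov kernel -/

section Quantization

lemma lintegral_comp_nat {A : Type*} [MeasurableSpace A] (μ : Measure A) {i : A → ℕ}
    (hi : Measurable i) (H : ℕ → ℝ≥0∞) :
    ∫⁻ x, H (i x) ∂μ = ∑' n, μ (i ⁻¹' {n}) * H n := by
  rw [← lintegral_map (f := H) (by fun_prop) hi, lintegral_countable']
  refine tsum_congr fun n => ?_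
  rw [Measure.map_apply hi (measurableSet_singleton n), mul_comm]

/-- A measurable map into a separable metric space is approximated uniformly by its values at
countably many points, and the approximating point can be chosen measurably. -/
lemma exists_countable_net {A S : Type*} [MeasurableSpace A] [Nonempty A] [PseudoMetricSpace S]
    [TopologicalSpace.SeparableSpace S] [MeasurableSpace S] [OpensMeasurableSpace S]
    {Φ : A → S} (hΦ : Measurable Φ) {δ : ℝ} (hδ : 0 < δ) :
    ∃ (i : A → ℕ) (r : ℕ → A), Measurable i ∧ ∀ x, dist (Φ (r (i x))) (Φ x) < δ := by
  classical
  have : Nonempty S := ⟨Φ (Classical.arbitrary A)⟩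
  let s := TopologicalSpace.denseSeq S
  have hex : ∀ x, ∃ n, dist (Φ x) (s n) < δ / 2 := fun x => by
    obtain ⟨n, hn⟩ :=
      (TopologicalSpace.denseRange_denseSeq S).exists_dist_lt (Φ x) (half_pos hδ)
    exact ⟨n, hn⟩
  let r : ℕ → A := fun n => if h : ∃ x, dist (Φ x) (s n) < δ / 2 then h.choose
    else Classical.arbitrary A
  refine ⟨fun x => Nat.find (hex x), r, measurable_find _ fun n => ?_, fun x => ?_⟩
  · exact (hΦ Metric.isOpen_ball.measurableSet : MeasurableSet (Φ ⁻¹' Metric.ball (s n) (δ / 2)))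
  · have h1 : dist (Φ x) (s (Nat.find (hex x))) < δ / 2 := Nat.find_spec (hex x)
    have h2 : ∃ x', dist (Φ x') (s (Nat.find (hex x))) < δ / 2 := ⟨x, h1⟩
    have h3 : dist (Φ (r (Nat.find (hex x)))) (s (Nat.find (hex x))) < δ / 2 := by
      simp only [r, dif_pos h2]
      exact h2.choose_spec
    calc _ ≤ _ := dist_triangle_right _ _ (s (Nat.find (hex x)))
      _ < δ / 2 + δ / 2 := add_lt_add h3 h1
      _ = δ := add_halves δ

variable {d : ℕ}

lemma map_simpleFunc_eq_sum (ν : Measure (E d)) [IsProbabilityMeasure ν]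
    (q : SimpleFunc (E d) (E d)) :
    ν.map q = Measure.sum fun j : q.range => ν (q ⁻¹' {(j : E d)}) • Measure.dirac (j : E d) := by
  rw [Measure.sum_fintype, (Measure.ae_mem_finset_iff_map_eq_sum_dirac (s := q.range)
    q.measurable.aemeasurable).1 (ae_of_all _ q.mem_range_self),
    ← Finset.sum_coe_sort q.range fun a => ν (q ⁻¹' {a}) • Measure.dirac a]

/-- A mixture of a Markov kernel is approximated by a countable mixture: the initial point `x` is
replaced by a nearby point `r (i x)`, chosen so that the function `ξ` does not increase by more than
`η`. Both laws are compared after rounding their samples to finitely many atoms; the points are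
chosen so that the atoms' weights under the kernel, and its rounding error, hardly change. -/
lemma exists_quantization (μ : Measure (E d)) [IsProbabilityMeasure μ] (Ψ : Kernel (E d) (E d))
    [IsMarkovKernel Ψ] (hm : MemLp id 2 (Ψ ∘ₘ μ)) {ξ : E d → ℝ≥0} (hξ : Measurable ξ) {η : ℝ}
    (hη : 0 < η) :
    ∃ (i : E d → ℕ) (r : ℕ → E d), Measurable i ∧ (∀ x, ‖r (i x) - x‖ ≤ η) ∧
      (∀ x, (ξ (r (i x)) : ℝ) ≤ ξ x + η) ∧
      IsProbabilityMeasure (Measure.sum fun n => μ (i ⁻¹' {n}) • Ψ (r n)) ∧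
      W2 (Ψ ∘ₘ μ) (Measure.sum fun n => μ (i ⁻¹' {n}) • Ψ (r n)) ≤ ENNReal.ofReal η := by
  classical
  set ν := Ψ ∘ₘ μ with hν
  set κ := η / 4 with hκ
  have hκ0 : 0 < κ := by positivity
  -- `q` rounds to finitely many atoms with small mean square error under the mixture; `F x` is its
  -- error under `Ψ x`, and the sets `D j` are its level sets
  obtain ⟨q, hq, -⟩ := hm.exists_simpleFunc_eLpNorm_sub_lt (by norm_num)
    (ε := ENNReal.ofReal κ) (by simpa using hκ0)
  have hqm := q.measurable
  set e : E d → ℝ≥0∞ := fun y => ‖y - q y‖ₑ ^ 2 with he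
  have hem : Measurable e := by fun_prop
  have hνe : ∫⁻ y, e y ∂ν ≤ ENNReal.ofReal κ ^ 2 := by
    rw [← eLpNorm_two_sq (fun y => y - q y) ν]
    exact ENNReal.pow_le_pow_left hq.le
  set F : E d → ℝ≥0∞ := fun x => ∫⁻ y, e y ∂(Ψ x) with hF
  have hFm : Measurable F := hem.lintegral_kernel
  have hFint : ∫⁻ x, F x ∂μ ≤ ENNReal.ofReal κ ^ 2 := by
    rwa [hν, Measure.lintegral_bind Ψ.aemeasurable hem.aemeasurable] at hνe
  have hFfin : ∀ᵐ x ∂μ, F x ≠ ⊤ := by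
    filter_upwards [ae_lt_top hFm (ne_top_of_le_ne_top (by simp) hFint)] with x hx using hx.ne
  set D : q.range → Set (E d) := fun j => q ⁻¹' {(j : E d)} with hD
  have hDm : ∀ j, MeasurableSet (D j) := fun j => q.measurableSet_preimage _
  obtain ⟨R, hR⟩ : ∃ R : ℝ≥0, ∀ j : q.range, ‖(j : E d)‖ₑ ≤ R := by
    refine ⟨∑ j : q.range, ‖(j : E d)‖₊, fun j => ?_⟩
    rw [enorm_eq_nnnorm, ENNReal.coe_le_coe]
    exact Finset.single_le_sum (f := fun j : q.range => ‖(j : E d)‖₊) (fun _ _ => zero_le)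
      (Finset.mem_univ j)
  set C : ℝ := (2 * R) ^ 2 * Fintype.card q.range with hC
  have hC0 : 0 ≤ C := by positivity
  -- `C * δ` bounds the squared distance of the rounded laws once each weight moves by at most `δ`
  obtain ⟨δ, hδ0, hδη, hδ1, hδκ, hδC⟩ : ∃ δ : ℝ, 0 < δ ∧ δ ≤ η ∧ δ ≤ 1 ∧ δ ≤ κ ^ 2 ∧
      C * δ ≤ κ ^ 2 := by
    refine ⟨min (min η 1) (κ ^ 2 / (C + 1)), by positivity,
      (min_le_left _ _).trans (min_le_left _ _),
      (min_le_left _ _).trans (min_le_right _ _), (min_le_right _ _).trans ?_, ?_⟩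
    · exact div_le_self (by positivity) (by linarith)
    · calc _ ≤ C * (κ ^ 2 / (C + 1)) := mul_le_mul_of_nonneg_left (min_le_right _ _) hC0
        _ ≤ κ ^ 2 := by
          rw [mul_div_assoc', div_le_iff₀ (by positivity)]
          nlinarith [sq_nonneg κ]
  -- the value `-1` marks an infinite rounding error; it is at distance at least `1 ≥ δ` from finite ones
  set G : E d → ℝ := fun x => if F x = ⊤ then -1 else (F x).toReal with hG
  have hGm : Measurable G := Measurable.ite (hFm (measurableSet_singleton _)) measurable_const
    hFm.ennreal_toReal
  -- a countable net for all the quantities that have to be kept nearly constant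
  set Φ : E d → E d × ℝ × ℝ × (q.range → ℝ) :=
    fun x => (x, (ξ x : ℝ), G x, fun j => (Ψ x (D j)).toReal) with hΦ
  have hΦm : Measurable Φ := by
    refine measurable_id.prodMk (hξ.coe_nnreal_real.prodMk (hGm.prodMk ?_))
    exact measurable_pi_lambda _ fun j => (Ψ.measurable_coe (hDm j)).ennreal_toReal
  obtain ⟨i, r, hi, hir⟩ := exists_countable_net hΦm hδ0
  have hir1 : ∀ x, dist (r (i x)) x < δ := fun x => (le_max_left _ _).trans_lt (hir x)
  have hir' : ∀ x, dist (Φ (r (i x))).2 (Φ x).2 < δ := fun x => (le_max_right _ _).trans_lt (hir x)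
  have hir2 : ∀ x, dist (ξ (r (i x)) : ℝ) (ξ x) < δ := fun x => (le_max_left _ _).trans_lt (hir' x)
  have hir'' : ∀ x, dist (Φ (r (i x))).2.2 (Φ x).2.2 < δ :=
    fun x => (le_max_right _ _).trans_lt (hir' x)
  have hir3 : ∀ x, dist (G (r (i x))) (G x) < δ := fun x => (le_max_left _ _).trans_lt (hir'' x)
  have hir4 : ∀ x j, dist (Ψ (r (i x)) (D j)).toReal (Ψ x (D j)).toReal < δ := fun x j =>
    (dist_le_pi_dist (fun j => (Ψ (r (i x)) (D j)).toReal) (fun j => (Ψ x (D j)).toReal) j).trans_lt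
      ((le_max_right _ _).trans_lt (hir'' x))
  have hFr : ∀ x, F x ≠ ⊤ → F (r (i x)) ≤ F x + ENNReal.ofReal δ := by
    intro x hx
    have h := abs_lt.1 (hir3 x)
    have hGx : G x = (F x).toReal := if_neg hx
    have hrx : F (r (i x)) ≠ ⊤ := by
      intro hc
      have : G (r (i x)) = -1 := if_pos hc
      rw [this, hGx] at h
      have := ENNReal.toReal_nonneg (a := F x)
      linarith [h.1]
    have hGr : G (r (i x)) = (F (r (i x))).toReal := if_neg hrx
    rw [hGx, hGr] at h
    rw [← ENNReal.ofReal_toReal hrx, ← ENNReal.ofReal_toReal hx,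
      ← ENNReal.ofReal_add ENNReal.toReal_nonneg hδ0.le]
    exact ENNReal.ofReal_le_ofReal (by linarith [h.2])
  have hΨr : ∀ x j, Ψ x (D j) ≤ Ψ (r (i x)) (D j) + ENNReal.ofReal δ := by
    intro x j
    have h := abs_lt.1 (hir4 x j)
    rw [← ENNReal.ofReal_toReal (measure_ne_top (Ψ x) (D j)),
      ← ENNReal.ofReal_toReal (measure_ne_top (Ψ (r (i x))) (D j)),
      ← ENNReal.ofReal_add ENNReal.toReal_nonneg hδ0.le]
    exact ENNReal.ofReal_le_ofReal (by linarith [h.1])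
  set ν' := Measure.sum fun n => μ (i ⁻¹' {n}) • Ψ (r n) with hν'
  have hν'int : ∀ H : E d → ℝ≥0∞, ∫⁻ y, H y ∂ν' = ∫⁻ x, ∫⁻ y, H y ∂(Ψ (r (i x))) ∂μ := by
    intro H
    rw [lintegral_comp_nat μ hi fun n => ∫⁻ y, H y ∂(Ψ (r n)), hν', lintegral_sum_measure]
    simp only [lintegral_smul_measure, smul_eq_mul]
  have hν'set : ∀ A, MeasurableSet A → ν' A = ∫⁻ x, Ψ (r (i x)) A ∂μ := by
    intro A hA
    rw [← lintegral_indicator_one hA, hν'int]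
    simp only [lintegral_indicator_one hA]
  have hν'p : IsProbabilityMeasure ν' := ⟨by rw [hν'set _ MeasurableSet.univ]; simp⟩
  refine ⟨i, r, hi, fun x => ?_, fun x => ?_, hν'p, ?_⟩
  · rw [← dist_eq_norm]; exact (hir1 x).le.trans hδη
  · have := (abs_lt.1 (hir2 x)).2; linarith
  have : IsProbabilityMeasure (ν.map q) := Measure.isProbabilityMeasure_map hqm.aemeasurable
  have : IsProbabilityMeasure (ν'.map q) := Measure.isProbabilityMeasure_map hqm.aemeasurable
  have w1 : W2 ν (ν.map q) ≤ ENNReal.ofReal κ := by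
    have h := W2_map_le ν (A := id) (A' := q) (by fun_prop) (by fun_prop)
    rw [Measure.map_id] at h
    refine h.trans ((ENNReal.rpow_le_rpow hνe (by norm_num)).trans_eq (sq_rpow_half _))
  have w3 : W2 (ν'.map q) ν' ≤ ENNReal.ofReal (2 * κ) := by
    have h := W2_map_le ν' (A := id) (A' := q) (by fun_prop) (by fun_prop)
    rw [Measure.map_id, W2_comm] at h
    refine h.trans ?_
    rw [← sq_rpow_half (ENNReal.ofReal (2 * κ))]
    refine ENNReal.rpow_le_rpow ?_ (by norm_num)
    calc ∫⁻ y, ‖id y - q y‖ₑ ^ 2 ∂ν' = ∫⁻ x, F (r (i x)) ∂μ := hν'int e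
      _ ≤ ∫⁻ x, (F x + ENNReal.ofReal δ) ∂μ := by
        refine lintegral_mono_ae ?_
        filter_upwards [hFfin] with x hx using hFr x hx
      _ = ∫⁻ x, F x ∂μ + ENNReal.ofReal δ := by rw [lintegral_add_right _ measurable_const]; simp
      _ ≤ ENNReal.ofReal κ ^ 2 + ENNReal.ofReal δ := by gcongr
      _ ≤ ENNReal.ofReal (2 * κ) ^ 2 := by
        rw [← ENNReal.ofReal_pow hκ0.le, ← ENNReal.ofReal_pow (by positivity),
          ← ENNReal.ofReal_add (by positivity) hδ0.le]
        exact ENNReal.ofReal_le_ofReal (by nlinarith)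
  have w2 : W2 (ν.map q) (ν'.map q) ≤ ENNReal.ofReal κ := by
    have hs : ∀ (ρ : Measure (E d)) [IsProbabilityMeasure ρ], ∑ j, ρ (D j) = 1 := by
      intro ρ _
      have : IsProbabilityMeasure (ρ.map q) := Measure.isProbabilityMeasure_map hqm.aemeasurable
      have h1 : ρ.map q univ = 1 := measure_univ
      rw [map_simpleFunc_eq_sum] at h1
      simpa [Measure.sum_apply _ MeasurableSet.univ, tsum_fintype] using h1
    rw [map_simpleFunc_eq_sum ν, map_simpleFunc_eq_sum ν']
    refine (W2_atoms_le (fun j : q.range => (j : E d)) (fun j => ν (D j)) (fun j => ν' (D j)) hR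
      ((hs ν).trans (hs ν').symm) (by rw [hs ν]; simp)).trans ?_
    rw [← sq_rpow_half (ENNReal.ofReal κ)]
    refine ENNReal.rpow_le_rpow ?_ (by norm_num)
    have hj : ∀ j, ν (D j) - ν' (D j) ≤ ENNReal.ofReal δ := by
      intro j
      rw [tsub_le_iff_left, hν, Measure.bind_apply (hDm j) Ψ.aemeasurable, hν'set _ (hDm j)]
      calc ∫⁻ x, Ψ x (D j) ∂μ ≤ ∫⁻ x, (Ψ (r (i x)) (D j) + ENNReal.ofReal δ) ∂μ :=
            lintegral_mono fun x => hΨr x j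
        _ = _ := by rw [lintegral_add_right _ measurable_const]; simp
    calc (2 * (R : ℝ≥0∞)) ^ 2 * ∑ j, (ν (D j) - ν' (D j))
        ≤ (2 * (R : ℝ≥0∞)) ^ 2 * ∑ j : q.range, ENNReal.ofReal δ :=
          mul_le_mul_right (Finset.sum_le_sum fun j _ => hj j) _
      _ = ENNReal.ofReal (C * δ) := by
          rw [Finset.sum_const, Finset.card_univ, nsmul_eq_mul, ← mul_assoc,
            ENNReal.ofReal_mul hC0, hC, ENNReal.ofReal_mul (by positivity),
            ENNReal.ofReal_pow (by positivity), ENNReal.ofReal_mul (by norm_num)]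
          simp
      _ ≤ ENNReal.ofReal κ ^ 2 := by
          rw [← ENNReal.ofReal_pow hκ0.le]
          exact ENNReal.ofReal_le_ofReal hδC
  calc W2 ν ν' ≤ W2 ν (ν.map q) + W2 (ν.map q) ν' := W2_triangle _ _ _
    _ ≤ W2 ν (ν.map q) + (W2 (ν.map q) (ν'.map q) + W2 (ν'.map q) ν') := by
      gcongr; exact W2_triangle _ _ _
    _ ≤ ENNReal.ofReal κ + (ENNReal.ofReal κ + ENNReal.ofReal (2 * κ)) := by gcongr
    _ = ENNReal.ofReal η := by
      rw [← ENNReal.ofReal_add hκ0.le (by positivity), ← ENNReal.ofReal_add hκ0.le (by positivity)]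
      congr 1
      rw [hκ]; ring

end Quantization

/-! ### One step of the sampler -/

section OneStep

lemma lintegral_add_sq_rpow_le {A : Type*} [MeasurableSpace A] {μ : Measure A} {p q : A → ℝ≥0∞}
    (hp : AEMeasurable p μ) (hq : AEMeasurable q μ) :
    (∫⁻ x, (p x + q x) ^ 2 ∂μ) ^ (1 / 2 : ℝ) ≤
      (∫⁻ x, p x ^ 2 ∂μ) ^ (1 / 2 : ℝ) + (∫⁻ x, q x ^ 2 ∂μ) ^ (1 / 2 : ℝ) := by
  simpa using ENNReal.lintegral_Lp_add_le hp hq (p := 2) (by norm_num)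

lemma add_sq_rpow_half_le (a b : ℝ≥0∞) : (a ^ 2 + b ^ 2) ^ (1 / 2 : ℝ) ≤ a + b := by
  rw [← sq_rpow_half (a + b)]
  refine ENNReal.rpow_le_rpow ?_ (by norm_num)
  calc a ^ 2 + b ^ 2 ≤ a ^ 2 + b ^ 2 + 2 * a * b := le_self_add
    _ = (a + b) ^ 2 := by ring

variable {d : ℕ} {Ω : Type*} {mΩ : MeasurableSpace Ω} {P : Measure Ω}

lemma IsSolution.mono_right {𝓖 : ℝ → MeasurableSpace Ω} {B : ℝ → Ω → E d} {b : ℝ → E d → E d}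
    {σ : ℝ → ℝ} {u v w : ℝ} {x : Ω → E d} {Y : ℝ → Ω → E d} (h : IsSolution 𝓖 B P b σ u w x Y)
    (huv : u ≤ v) (hvw : v ≤ w) : IsSolution 𝓖 B P b σ u v x Y where
  adapted t ht := h.adapted t ⟨ht.1, ht.2.trans hvw⟩
  init := h.init
  cont := h.cont.mono fun _ hω => hω.mono (Icc_subset_Icc_right hvw)
  drift_integrable := h.drift_integrable.mono fun _ hω => hω.mono_set (by
    rw [uIcc_of_le huv, uIcc_of_le (huv.trans hvw)]; exact Icc_subset_Icc_right hvw)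
  eq t ht := h.eq t ⟨ht.1, ht.2.trans hvw⟩

/-- Under strong well-posedness the transition law is the law of a strong solution. -/
lemma StronglyWellPosed.exists_transitionLaw_eq [IsProbabilityMeasure P] {F : Filtration ℝ mΩ}
    {B : ℝ → Ω → E d} {b : ℝ → E d → E d} {σ : ℝ → ℝ} {u v w : ℝ}
    (h : StronglyWellPosed F B P b σ u w) (huv : u ≤ v) (hvw : v ≤ w) (x : E d) :
    ∃ Y : ℝ → Ω → E d, IsStrongSolution B P b σ u v (fun _ => x) Y ∧
      transitionLaw B P b σ u v x = P.map (Y v) := by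
  obtain ⟨⟨Y₀, hY₀⟩, -⟩ := h (fun _ => x) measurable_const (integrable_const x)
  have hex : ∃ Y : ℝ → Ω → E d, IsStrongSolution B P b σ u v (fun _ => x) Y :=
    ⟨Y₀, IsSolution.mono_right hY₀ huv hvw⟩
  exact ⟨hex.choose, hex.choose_spec, by rw [transitionLaw, dif_pos hex]⟩

variable [IsProbabilityMeasure P] {T : ℝ} {f g : ℝ → ℝ} {V₀ : E d → ℝ} {sθ : ℝ → E d → E d}
    {α M : ℝ} {ε ℓ : ℝ → ℝ} {F : Filtration ℝ mΩ} {B : ℝ → Ω → E d} {X : ℝ → Ω → E d}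

/-- Propagation of a coupling `π` of `μ` with the current ideal marginal. The coupling is realised
next to the ideal trajectory by an extra coordinate `z` of conditional law `π(· | X_u)`; the learned
solution is started from the rounded point `r (i z)`, and its law is the mixture of the transition
laws because the noise after time `u` is independent of `X_u`. -/
lemma Setting.W2_mixture_le (h : Setting T f g V₀ sθ α M ε ℓ) (hB : IsBrownianMotion F B P)
    (hX : IsSolution F B P (reverseDrift f g T (score f g V₀)) (fun t => g (T - t)) 0 T (X 0) X)
    (hX_law : ∀ t ∈ Icc 0 T, P.map (X t) = forwardMarginal f g V₀ (T - t))
    {u v : ℝ} (hu : 0 ≤ u) (huv : u ≤ v) (hv : v ≤ T) {μ : Measure (E d)} {i : E d → ℕ}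
    (hi : Measurable i) {r : ℕ → E d} {δ : ℝ} (hδ : ∀ x, ‖r (i x) - x‖ ≤ δ)
    {Y : ℕ → ℝ → Ω → E d} (hY : ∀ n, IsStrongSolution B P (reverseDrift f g T sθ)
      (fun t => g (T - t)) u v (fun _ => r n) (Y n))
    {π : Measure (E d × E d)} (hπ₁ : π.map Prod.fst = μ)
    (hπ₂ : π.map Prod.snd = forwardMarginal f g V₀ (T - u)) :
    W2 (Measure.sum fun n => μ (i ⁻¹' {n}) • P.map (Y n v)) (forwardMarginal f g V₀ (T - v)) ≤
      ENNReal.ofReal (Real.exp (Gam f g α M ℓ (T - u) - Gam f g α M ℓ (T - v))) *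
          ((∫⁻ z, ‖z.1 - z.2‖ₑ ^ 2 ∂π) ^ (1 / 2 : ℝ) + ENNReal.ofReal δ) +
        ENNReal.ofReal (Real.exp (-Gam f g α M ℓ (T - v)) *
          ∫ s in (T - v)..(T - u), Real.exp (Gam f g α M ℓ s) * g s ^ 2 * ε s) := by
  have hv0 : 0 ≤ v := hu.trans huv
  have hXu : Measurable[F u] (X u) := hX.adapted u ⟨hu, huv.trans hv⟩
  have hXum : Measurable (X u) := hXu.mono (F.le u) le_rfl
  have hXv : Measurable (X v) := (hX.adapted v ⟨hv0, hv⟩).mono (F.le v) le_rfl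
  rw [← hX_law u ⟨hu, huv.trans hv⟩] at hπ₂
  rw [← hX_law v ⟨hv0, hv⟩]
  obtain ⟨R, hRm, hR, hbound⟩ := h.exists_error_bound hB hX hX_law hu huv hv
  set A := ENNReal.ofReal (Real.exp (Gam f g α M ℓ (T - u) - Gam f g α M ℓ (T - v))) with hA
  have hπp : IsProbabilityMeasure π := by
    have : IsProbabilityMeasure (π.map Prod.snd) := by
      rw [hπ₂]; exact Measure.isProbabilityMeasure_map hXum.aemeasurable
    exact (Measure.isProbabilityMeasure_map_iff measurable_snd.aemeasurable).1 this
  set π' := π.map Prod.swap with hπ'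
  have hπ'p : IsProbabilityMeasure π' := Measure.isProbabilityMeasure_map (by fun_prop)
  have hfst : π'.fst = P.map (X u) := by
    rw [← hπ₂, Measure.fst, hπ', Measure.map_map measurable_fst measurable_swap]; rfl
  set κ := π'.condKernel with hκ
  have hdis : P.map (X u) ⊗ₘ κ = π' := by
    rw [← hfst]; exact π'.disintegrate κ
  -- the pair `(p.2, X u p.1)` has law `π` under `Q`
  set Q : Measure (Ω × E d) := P ⊗ₘ κ.comap (X u) hXum with hQ
  have hQfst : Q.map Prod.fst = P := Measure.fst_compProd P _
  have hQint : ∀ H : E d × E d → ℝ≥0∞, Measurable H →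
      ∫⁻ p, H (p.2, X u p.1) ∂Q = ∫⁻ z, H z ∂π := by
    intro H hH
    have e1 : ∫⁻ z, H z ∂π = ∫⁻ z, H z.swap ∂π' := by
      rw [hπ', lintegral_map (by fun_prop) measurable_swap]; simp
    have hH1 : Measurable fun p : Ω × E d => H (p.2, X u p.1) :=
      hH.comp (measurable_snd.prodMk (hXum.comp measurable_fst))
    have hH2 : Measurable fun z : E d × E d => H z.swap := hH.comp measurable_swap
    rw [e1, ← hdis, Measure.lintegral_compProd hH2, hQ, Measure.lintegral_compProd hH1,
      lintegral_map _ hXum]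
    · simp
    · exact Measurable.lintegral_kernel_prod_right' (κ := κ) (f := fun z => H z.swap) hH2
  have hYm : ∀ n, Measurable[inputSigma B P u (fun _ => r n) v] (Y n v) := fun n =>
    (hY n).adapted v ⟨huv, le_rfl⟩
  have hYm' : ∀ n, Measurable (Y n v) := fun n =>
    (hYm n).mono (hB.inputSigma_le hu (r n) v) le_rfl
  have hY'm : Measurable fun p : Ω × E d => Y (i p.2) v p.1 := by
    have h1 : Measurable fun p : Ω × ℕ => Y p.2 v p.1 := measurable_from_prod_countable_left hYm'
    exact h1.comp (measurable_fst.prodMk (hi.comp measurable_snd))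
  have hlawX : Q.map (fun p => X v p.1) = P.map (X v) := by
    conv_rhs => rw [← hQfst]
    rw [Measure.map_map hXv measurable_fst]; rfl
  -- the cell of `p.2` depends on `ω` only through `X u ω`, hence is independent of `Y n v`
  have hlawY : Q.map (fun p => Y (i p.2) v p.1) =
      Measure.sum fun n => μ (i ⁻¹' {n}) • P.map (Y n v) := by
    ext S hS
    have hin : ∀ n, MeasurableSet (i ⁻¹' {n}) := fun n => hi (measurableSet_singleton n)
    have hmass : ∀ n, ∫⁻ ω, κ (X u ω) (i ⁻¹' {n}) ∂P = μ (i ⁻¹' {n}) := by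
      intro n
      have := hQint (fun z => (i ⁻¹' {n}).indicator 1 z.1)
        ((measurable_one.indicator (hin n)).comp measurable_fst)
      have hm2 : Measurable fun p : Ω × E d =>
          (i ⁻¹' {n}).indicator (1 : E d → ℝ≥0∞) (p.2, X u p.1).1 :=
        (measurable_one.indicator (hin n)).comp measurable_snd
      rw [hQ, Measure.lintegral_compProd hm2] at this
      simp only [Kernel.comap_apply, lintegral_indicator_one (hin n)] at this
      rw [this, ← hπ₁, ← lintegral_indicator_one (hin n), lintegral_map
        (measurable_one.indicator (hin n)) measurable_fst]
    rw [Measure.map_apply hY'm hS, Measure.sum_apply _ hS, hQ,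
      Measure.compProd_apply (hY'm hS)]
    have e1 : ∀ ω, (κ.comap (X u) hXum) ω
        (Prod.mk ω ⁻¹' ((fun p : Ω × E d => Y (i p.2) v p.1) ⁻¹' S))
        = ∑' n, (Y n v ⁻¹' S).indicator 1 ω * κ (X u ω) (i ⁻¹' {n}) := by
      intro ω
      rw [Kernel.comap_apply]
      have hm : MeasurableSet (Prod.mk ω ⁻¹' ((fun p : Ω × E d => Y (i p.2) v p.1) ⁻¹' S)) :=
        measurable_prodMk_left (hY'm hS)
      rw [← lintegral_indicator_one hm]
      have e2 : ∀ z, (Prod.mk ω ⁻¹' ((fun p : Ω × E d => Y (i p.2) v p.1) ⁻¹' S)).indicator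
          (1 : E d → ℝ≥0∞) z = (fun n => (Y n v ⁻¹' S).indicator (1 : Ω → ℝ≥0∞) ω) (i z) :=
        fun z => rfl
      simp only [e2]
      rw [lintegral_comp_nat _ hi fun n => (Y n v ⁻¹' S).indicator (1 : Ω → ℝ≥0∞) ω]
      exact tsum_congr fun n => mul_comm _ _
    simp only [e1]
    have hm3 : ∀ n, AEMeasurable (fun ω => (Y n v ⁻¹' S).indicator (1 : Ω → ℝ≥0∞) ω *
        κ (X u ω) (i ⁻¹' {n})) P := fun n => ((measurable_one.indicator (hYm' n hS)).mul
      ((κ.measurable_coe (hin n)).comp hXum)).aemeasurable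
    rw [lintegral_tsum hm3]
    refine tsum_congr fun n => ?_
    have hind := lintegral_mul_eq_lintegral_mul_lintegral_of_independent_measurableSpace
      (hB.inputSigma_le hu (r n) v) (F.le u) (hB.indep_inputSigma hu (r n) v)
      (f := (Y n v ⁻¹' S).indicator 1) (g := fun ω => κ (X u ω) (i ⁻¹' {n}))
      (Measurable.indicator measurable_const (hYm n hS)) ((κ.measurable_coe (hin n)).comp hXu)
    rw [hind, hmass, lintegral_indicator_one (hYm' n hS), Measure.smul_apply,
      Measure.map_apply (hYm' n) hS, smul_eq_mul, mul_comm]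
  have hae : ∀ᵐ p ∂Q, ‖Y (i p.2) v p.1 - X v p.1‖ₑ ≤
      A * (‖p.2 - X u p.1‖ₑ + ENNReal.ofReal δ) + R p.1 := by
    have h1 : ∀ᵐ ω ∂P, ∀ n, ‖Y n v ω - X v ω‖ₑ ≤ A * ‖r n - X u ω‖ₑ + R ω := ae_all_iff.2 fun n =>
      hbound (inputSigma B P u fun _ => r n) (hB.inputSigma_le hu (r n)) _ (Y n) (hY n)
    rw [← hQfst] at h1
    filter_upwards [ae_of_ae_map measurable_fst.aemeasurable h1] with p hp
    refine (hp (i p.2)).trans ?_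
    gcongr
    rw [add_comm]
    calc ‖r (i p.2) - X u p.1‖ₑ = ‖(r (i p.2) - p.2) + (p.2 - X u p.1)‖ₑ := by congr 1; abel
      _ ≤ ‖r (i p.2) - p.2‖ₑ + ‖p.2 - X u p.1‖ₑ := enorm_add_le _ _
      _ ≤ _ := by
        gcongr
        rw [← ofReal_norm]
        exact ENNReal.ofReal_le_ofReal (hδ _)
  have hW := W2_map_le Q hY'm.aemeasurable (hXv.comp measurable_fst).aemeasurable
  simp only [Function.comp_def] at hW
  rw [hlawX, hlawY] at hW
  have hm1 : Measurable fun p : Ω × E d => ‖p.2 - X u p.1‖ₑ :=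
    (measurable_snd.sub (hXum.comp measurable_fst)).enorm
  have hQp : IsProbabilityMeasure Q := by rw [hQ]; infer_instance
  calc _ ≤ _ := hW
    _ ≤ (∫⁻ p, (A * (‖p.2 - X u p.1‖ₑ + ENNReal.ofReal δ) + R p.1) ^ 2 ∂Q) ^ (1 / 2 : ℝ) := by
      refine ENNReal.rpow_le_rpow (lintegral_mono_ae ?_) (by norm_num)
      filter_upwards [hae] with p hp using pow_le_pow_left' hp 2
    _ ≤ (∫⁻ p, (A * (‖p.2 - X u p.1‖ₑ + ENNReal.ofReal δ)) ^ 2 ∂Q) ^ (1 / 2 : ℝ) +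
        (∫⁻ p, R p.1 ^ 2 ∂Q) ^ (1 / 2 : ℝ) :=
      lintegral_add_sq_rpow_le ((hm1.add_const _).const_mul _).aemeasurable
        (hRm.comp measurable_fst).aemeasurable
    _ ≤ _ := by
      refine add_le_add ?_ ?_
      · simp_rw [mul_pow]
        rw [lintegral_const_mul _ ((hm1.add_const _).pow_const 2),
          ENNReal.mul_rpow_of_nonneg _ _ (by norm_num), sq_rpow_half]
        gcongr
        refine (lintegral_add_sq_rpow_le hm1.aemeasurable aemeasurable_const).trans ?_
        rw [hQint (fun z => ‖z.1 - z.2‖ₑ ^ 2) (by fun_prop), lintegral_const, measure_univ, mul_one,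
          sq_rpow_half]
      · refine le_trans (le_of_eq ?_) hR
        rw [← lintegral_map (f := fun ω => R ω ^ 2) (by fun_prop) measurable_fst, hQfst]

/-- One step of the sampler against one step of the ideal reverse flow. The law after the step is
compared in turn with its quantization, with the mixture of transition laws from the same points
(at cost `ξ`), and with the ideal marginal (`W2_mixture_le`). Quantization makes measurability of
the transition laws in the initial point, and of their optimal couplings, unnecessary. -/
theorem Setting.W2_step_le (h : Setting T f g V₀ sθ α M ε ℓ) (hB : IsBrownianMotion F B P)
    (hX : IsSolution F B P (reverseDrift f g T (score f g V₀)) (fun t => g (T - t)) 0 T (X 0) X)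
    (hX_law : ∀ t ∈ Icc 0 T, P.map (X t) = forwardMarginal f g V₀ (T - t))
    {u v : ℝ} (hu : 0 ≤ u) (huv : u ≤ v) (hv : v ≤ T)
    (hwp : StronglyWellPosed F B P (reverseDrift f g T sθ) (fun t => g (T - t)) u T)
    (μ : Measure (E d)) [IsProbabilityMeasure μ] (Ψ : Kernel (E d) (E d)) [IsMarkovKernel Ψ]
    (hm : MemLp id 2 (Ψ ∘ₘ μ)) {ξ : E d → ℝ≥0} (hξ : Measurable ξ)
    (hξW : ∀ x, W2 (transitionLaw B P (reverseDrift f g T sθ) (fun t => g (T - t)) u v x) (Ψ x) ≤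
      (ξ x : ℝ≥0∞)) :
    W2 (Ψ ∘ₘ μ) (forwardMarginal f g V₀ (T - v)) ≤
      (∫⁻ x, (ξ x : ℝ≥0∞) ^ 2 ∂μ) ^ (1 / 2 : ℝ) +
      ENNReal.ofReal (Real.exp (Gam f g α M ℓ (T - u) - Gam f g α M ℓ (T - v))) *
          W2 μ (forwardMarginal f g V₀ (T - u)) +
      ENNReal.ofReal (Real.exp (-Gam f g α M ℓ (T - v)) *
          ∫ s in (T - v)..(T - u), Real.exp (Gam f g α M ℓ s) * g s ^ 2 * ε s) := by
  have hfm : ∀ t ∈ Icc 0 T, IsProbabilityMeasure (forwardMarginal f g V₀ (T - t)) := fun t ht => by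
    rw [← hX_law t ht]
    exact Measure.isProbabilityMeasure_map ((hX.adapted t ht).mono (F.le t) le_rfl).aemeasurable
  have hp1 := hfm u ⟨hu, huv.trans hv⟩
  have hp2 := hfm v ⟨hu.trans huv, hv⟩
  set a : ℝ := Real.exp (Gam f g α M ℓ (T - u) - Gam f g α M ℓ (T - v)) with ha
  have ha0 : 0 < a := Real.exp_pos _
  set I := ENNReal.ofReal (Real.exp (-Gam f g α M ℓ (T - v)) *
          ∫ s in (T - v)..(T - u), Real.exp (Gam f g α M ℓ s) * g s ^ 2 * ε s) with hI
  choose Y hY hYlaw using fun x => hwp.exists_transitionLaw_eq huv hv x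
  have key : ∀ η : ℝ, 0 < η → W2 (Ψ ∘ₘ μ) (forwardMarginal f g V₀ (T - v)) ≤
      ENNReal.ofReal η + ((∫⁻ x, (ξ x : ℝ≥0∞) ^ 2 ∂μ) ^ (1 / 2 : ℝ) + ENNReal.ofReal η +
        ENNReal.ofReal η) + (ENNReal.ofReal a * (W2 μ (forwardMarginal f g V₀ (T - u)) +
          ENNReal.ofReal η + ENNReal.ofReal η) + I) := by
    intro η hη
    have hη0 : ENNReal.ofReal η ^ 2 ≠ 0 := by simpa using hη
    obtain ⟨i, r, hi, hir, hiξ, hp3, hW⟩ := exists_quantization μ Ψ hm hξ hη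
    have hYp : ∀ n, IsProbabilityMeasure (P.map (Y (r n) v)) := fun n =>
      Measure.isProbabilityMeasure_map (((hY (r n)).adapted v ⟨huv, le_rfl⟩).mono
        (hB.inputSigma_le hu (r n) v) le_rfl).aemeasurable
    have hp4 : IsProbabilityMeasure (Measure.sum fun n => μ (i ⁻¹' {n}) • P.map (Y (r n) v)) := by
      constructor
      have := lintegral_comp_nat μ hi fun _ => 1
      simpa [Measure.sum_apply _ MeasurableSet.univ] using this.symm
    have w1 : W2 (Measure.sum fun n => μ (i ⁻¹' {n}) • Ψ (r n))
        (Measure.sum fun n => μ (i ⁻¹' {n}) • P.map (Y (r n) v)) ≤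
        (∫⁻ x, (ξ x : ℝ≥0∞) ^ 2 ∂μ) ^ (1 / 2 : ℝ) + ENNReal.ofReal η + ENNReal.ofReal η := by
      rw [W2_comm]
      refine (W2_sum_le (fun n => μ (i ⁻¹' {n})) (fun n => P.map (Y (r n) v)) (fun n => Ψ (r n))
        (fun n => ξ (r n)) (fun n => hYlaw (r n) ▸ hξW (r n)) hη0).trans ?_
      rw [← lintegral_comp_nat μ hi fun n => (ξ (r n) : ℝ≥0∞) ^ 2 + ENNReal.ofReal η ^ 2,
        lintegral_add_right _ measurable_const, lintegral_const, measure_univ, mul_one]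
      calc _ = (((∫⁻ x, (ξ (r (i x)) : ℝ≥0∞) ^ 2 ∂μ) ^ (1 / 2 : ℝ)) ^ 2 +
            ENNReal.ofReal η ^ 2) ^ (1 / 2 : ℝ) := by rw [rpow_half_sq]
        _ ≤ (∫⁻ x, (ξ (r (i x)) : ℝ≥0∞) ^ 2 ∂μ) ^ (1 / 2 : ℝ) + ENNReal.ofReal η :=
          add_sq_rpow_half_le _ _
        _ ≤ (∫⁻ x, ((ξ x : ℝ≥0∞) + ENNReal.ofReal η) ^ 2 ∂μ) ^ (1 / 2 : ℝ) +
            ENNReal.ofReal η := by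
          gcongr with x
          rw [← ENNReal.ofReal_coe_nnreal, ← ENNReal.ofReal_coe_nnreal,
            ← ENNReal.ofReal_add (by positivity) hη.le]
          exact ENNReal.ofReal_le_ofReal (hiξ x)
        _ ≤ _ := by
          gcongr
          refine (lintegral_add_sq_rpow_le (by fun_prop) aemeasurable_const).trans ?_
          rw [lintegral_const, measure_univ, mul_one, sq_rpow_half]
    obtain ⟨π, ⟨hπ₁, hπ₂⟩, hπ⟩ :=
      exists_coupling_le (le_refl (W2 μ (forwardMarginal f g V₀ (T - u)))) hη0
    have w2 := h.W2_mixture_le hB hX hX_law hu huv hv hi hir (fun n => hY (r n)) hπ₁ hπ₂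
    calc _ ≤ _ := W2_triangle _ (Measure.sum fun n => μ (i ⁻¹' {n}) • Ψ (r n)) _
      _ ≤ _ + (_ + _) := add_le_add le_rfl
        (W2_triangle _ (Measure.sum fun n => μ (i ⁻¹' {n}) • P.map (Y (r n) v)) _)
      _ ≤ ENNReal.ofReal η + (((∫⁻ x, (ξ x : ℝ≥0∞) ^ 2 ∂μ) ^ (1 / 2 : ℝ) + ENNReal.ofReal η +
        ENNReal.ofReal η) + (ENNReal.ofReal a * (W2 μ (forwardMarginal f g V₀ (T - u)) +
          ENNReal.ofReal η + ENNReal.ofReal η) + I)) := by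
        refine add_le_add hW (add_le_add w1 (w2.trans ?_))
        gcongr
        exact (ENNReal.rpow_le_rpow hπ (by norm_num)).trans (add_sq_rpow_half_le _ _)
      _ = _ := by ring
  refine ENNReal.le_of_forall_pos_le_add fun t ht _ => ?_
  have ht' : (0 : ℝ) < t := ht
  -- the errors add up to `(3 + 2 a) η`
  have hη : 0 < (t : ℝ) / (3 + 2 * a) := by positivity
  refine (key _ hη).trans (le_of_eq ?_)
  have e : (t : ℝ≥0∞) = (3 + 2 * ENNReal.ofReal a) * ENNReal.ofReal ((t : ℝ) / (3 + 2 * a)) := by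
    have : 3 + 2 * ENNReal.ofReal a = ENNReal.ofReal (3 + 2 * a) := by
      rw [ENNReal.ofReal_add (by norm_num) (by positivity), ENNReal.ofReal_mul (by norm_num)]
      simp
    rw [this, ← ENNReal.ofReal_mul (by positivity), mul_div_cancel₀ _ (by positivity),
      ENNReal.ofReal_coe_nnreal]
  rw [e]
  ring

end OneStep

/-! ### Telescoping over the grid -/

section Telescoping

lemma le_add_sum_of_succ_le {N : ℕ} (A : Fin (N + 1) → ℝ≥0∞) (a : Fin N → ℝ≥0∞)
    (h : ∀ k : Fin N, A k.succ ≤ A k.castSucc + a k) : A (Fin.last N) ≤ A 0 + ∑ k, a k := by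
  induction N with
  | zero => simp
  | succ N ih =>
    have h1 := ih (fun k => A k.castSucc) (fun k => a k.castSucc) fun k => h k.castSucc
    have h2 := h (Fin.last N)
    rw [Fin.sum_univ_castSucc, ← add_assoc]
    exact h2.trans (add_le_add h1 le_rfl)

variable {d : ℕ}

lemma forwardMarginal_zero (f g : ℝ → ℝ) (V₀ : E d → ℝ) :
    forwardMarginal f g V₀ 0 = dataLaw V₀ := by
  have h1 : aCoef f 0 = 1 := by simp [aCoef]
  have h2 : sigmaSq f g 0 = 0 := by simp [sigmaSq]
  have : SFinite (dataLaw V₀) := by unfold dataLaw; infer_instance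
  simp only [forwardMarginal, h1, h2, one_smul, Real.sqrt_zero, zero_smul, Measure.map_const,
    measure_univ, Measure.map_id', Measure.conv_dirac_zero]

variable {T : ℝ} {f g : ℝ → ℝ} {V₀ : E d → ℝ} {sθ : ℝ → E d → E d} {α M : ℝ} {ε ℓ : ℝ → ℝ}

lemma Setting.integral_error_nonneg (h : Setting T f g V₀ sθ α M ε ℓ) {p q : ℝ} (hp : 0 ≤ p)
    (hpq : p ≤ q) (hq : q ≤ T) :
    0 ≤ ∫ s in p..q, Real.exp (Gam f g α M ℓ s) * g s ^ 2 * ε s := by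
  rw [intervalIntegral.integral_of_le hpq]
  refine setIntegral_nonneg measurableSet_Ioc fun s hs => ?_
  have := h.errorL2.nonneg s ⟨hp.trans_lt hs.1, hs.2.trans hq⟩
  positivity

lemma Setting.intervalIntegrable_error (h : Setting T f g V₀ sθ α M ε ℓ) {p q : ℝ} (hp : 0 ≤ p)
    (hpq : p ≤ q) (hq : q ≤ T) :
    IntervalIntegrable (fun s => Real.exp (Gam f g α M ℓ s) * g s ^ 2 * ε s) volume p q :=
  (intervalIntegrable_iff_integrableOn_Icc_of_le hpq).2
    (h.integrableOn_error.mono_set (Icc_subset_Icc hp hq))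

end Telescoping

end ReverseDiffusion

end

theorem mainTheorem7 {d : ℕ} {T : ℝ} (hT : 0 < T)
    -- the schedule and the data law
    (f g : ℝ → ℝ) (hf_meas : Measurable f) (hg_meas : Measurable g)
    (hf_nonneg : ∀ s ∈ Set.Icc 0 T, 0 ≤ f s) (hg_nonneg : ∀ s ∈ Set.Icc 0 T, 0 ≤ g s)
    (hg_pos : ∀ s ∈ Set.Ioc 0 T, 0 < g s)
    (hf_int : IntegrableOn f (Set.Ioc 0 T)) (hg_int : IntegrableOn (fun s => g s ^ 2) (Set.Ioc 0 T))
    (V₀ : ReverseDiffusion.E d → ℝ) (hV₀ : ContDiff ℝ 1 V₀)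
    (hV₀_int : Integrable (fun x => Real.exp (-V₀ x)))
    -- the learned score and the structural assumptions
    (sθ : ℝ → ReverseDiffusion.E d → ReverseDiffusion.E d)
    (hsθ : Measurable (Function.uncurry sθ))
    (α M : ℝ) (ε ℓ : ℝ → ℝ)
    (hweak : ReverseDiffusion.WeakLogConcave V₀ α M)
    (hL2 : ReverseDiffusion.ScoreErrorL2 f g V₀ sθ T ε)
    (hmono : ReverseDiffusion.ScoreErrorMonotone f g V₀ sθ T ℓ)
    (hΓ : IntegrableOn (ReverseDiffusion.load f g α M ℓ) (Set.Ioc 0 T))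
    -- a complete filtered probability space with a Brownian motion
    {Ω : Type*} {mΩ : MeasurableSpace Ω} (P : Measure Ω) [IsProbabilityMeasure P]
    (F : Filtration ℝ mΩ) (hF : ∀ A : Set Ω, MeasurableSet A → P A = 0 → MeasurableSet[F 0] A)
    (B : ℝ → Ω → ReverseDiffusion.E d) (hB : ReverseDiffusion.IsBrownianMotion F B P)
    -- the ideal reverse trajectory on `[0, T]`
    (X : ℝ → Ω → ReverseDiffusion.E d)
    (hX : ReverseDiffusion.IsSolution F B P
      (ReverseDiffusion.reverseDrift f g T (ReverseDiffusion.score f g V₀)) (fun t => g (T - t))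
      0 T (X 0) X)
    (hX_law : ∀ t ∈ Set.Icc 0 T, P.map (X t) = ReverseDiffusion.forwardMarginal f g V₀ (T - t))
    -- the grid and strong well posedness of the learned reverse equation
    {N : ℕ} (t : Fin (N + 1) → ℝ) (ht : StrictMono t) (ht0 : t 0 = 0) (htN : t (Fin.last N) = T)
    (hwp : ∀ k : Fin N, ReverseDiffusion.StronglyWellPosed F B P
      (ReverseDiffusion.reverseDrift f g T sθ) (fun r => g (T - r)) (t k.castSucc) T)
    -- the numerical chain, started from the law `pHat`
    {Ω' : Type*} {mΩ' : MeasurableSpace Ω'} (Q : Measure Ω') [IsProbabilityMeasure Q]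
    (pHat : Measure (ReverseDiffusion.E d))
    (Ψ : Fin N → Kernel (ReverseDiffusion.E d) (ReverseDiffusion.E d)) [∀ k, IsMarkovKernel (Ψ k)]
    (Z : Fin (N + 1) → Ω' → ReverseDiffusion.E d)
    (hZ0 : HasLaw (Z 0) pHat Q)
    (hZ : ∀ k : Fin N, HasCondDistrib (Z k.succ) (Z k.castSucc) (Ψ k) Q)
    (hZ_mom : ∀ k, MemLp (Z k) 2 Q)
    -- the one-step defects
    (ξ : Fin N → ReverseDiffusion.E d → ℝ≥0) (hξ_meas : ∀ k, Measurable (ξ k))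
    (hξ : ∀ (k : Fin N) (x : ReverseDiffusion.E d),
      ReverseDiffusion.W2
        (ReverseDiffusion.transitionLaw B P (ReverseDiffusion.reverseDrift f g T sθ)
          (fun r => g (T - r)) (t k.castSucc) (t k.succ) x)
        (Ψ k x) ≤ (ξ k x : ℝ≥0∞)) :
    ReverseDiffusion.W2 (Q.map (Z (Fin.last N))) (ReverseDiffusion.dataLaw V₀) ≤
      ENNReal.ofReal (Real.exp (ReverseDiffusion.Gam f g α M ℓ T)) *
          ReverseDiffusion.W2 pHat (ReverseDiffusion.forwardMarginal f g V₀ T)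
      + ∑ k : Fin N,
          ENNReal.ofReal (Real.exp (ReverseDiffusion.Gam f g α M ℓ (T - t k.succ))) *
            (∫⁻ ω, (ξ k (Z k.castSucc ω) : ℝ≥0∞) ^ 2 ∂Q) ^ (1 / 2 : ℝ)
      + ENNReal.ofReal (∫ s in (0 : ℝ)..T,
          Real.exp (ReverseDiffusion.Gam f g α M ℓ s) * g s ^ 2 * ε s) := by
  have h : ReverseDiffusion.Setting T f g V₀ sθ α M ε ℓ :=
    ⟨hT, hf_meas, hg_meas, hg_pos, hf_int, hg_int, hV₀, hV₀_int, hsθ, hweak, hL2, hmono, hΓ⟩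
  have htT : ∀ k, t k ∈ Set.Icc 0 T := fun k => by
    rw [← ht0, ← htN]
    exact ⟨ht.monotone (Fin.zero_le k), ht.monotone (Fin.le_last k)⟩
  set Γ := ReverseDiffusion.Gam f g α M ℓ with hΓdef
  set J : ℝ → ℝ := fun s => Real.exp (Γ s) * g s ^ 2 * ε s with hJ
  -- the weighted distance at the grid times plus the error still to be incurred telescopes
  set A : Fin (N + 1) → ℝ≥0∞ := fun k =>
    ENNReal.ofReal (Real.exp (Γ (T - t k))) *
      ReverseDiffusion.W2 (Q.map (Z k)) (ReverseDiffusion.forwardMarginal f g V₀ (T - t k)) +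
    ENNReal.ofReal (∫ s in (0 : ℝ)..(T - t k), J s) with hA
  have hstep : ∀ k : Fin N, A k.succ ≤ A k.castSucc +
      ENNReal.ofReal (Real.exp (Γ (T - t k.succ))) *
        (∫⁻ ω, (ξ k (Z k.castSucc ω) : ℝ≥0∞) ^ 2 ∂Q) ^ (1 / 2 : ℝ) := by
    intro k
    have hu := (htT k.castSucc).1
    have hv := (htT k.succ).2
    have huv : t k.castSucc ≤ t k.succ := (ht Fin.castSucc_lt_succ).le
    have hZm : AEMeasurable (Z k.castSucc) Q := (hZ_mom _).1.aemeasurable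
    have hZm' : AEMeasurable (Z k.succ) Q := (hZ_mom _).1.aemeasurable
    have : IsProbabilityMeasure (Q.map (Z k.castSucc)) := Measure.isProbabilityMeasure_map hZm
    have hlaw : Q.map (Z k.succ) = Ψ k ∘ₘ Q.map (Z k.castSucc) := by
      rw [← Measure.snd_compProd, ← (hZ k).map_eq, Measure.snd_map_prodMk₀ hZm]
    have hmom : MemLp id 2 (Ψ k ∘ₘ Q.map (Z k.castSucc)) := by
      rw [← hlaw]
      exact (memLp_map_measure_iff (by fun_prop) hZm').2 (hZ_mom k.succ)
    have hW := h.W2_step_le hB hX hX_law hu huv hv (hwp k) (Q.map (Z k.castSucc)) (Ψ k) hmom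
      (hξ_meas k) (hξ k)
    rw [← hlaw, lintegral_map' (by fun_prop) hZm] at hW
    have hJu : 0 ≤ ∫ s in (T - t k.succ)..(T - t k.castSucc), J s :=
      h.integral_error_nonneg (by linarith) (by linarith) (by linarith)
    have hJv : 0 ≤ ∫ s in (0 : ℝ)..(T - t k.succ), J s :=
      h.integral_error_nonneg le_rfl (by linarith) (by linarith [(htT k.succ).1])
    have hadd : (∫ s in (0 : ℝ)..(T - t k.castSucc), J s) =
        (∫ s in (T - t k.succ)..(T - t k.castSucc), J s) + ∫ s in (0 : ℝ)..(T - t k.succ), J s := by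
      rw [add_comm]
      exact (intervalIntegral.integral_add_adjacent_intervals
        (h.intervalIntegrable_error le_rfl (by linarith) (by linarith [(htT k.succ).1]))
        (h.intervalIntegrable_error (by linarith) (by linarith) (by linarith))).symm
    have hexp : ∀ c : ℝ, ENNReal.ofReal (Real.exp (Γ (T - t k.succ))) *
        ENNReal.ofReal (Real.exp (-Γ (T - t k.succ)) * c) = ENNReal.ofReal c := fun c => by
      rw [← ENNReal.ofReal_mul (Real.exp_pos _).le, ← mul_assoc, ← Real.exp_add, add_neg_cancel,
        Real.exp_zero, one_mul]
    have hexp' : ENNReal.ofReal (Real.exp (Γ (T - t k.succ))) *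
        ENNReal.ofReal (Real.exp (Γ (T - t k.castSucc) - Γ (T - t k.succ))) =
        ENNReal.ofReal (Real.exp (Γ (T - t k.castSucc))) := by
      rw [← ENNReal.ofReal_mul (Real.exp_pos _).le, ← Real.exp_add, add_sub_cancel]
    simp only [hA]
    rw [hadd, ENNReal.ofReal_add hJu hJv]
    refine (add_le_add (mul_le_mul_right hW _) le_rfl).trans (le_of_eq ?_)
    rw [mul_add, mul_add, ← mul_assoc _ (ENNReal.ofReal (Real.exp _)), hexp', hexp]
    ring
  have hfin := ReverseDiffusion.le_add_sum_of_succ_le A _ hstep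
  have hΓ0 : Γ 0 = 0 := by simp [hΓdef, ReverseDiffusion.Gam]
  have hlast : ReverseDiffusion.W2 (Q.map (Z (Fin.last N))) (ReverseDiffusion.dataLaw V₀) ≤
      A (Fin.last N) := by
    simp only [hA, htN, sub_self, hΓ0, ReverseDiffusion.forwardMarginal_zero]
    simp
  refine (hlast.trans hfin).trans (le_of_eq ?_)
  simp only [hA, ht0, sub_zero, hZ0.map_eq]
  ring
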